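/- Let $n\ge 2$, $N=\tfrac12(n+1)(n+2)$, and let indices $i,j,k,l$ run from $1$ to $n$. Let $Y^{2n+1}$ be a smooth contact manifold, let $Z\to Y$ be its bundle of Legendrian $n$-planes (or an open part of that bundle), so $\dim Z=N+n$, and let $\mathcal I$ be a smooth Frobenius (i.e. integrable Pfaffian) system of rank $N$ on $Z$ whose leaves are canonical lifts of Legendrian submanifolds of $Y$ (a Legendrian submanifold path geometry). An adapted coframe field on an open subset of $Z$ is a smooth coframe field $(\theta_0,\theta_i,\Theta_{ij}=\Theta_{ji},\omega^i)$ such that $\theta_0$ is a multiple of the pulled back contact form, $\mathcal I$ is spanned by $\theta_0,\theta_i,\Theta_{ij}$, and $$d\theta_0\equiv-\sum_k\theta_k\wedge\omega^k \bmod \theta_0,\qquad d\theta_i\equiv-\sum_k\Theta_{ik}\wedge\omega^k \bmod \theta_0,\theta,\qquad d\Theta_{ij}\equiv 0 \bmod \theta_0,\theta,\Theta .$$ The values of the local adapted coframe fields form a bundle $F_1\to Z$ on whose fibres the group $H_1$ of the transformations $$\theta_0^*=\lambda\theta_0,\quad \theta^*=A(\theta+b\,\theta_0),\quad \Theta^*=\tfrac1\lambda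 A\Big(\Theta+e\,\theta_0+\sum_k A_k\theta_k\Big)A^t,\quad \omega^*=\lambda A^{-t}(\omega+c\,\theta)+f\,\theta_0$$ acts simply transitively, where $\lambda\ne0$, $A\in GL(n,\mathbb R)$, $b,f\in\mathbb R^n$, and $e,c,A_k$ are symmetric $n\times n$ matrices. Denote the tautological forms on $F_1$ again by $\theta_0,\theta=(\theta_i),\Theta=(\Theta_{ij}),\omega=(\omega^i)$. A pseudoconnection on $F_1$ is a smooth $1$-form on $F_1$ with values in the Lie algebra of $H_1$ that restricts to the Maurer–Cartan form on every fibre of $F_1\to Z$. Its components are $1$-forms $\rho$ (scalar), $\alpha$ ($\mathfrak{gl}(n,\mathbb R)$-valued), $\beta,\mu$ ($\mathbb R^n$-valued) and $\epsilon,\pi^k,\gamma$ (valued in symmetric matrices), corresponding to the negatives of the infinitesimal parameters $\dot\lambda,\dot A,\dot b,\dot f,\dot e,\dot A_k,\dot c$ of the above transformations. **Proposition 1.** There exists a pseudoconnection on $F_1$ for which $$\begin{aligned} d\theta_0&=-\rho\wedge\theta_0-\theta^t\wedge\omega,\\ d\theta&=-\beta\wedge\theta_0-\alpha\wedge\theta-\Theta\wedge\omega,\\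 d\Theta&=-\epsilon\wedge\theta_0-\sum_k\pi^k\wedge\theta_k-\Big(\alpha-\frac{\rho}{2}\Big)\wedge\Theta+\Theta\wedge\Big(\alpha-\frac{\rho}{2}\Big)^t+T_0,\\ d\omega&=-\mu\wedge\theta_0-\gamma\wedge\theta+(\alpha^t-\rho)\wedge\omega, \end{aligned}$$ where $T_0=\sum_{ij}\Theta_{ij}\wedge\tau^{ij}$ for smooth $1$-forms $\tau^{ij}=\tau^{ji}$ on $F_1$ with values in the symmetric $n\times n$ matrices that satisfy $\tau^{ij}\wedge\omega=0$. -/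

import Mathlib

open Bundle Set
open scoped Manifold ContDiff Topology

/-! ### Differential one-forms on manifolds and on subsets of manifolds -/

section Forms

variable {E H M F : Type*} [NormedAddCommGroup E] [NormedSpace ℝ E] [TopologicalSpace H]
  [TopologicalSpace M] [ChartedSpace H M] [NormedAddCommGroup F] [NormedSpace ℝ F]

/-- The `F`-valued one-form `η` on `M` is smooth on `U` (as a section of the bundle
`Hom(TM, F)`). -/
def IsSmoothFormOn (I : ModelWithCorners ℝ E H) [IsManifold I 1 M]
    (η : ∀ x : M, TangentSpace I x →L[ℝ] F) (U : Set M) : Prop :=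
  ContMDiffOn I (I.prod 𝓘(ℝ, E →L[ℝ] F)) ∞
    (fun x => TotalSpace.mk' (E →L[ℝ] F)
      (E := fun x : M => TangentSpace I x →L[ℝ] Bundle.Trivial M F x) x (η x)) U

/-- The exterior derivative of an `F`-valued one-form on a manifold without boundary: pull the form
back to the model vector space by the inverse of the preferred chart at `x`, and take
`dη(v, w) = (D_v η)(w) - (D_w η)(v)` there. (The tangent space at `x` is the model space `E`, by
the preferred chart at `x`.) -/
noncomputable def extD (I : ModelWithCorners ℝ E H)
    (η : ∀ x : M, TangentSpace I x →L[ℝ] F) (x : M) (v w : TangentSpace I x) : F :=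
  let η' : E → (E →L[ℝ] F) := fun y =>
    (η ((extChartAt I x).symm y)).comp (mfderiv 𝓘(ℝ, E) I (extChartAt I x).symm y)
  (fderiv ℝ η' (extChartAt I x x) v) w - (fderiv ℝ η' (extChartAt I x x) w) v

/-- The wedge product of two scalar one-forms on a vector space. -/
def wedge {T : Type*} (a b : T → ℝ) (v w : T) : ℝ := a v * b w - a w * b v

/-- The vectors tangent to a subset `S` of `M` at `p`: the velocities at time `0` of the smooth
curves in `M` that stay in `S` and start at `p`. If `S` is an embedded submanifold, this is its
tangent space. -/
def tangentVectors (I : ModelWithCorners ℝ E H) (S : Set M) (p : M) : Set (TangentSpace I p) :=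
  {v | ∃ c : ℝ → M, ContMDiff 𝓘(ℝ, ℝ) I ∞ c ∧ (∀ t, c t ∈ S) ∧ c 0 = p ∧
    (mfderiv 𝓘(ℝ, ℝ) I c 0 (1 : ℝ) : E) = v}

/-- `η` is a smooth one-form on the subset `S` of `M`: on vectors tangent to `S` it agrees, near
every point of `S`, with a smooth one-form on an open subset of `M`. If `S` is an embedded
submanifold, these are the smooth one-forms on that manifold. -/
def IsSmoothFormOnSubset (I : ModelWithCorners ℝ E H) [IsManifold I 1 M]
    (η : ∀ x : M, TangentSpace I x →L[ℝ] F) (S : Set M) : Prop :=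
  ∀ p ∈ S, ∃ O : Set M, IsOpen O ∧ p ∈ O ∧ ∃ η' : ∀ x : M, TangentSpace I x →L[ℝ] F,
    IsSmoothFormOn I η' O ∧ ∀ q ∈ S ∩ O, ∀ v ∈ tangentVectors I S q, η q v = η' q v

end Forms

/-! ### Contact manifolds, Legendrian planes, Legendrian submanifold path geometries -/

/-- `N = (n + 1)(n + 2) / 2`. -/
abbrev dimN (n : ℕ) : ℕ := (n + 1) * (n + 2) / 2

/-- The dimension `N + n` of the bundle of Legendrian planes. -/
abbrev dimZ (n : ℕ) : ℕ := dimN n + n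

section Contact

variable (n : ℕ) {Y : Type*} [TopologicalSpace Y]
  [ChartedSpace (EuclideanSpace ℝ (Fin (2 * n + 1))) Y] [IsManifold (𝓡 (2 * n + 1)) ∞ Y]

/-- `θ ∧ (dθ)^n ≠ 0` at `y`. (The sum is `θ ∧ (dθ)^n` evaluated on `v`, up to a nonzero constant.) -/
def IsContactFormAt (θ : ∀ y : Y, TangentSpace (𝓡 (2 * n + 1)) y →L[ℝ] ℝ) (y : Y) : Prop :=
  ∃ v : Fin (2 * n + 1) → TangentSpace (𝓡 (2 * n + 1)) y,
    ∑ s : Equiv.Perm (Fin (2 * n + 1)), ((Equiv.Perm.sign s : ℤ) : ℝ) *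
      (θ y (v (s ⟨0, by omega⟩)) *
        ∏ i : Fin n, extD (𝓡 (2 * n + 1)) θ y
          (v (s ⟨2 * i.1 + 1, by omega⟩)) (v (s ⟨2 * i.1 + 2, by omega⟩))) ≠ 0

/-- `θ` is a local generator, on the open set `U`, of the contact structure whose hyperplane field
is `D`: a smooth contact form on `U` with kernel `D`. -/
def IsContactGenerator (D : ∀ y : Y, Submodule ℝ (TangentSpace (𝓡 (2 * n + 1)) y))
    (θ : ∀ y : Y, TangentSpace (𝓡 (2 * n + 1)) y →L[ℝ] ℝ) (U : Set Y) : Prop :=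
  IsOpen U ∧ IsSmoothFormOn (𝓡 (2 * n + 1)) θ U ∧
    ∀ y ∈ U, IsContactFormAt n θ y ∧ ∀ v, v ∈ D y ↔ θ y v = 0

/-- The hyperplane field `D` is a contact structure: it is locally the kernel of a contact form
(which is then defined up to multiplication by a nonzero function). -/
def IsContactStructure (D : ∀ y : Y, Submodule ℝ (TangentSpace (𝓡 (2 * n + 1)) y)) : Prop :=
  ∀ y : Y, ∃ U : Set Y, ∃ θ : ∀ y : Y, TangentSpace (𝓡 (2 * n + 1)) y →L[ℝ] ℝ,
    y ∈ U ∧ IsContactGenerator n D θ U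

/-- `L` is a Legendrian `n`-plane at `y`: an `n`-dimensional subspace of the tangent space on which
`θ₀` and `dθ₀` vanish, for the local generators `θ₀` of the contact structure. -/
def IsLegendrianPlane (D : ∀ y : Y, Submodule ℝ (TangentSpace (𝓡 (2 * n + 1)) y)) (y : Y)
    (L : Submodule ℝ (TangentSpace (𝓡 (2 * n + 1)) y)) : Prop :=
  Module.finrank ℝ L = n ∧
    ∀ (U : Set Y) (θ : ∀ y : Y, TangentSpace (𝓡 (2 * n + 1)) y →L[ℝ] ℝ),
      y ∈ U → IsContactGenerator n D θ U →
        (∀ v ∈ L, θ y v = 0) ∧ ∀ v ∈ L, ∀ w ∈ L, extD (𝓡 (2 * n + 1)) θ y v w = 0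

/-- The family of `n`-planes `P t` in the tangent spaces of `Y` at `b t`, for `t` in the open subset
`U` of a Euclidean space, is smooth: `P` is locally spanned by `n` smooth vector fields along `b`. -/
def IsSmoothPlaneFamily {k : ℕ} (U : Set (EuclideanSpace ℝ (Fin k)))
    (b : EuclideanSpace ℝ (Fin k) → Y)
    (P : ∀ t, Submodule ℝ (TangentSpace (𝓡 (2 * n + 1)) (b t))) : Prop :=
  ContMDiffOn (𝓡 k) (𝓡 (2 * n + 1)) ∞ b U ∧
    ∀ t₀ ∈ U, ∃ V : Set (EuclideanSpace ℝ (Fin k)), IsOpen V ∧ t₀ ∈ V ∧ V ⊆ U ∧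
      ∃ e : Fin n → ∀ t, TangentSpace (𝓡 (2 * n + 1)) (b t),
        (∀ i, ContMDiffOn (𝓡 k) (𝓡 (2 * n + 1)).tangent ∞
          (fun t => (⟨b t, e i t⟩ : TangentBundle (𝓡 (2 * n + 1)) Y)) V) ∧
        ∀ t ∈ V, Submodule.span ℝ (range fun i => e i t) = P t

variable (Y) (Z : Type*) [TopologicalSpace Z]
  [ChartedSpace (EuclideanSpace ℝ (Fin (dimZ n))) Z] [IsManifold (𝓡 (dimZ n)) ∞ Z]

/-- A Legendrian submanifold path geometry: a contact manifold `Y` of dimension `2n + 1`, the bundle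
`Z → Y` of its Legendrian `n`-planes (or an open part of it), and a Frobenius system on `Z` whose
leaves are the canonical lifts of Legendrian submanifolds of `Y`. -/
structure LegendrianPathGeometry where
  /-- The contact hyperplanes. -/
  D : ∀ y : Y, Submodule ℝ (TangentSpace (𝓡 (2 * n + 1)) y)
  contact : IsContactStructure n D
  /-- The projection `Z → Y`. -/
  proj : Z → Y
  /-- The Legendrian `n`-plane at `proj z` that the point `z` stands for. -/
  plane : ∀ z : Z, Submodule ℝ (TangentSpace (𝓡 (2 * n + 1)) (proj z))
  legendrian : ∀ z, IsLegendrianPlane n D (proj z) (plane z)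
  /-- Different points of `Z` stand for different planes. -/
  injective : Function.Injective fun z =>
    (⟨proj z, plane z⟩ : Σ y : Y, Submodule ℝ (TangentSpace (𝓡 (2 * n + 1)) y))
  smooth_proj : ContMDiff (𝓡 (dimZ n)) (𝓡 (2 * n + 1)) ∞ proj
  /-- The smooth structure of `Z` is that of the bundle of Legendrian planes: a map into `Z` is
  smooth exactly if the family of planes that it stands for is smooth. (As `Z` has the dimension of
  the bundle of all Legendrian planes, it is thus an open part of that bundle.) -/
  smooth_iff : ∀ (k : ℕ) (U : Set (EuclideanSpace ℝ (Fin k))), IsOpen U →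
    ∀ f : EuclideanSpace ℝ (Fin k) → Z,
      ContMDiffOn (𝓡 k) (𝓡 (dimZ n)) ∞ f U ↔
        IsSmoothPlaneFamily n U (fun t => proj (f t)) (fun t => plane (f t))
  /-- The differential system on `Z` that defines the foliation: the conormal spaces of the
  leaves. -/
  sys : ∀ z : Z, Submodule ℝ (TangentSpace (𝓡 (dimZ n)) z →L[ℝ] ℝ)
  /-- The system is smooth, of rank `N`. -/
  sys_smooth : ∀ z : Z, ∃ U : Set Z, IsOpen U ∧ z ∈ U ∧
    ∃ η : Fin (dimN n) → ∀ z : Z, TangentSpace (𝓡 (dimZ n)) z →L[ℝ] ℝ,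
      (∀ a, IsSmoothFormOn (𝓡 (dimZ n)) (η a) U) ∧
      ∀ x ∈ U, LinearIndependent ℝ (fun a => η a x) ∧
        Submodule.span ℝ (range fun a => η a x) = sys x
  /-- The system is Frobenius: `dη ≡ 0` modulo the system, for every `η` in it. -/
  sys_frobenius : ∀ (U : Set Z) (η : ∀ z : Z, TangentSpace (𝓡 (dimZ n)) z →L[ℝ] ℝ),
    IsOpen U → IsSmoothFormOn (𝓡 (dimZ n)) η U → (∀ z ∈ U, η z ∈ sys z) →
    ∀ z ∈ U, ∀ v w : TangentSpace (𝓡 (dimZ n)) z,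
      (∀ ξ ∈ sys z, ξ v = 0) → (∀ ξ ∈ sys z, ξ w = 0) → extD (𝓡 (dimZ n)) η z v w = 0
  /-- The leaves are canonical lifts: the tangent space of the leaf through `z` projects onto the
  plane that `z` stands for. -/
  lift : ∀ (z : Z) (x : TangentSpace (𝓡 (2 * n + 1)) (proj z)), x ∈ plane z ↔
    ∃ v : TangentSpace (𝓡 (dimZ n)) z, (∀ ξ ∈ sys z, ξ v = 0) ∧
      mfderiv (𝓡 (dimZ n)) (𝓡 (2 * n + 1)) proj z v = x

end Contact

/-! ### Coframes -/

/-- Real symmetric `n` by `n` matrices. -/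
def symMat (n : ℕ) : Submodule ℝ (Fin n → Fin n → ℝ) where
  carrier := {m | ∀ i j, m i j = m j i}
  add_mem' := fun ha hb i j => by simp [ha i j, hb i j]
  zero_mem' := fun _ _ => rfl
  smul_mem' := fun c a ha i j => by simp [ha i j]

/-- The vector space in which coframes take their values; its elements are
`(θ₀, (θ_i), (Θ_ij), (ω^i))` with `Θ` symmetric. -/
def CoV (n : ℕ) : Type := ℝ × (Fin n → ℝ) × symMat n × (Fin n → ℝ)

noncomputable instance (n : ℕ) : NormedAddCommGroup (CoV n) :=
  inferInstanceAs (NormedAddCommGroup (ℝ × (Fin n → ℝ) × symMat n × (Fin n → ℝ)))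

noncomputable instance (n : ℕ) : NormedSpace ℝ (CoV n) :=
  inferInstanceAs (NormedSpace ℝ (ℝ × (Fin n → ℝ) × symMat n × (Fin n → ℝ)))

/-- The component `θ₀`. -/
noncomputable def coTh0 (n : ℕ) : CoV n →L[ℝ] ℝ :=
  ContinuousLinearMap.fst ℝ ℝ ((Fin n → ℝ) × symMat n × (Fin n → ℝ))

/-- The component `θ_i`. -/
noncomputable def coTh {n : ℕ} (i : Fin n) : CoV n →L[ℝ] ℝ :=
  (ContinuousLinearMap.proj (R := ℝ) (φ := fun _ : Fin n => ℝ) i).comp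
    ((ContinuousLinearMap.fst ℝ (Fin n → ℝ) (symMat n × (Fin n → ℝ))).comp
      (ContinuousLinearMap.snd ℝ ℝ ((Fin n → ℝ) × symMat n × (Fin n → ℝ))))

/-- The component `Θ_ij`. -/
noncomputable def coTT {n : ℕ} (i j : Fin n) : CoV n →L[ℝ] ℝ :=
  (((ContinuousLinearMap.proj (R := ℝ) (φ := fun _ : Fin n => ℝ) j).comp
    (ContinuousLinearMap.proj (R := ℝ) (φ := fun _ : Fin n => Fin n → ℝ) i)).comp
      (symMat n).subtypeL).comp
    ((ContinuousLinearMap.fst ℝ (symMat n) (Fin n → ℝ)).comp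
      ((ContinuousLinearMap.snd ℝ (Fin n → ℝ) (symMat n × (Fin n → ℝ))).comp
        (ContinuousLinearMap.snd ℝ ℝ ((Fin n → ℝ) × symMat n × (Fin n → ℝ)))))

/-- The component `ω^i`. -/
noncomputable def coOm {n : ℕ} (i : Fin n) : CoV n →L[ℝ] ℝ :=
  (ContinuousLinearMap.proj (R := ℝ) (φ := fun _ : Fin n => ℝ) i).comp
    ((ContinuousLinearMap.snd ℝ (symMat n) (Fin n → ℝ)).comp
      ((ContinuousLinearMap.snd ℝ (Fin n → ℝ) (symMat n × (Fin n → ℝ))).comp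
        (ContinuousLinearMap.snd ℝ ℝ ((Fin n → ℝ) × symMat n × (Fin n → ℝ)))))

section Coframes

variable (n : ℕ) (Z : Type*) [TopologicalSpace Z]
  [ChartedSpace (EuclideanSpace ℝ (Fin (dimZ n))) Z] [IsManifold (𝓡 (dimZ n)) ∞ Z]

/-- The manifold of all pairs `(z, u)` with `z` in `Z` and `u : T_z Z → CoV n` linear, the total
space of the vector bundle `Hom(TZ, CoV n)`. The coframes of `Z` are the pairs with `u` bijective;
they form an open subset. -/
abbrev CoframeSpace : Type _ :=
  TotalSpace (EuclideanSpace ℝ (Fin (dimZ n)) →L[ℝ] CoV n)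
    (fun z : Z => TangentSpace (𝓡 (dimZ n)) z →L[ℝ] Bundle.Trivial Z (CoV n) z)

/-- The model with corners of the manifold `CoframeSpace n Z`. -/
noncomputable abbrev modelCo : ModelWithCorners ℝ
    (EuclideanSpace ℝ (Fin (dimZ n)) × (EuclideanSpace ℝ (Fin (dimZ n)) →L[ℝ] CoV n))
    (ModelProd (EuclideanSpace ℝ (Fin (dimZ n)))
      (EuclideanSpace ℝ (Fin (dimZ n)) →L[ℝ] CoV n)) :=
  (𝓡 (dimZ n)).prod 𝓘(ℝ, EuclideanSpace ℝ (Fin (dimZ n)) →L[ℝ] CoV n)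

variable {Z}

/-- The tautological `CoV n`-valued one-form on `CoframeSpace n Z`: at `(z, u)` it is `u` composed
with the differential of the projection to `Z`. -/
noncomputable def taut (p : CoframeSpace n Z) : TangentSpace (modelCo n) p →L[ℝ] CoV n :=
  ContinuousLinearMap.comp
    (show TangentSpace (𝓡 (dimZ n)) p.proj →L[ℝ] CoV n from p.snd)
    (mfderiv (modelCo n) (𝓡 (dimZ n)) (fun q : CoframeSpace n Z => q.proj) p)

variable {n} {Y : Type*} [TopologicalSpace Y]
  [ChartedSpace (EuclideanSpace ℝ (Fin (2 * n + 1))) Y] [IsManifold (𝓡 (2 * n + 1)) ∞ Y]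

/-- `s = (θ₀, θ, Θ, ω)` is an adapted coframe field on the open set `U`: `θ₀` is a multiple of the
(pulled back) contact form, the system is `{θ₀, θ_i, Θ_ij}`, and
`dθ₀ ≡ - ∑ θ_k ∧ ω^k mod θ₀`, `dθ_i ≡ - ∑ Θ_ik ∧ ω^k mod θ₀, θ`, `dΘ_ij ≡ 0 mod θ₀, θ, Θ`.
(A two-form is `0` modulo some independent one-forms exactly if it vanishes on their common
kernel.) -/
structure IsAdaptedCoframeField (G : LegendrianPathGeometry n Y Z) (U : Set Z)
    (s : ∀ z : Z, TangentSpace (𝓡 (dimZ n)) z →L[ℝ] CoV n) : Prop where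
  isOpen : IsOpen U
  smooth : IsSmoothFormOn (𝓡 (dimZ n)) s U
  coframe : ∀ z ∈ U, Function.Bijective (s z)
  contact : ∀ z ∈ U, ∀ v : TangentSpace (𝓡 (dimZ n)) z,
    coTh0 n (s z v) = 0 ↔ mfderiv (𝓡 (dimZ n)) (𝓡 (2 * n + 1)) G.proj z v ∈ G.D (G.proj z)
  sys : ∀ z ∈ U, G.sys z = Submodule.span ℝ
    ({(coTh0 n).comp (s z)} ∪ (range fun i => (coTh i).comp (s z)) ∪
      range fun ij : Fin n × Fin n => (coTT ij.1 ij.2).comp (s z))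
  d_th0 : ∀ z ∈ U, ∀ v w : TangentSpace (𝓡 (dimZ n)) z,
    coTh0 n (s z v) = 0 → coTh0 n (s z w) = 0 →
    coTh0 n (extD (𝓡 (dimZ n)) s z v w) =
      - ∑ k, wedge (fun x => coTh k (s z x)) (fun x => coOm k (s z x)) v w
  d_th : ∀ z ∈ U, ∀ v w : TangentSpace (𝓡 (dimZ n)) z,
    coTh0 n (s z v) = 0 → coTh0 n (s z w) = 0 →
    (∀ i, coTh i (s z v) = 0) → (∀ i, coTh i (s z w) = 0) →
    ∀ i, coTh i (extD (𝓡 (dimZ n)) s z v w) =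
      - ∑ k, wedge (fun x => coTT i k (s z x)) (fun x => coOm k (s z x)) v w
  d_TT : ∀ z ∈ U, ∀ v w : TangentSpace (𝓡 (dimZ n)) z,
    coTh0 n (s z v) = 0 → coTh0 n (s z w) = 0 →
    (∀ i, coTh i (s z v) = 0) → (∀ i, coTh i (s z w) = 0) →
    (∀ i j, coTT i j (s z v) = 0) → (∀ i j, coTT i j (s z w) = 0) →
    ∀ i j, coTT i j (extD (𝓡 (dimZ n)) s z v w) = 0

/-- The bundle `F₁` of adapted coframes: the values of the local adapted coframe fields. It is an
embedded submanifold of `CoframeSpace n Z`. -/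
def F1 (G : LegendrianPathGeometry n Y Z) : Set (CoframeSpace n Z) :=
  {p | ∃ (U : Set Z) (s : ∀ z : Z, TangentSpace (𝓡 (dimZ n)) z →L[ℝ] CoV n),
    p.proj ∈ U ∧ IsAdaptedCoframeField G U s ∧ p.snd = s p.proj}

end Coframes

/-! ### The structure group and pseudoconnections -/

/-- Parameters of the structure group `H₁`, and elements of its Lie algebra. Group parameters are
`(λ, A, b, e, (A_k), c, f)`, elements of the Lie algebra `(ρ, α, β, ε, (π^k), γ, μ)`, where
`e, A_k, c, ε, π^k, γ` are symmetric. -/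
abbrev H1Space (n : ℕ) : Type :=
  ℝ × (Fin n → Fin n → ℝ) × (Fin n → ℝ) × symMat n × (Fin n → symMat n) × symMat n × (Fin n → ℝ)

/-- The parameters of the neutral element of `H₁`. -/
noncomputable def h1One (n : ℕ) : H1Space n := (1, fun i j => if i = j then 1 else 0, 0, 0, 0, 0, 0)

/-- The action of `H₁` on coframes:
`θ₀* = λ θ₀`, `θ* = A (θ + b θ₀)`, `Θ* = λ⁻¹ A (Θ + e θ₀ + ∑ A_k θ_k) Aᵗ`,
`ω* = λ A⁻ᵗ (ω + c θ) + f θ₀`. -/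
noncomputable def h1Act {n : ℕ} : H1Space n → CoV n → CoV n
  | (lam, A, b, e, S, c, f), (x0, x, X, y) =>
    (lam * x0,
     fun i => ∑ j, A i j * (x j + b j * x0),
     ⟨fun i j => lam⁻¹ * ∑ k, ∑ l,
        A i k * (X.1 k l + e.1 k l * x0 + ∑ m, (S m).1 k l * x m) * A j l, by
        intro i j
        dsimp only
        rw [Finset.sum_comm]
        refine congrArg _ (Finset.sum_congr rfl fun l _ => Finset.sum_congr rfl fun k _ => ?_)
        have hX := X.2 k l
        have he := e.2 k l
        have hS : ∀ m, (S m).1 k l = (S m).1 l k := fun m => (S m).2 k l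
        simp only [hX, he, hS]
        ring⟩,
     fun i => lam * (∑ j, ((Matrix.of A)⁻¹) j i * (y j + ∑ k, c.1 j k * x k)) + f i * x0)

section PseudoConnection

variable {n : ℕ} {Y Z : Type*} [TopologicalSpace Y]
  [ChartedSpace (EuclideanSpace ℝ (Fin (2 * n + 1))) Y] [IsManifold (𝓡 (2 * n + 1)) ∞ Y]
  [TopologicalSpace Z]
  [ChartedSpace (EuclideanSpace ℝ (Fin (dimZ n))) Z] [IsManifold (𝓡 (dimZ n)) ∞ Z]

/-- A pseudoconnection on `F₁`: a smooth one-form on `F₁` with values in the Lie algebra of `H₁`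
that restricts to the Maurer-Cartan form on the fibres of `F₁ → Z`. A curve in a fibre of `F₁` has
the form `c t = h t • c 0` with `h` in `H₁`; as `H₁` acts on the right by `(u, h) ↦ h⁻¹ • u`, the
Maurer-Cartan form takes the value `- h'(0)` on `c'(0)`. -/
structure IsPseudoConnection (G : LegendrianPathGeometry n Y Z)
    (φ : ∀ p : CoframeSpace n Z, TangentSpace (modelCo n) p →L[ℝ] H1Space n) : Prop where
  smooth : IsSmoothFormOnSubset (modelCo n) φ (F1 G)
  fibre : ∀ (z : Z) (u : ℝ → (TangentSpace (𝓡 (dimZ n)) z →L[ℝ] CoV n)) (h : ℝ → H1Space n)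
    (X : H1Space n),
    (∀ t, (⟨z, u t⟩ : CoframeSpace n Z) ∈ F1 G) →
    ContMDiff 𝓘(ℝ, ℝ) (modelCo n) ∞ (fun t => (⟨z, u t⟩ : CoframeSpace n Z)) →
    (∀ t v, u t v = h1Act (h t) (u 0 v)) → h 0 = h1One n → HasDerivAt h X 0 →
    φ ⟨z, u 0⟩ (mfderiv 𝓘(ℝ, ℝ) (modelCo n) (fun t => (⟨z, u t⟩ : CoframeSpace n Z)) 0 (1 : ℝ)) = -X

/-- The component `ρ`. -/
def pcRho (x : H1Space n) : ℝ := x.1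

/-- The component `α_ij`. -/
def pcAlpha (i j : Fin n) (x : H1Space n) : ℝ := x.2.1 i j

/-- The component `β_i`. -/
def pcBeta (i : Fin n) (x : H1Space n) : ℝ := x.2.2.1 i

/-- The component `ε_ij`. -/
def pcEps (i j : Fin n) (x : H1Space n) : ℝ := x.2.2.2.1.1 i j

/-- The component `π^k_ij`. -/
def pcPi (k i j : Fin n) (x : H1Space n) : ℝ := (x.2.2.2.2.1 k).1 i j

/-- The component `γ_ij`. -/
def pcGamma (i j : Fin n) (x : H1Space n) : ℝ := x.2.2.2.2.2.1.1 i j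

/-- The component `μ_i`. -/
def pcMu (i : Fin n) (x : H1Space n) : ℝ := x.2.2.2.2.2.2 i

/-- The structure equations at the point `p`, on the vectors `v, w`, for the values `φ` of the
pseudoconnection and `τ = (τ^{ij})` at `p`:
`dθ₀ = - ρ ∧ θ₀ - θᵗ ∧ ω`,
`dθ = - β ∧ θ₀ - α ∧ θ - Θ ∧ ω`,
`dΘ = - ε ∧ θ₀ - ∑ π^k ∧ θ_k - (α - ρ/2) ∧ Θ + Θ ∧ (α - ρ/2)ᵗ + ∑ Θ_kl ∧ τ^{kl}`,
`dω = - μ ∧ θ₀ - γ ∧ θ + (αᵗ - ρ) ∧ ω`. -/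
structure StructureEquations (p : CoframeSpace n Z)
    (φ : TangentSpace (modelCo n) p →L[ℝ] H1Space n)
    (τ : TangentSpace (modelCo n) p →L[ℝ] (Fin n → Fin n → symMat n))
    (v w : TangentSpace (modelCo n) p) : Prop where
  d_th0 : coTh0 n (extD (modelCo n) (taut n) p v w) =
    - wedge (fun x => pcRho (φ x)) (fun x => coTh0 n (taut n p x)) v w
    - ∑ k, wedge (fun x => coTh k (taut n p x)) (fun x => coOm k (taut n p x)) v w
  d_th : ∀ i, coTh i (extD (modelCo n) (taut n) p v w) =
    - wedge (fun x => pcBeta i (φ x)) (fun x => coTh0 n (taut n p x)) v w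
    - ∑ j, wedge (fun x => pcAlpha i j (φ x)) (fun x => coTh j (taut n p x)) v w
    - ∑ j, wedge (fun x => coTT i j (taut n p x)) (fun x => coOm j (taut n p x)) v w
  d_TT : ∀ i j, coTT i j (extD (modelCo n) (taut n) p v w) =
    - wedge (fun x => pcEps i j (φ x)) (fun x => coTh0 n (taut n p x)) v w
    - ∑ k, wedge (fun x => pcPi k i j (φ x)) (fun x => coTh k (taut n p x)) v w
    - ∑ k, wedge (fun x => pcAlpha i k (φ x) - if i = k then pcRho (φ x) / 2 else 0)
        (fun x => coTT k j (taut n p x)) v w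
    + ∑ k, wedge (fun x => coTT i k (taut n p x))
        (fun x => pcAlpha j k (φ x) - if j = k then pcRho (φ x) / 2 else 0) v w
    + ∑ k, ∑ l, wedge (fun x => coTT k l (taut n p x)) (fun x => (τ x k l).1 i j) v w
  d_om : ∀ i, coOm i (extD (modelCo n) (taut n) p v w) =
    - wedge (fun x => pcMu i (φ x)) (fun x => coTh0 n (taut n p x)) v w
    - ∑ j, wedge (fun x => pcGamma i j (φ x)) (fun x => coTh j (taut n p x)) v w
    + ∑ j, wedge (fun x => pcAlpha j i (φ x) - if i = j then pcRho (φ x) else 0)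
        (fun x => coOm j (taut n p x)) v w

end PseudoConnection

/-! ### Linear algebra of the coframe space: Lie algebra action, model torsion, flag -/

section Algebra

variable {n : ℕ}

/-! Over the domain of an adapted coframe field S, write a coframe in F₁ as u = N S. The
tautological form is then N S, and its exterior derivative is dN N⁻¹ ∧ (N S) plus the torsion N dS,
expressed in the coframe u. The transition N preserves the flag {θ₀ = 0} ⊃ {θ₀ = θ = 0} ⊃ {θ₀ = θ =
Θ = 0} and, modulo its first two steps, the model torsion (-θᵗ ∧ ω, -Θ ∧ ω, 0, 0). Differentiating
these conditions along F₁ leaves exactly the Lie algebra of H₁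
(`IsInfinitesimalTransition.exists_infAct`). Hence -dN N⁻¹ is a pseudoconnection, and it remains one
after adding any horizontal form with values in the Lie algebra. Such a form must be chosen so as to
absorb the torsion.

Absorption is a problem at a single point (`IsAdaptedTorsion.absorb`). The torsion is an alternating
bilinear map T, adaptedness restricts it along the flag, and d² = 0 makes the cyclic sums of T(T(a,
b), c) vanish modulo the first two steps of the flag. The congruences for dθ₀ and dθ yield ρ, α, β.
Then d²θ₀ = 0 gives ∑ θ_i ∧ R(ω^i) ≡ 0 mod θ₀ for the remaining torsion R, and Cartan's lemma yields
a symmetric γ, and μ. Finally d²θ_i = 0 gives ∑ R(Θ_ik) ∧ ω^k ≡ 0 mod θ₀, θ. This excludes Θ ∧ Θ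
terms and turns the Θ ∧ ω terms into a τ with τ ∧ ω = 0. Integrability excludes ω ∧ ω terms, and ε
and π take everything else.

The absorption equations are linear, so a generalized inverse solves them linearly in the torsion
(`exists_linear_absorption`), and the resulting forms are smooth. The structure equations are affine
in the pseudoconnection and τ, so local solutions are glued by a partition of unity on Z
(`exists_isConnectionOver_iUnion`). -/

instance (n : ℕ) : FiniteDimensional ℝ (CoV n) :=
  inferInstanceAs (FiniteDimensional ℝ (ℝ × (Fin n → ℝ) × symMat n × (Fin n → ℝ)))

/-- The element of `CoV n` with given components. -/
def mkCo (x0 : ℝ) (x : Fin n → ℝ) (X : symMat n) (y : Fin n → ℝ) : CoV n := (x0, x, X, y)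

/-- The symmetric matrix `Θ`. -/
noncomputable def coSym : CoV n →ₗ[ℝ] symMat n :=
  LinearMap.fst ℝ (symMat n) (Fin n → ℝ) ∘ₗ
    LinearMap.snd ℝ (Fin n → ℝ) (symMat n × (Fin n → ℝ)) ∘ₗ
      LinearMap.snd ℝ ℝ ((Fin n → ℝ) × symMat n × (Fin n → ℝ))

@[simp] lemma coTh0_mkCo (x0 : ℝ) (x : Fin n → ℝ) (X : symMat n) (y : Fin n → ℝ) :
    coTh0 n (mkCo x0 x X y) = x0 := rfl
@[simp] lemma coTh_mkCo (x0 : ℝ) (x : Fin n → ℝ) (X : symMat n) (y : Fin n → ℝ) (i : Fin n) :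
    coTh i (mkCo x0 x X y) = x i := rfl
@[simp] lemma coTT_mkCo (x0 : ℝ) (x : Fin n → ℝ) (X : symMat n) (y : Fin n → ℝ) (i j : Fin n) :
    coTT i j (mkCo x0 x X y) = X.1 i j := rfl
@[simp] lemma coOm_mkCo (x0 : ℝ) (x : Fin n → ℝ) (X : symMat n) (y : Fin n → ℝ) (i : Fin n) :
    coOm i (mkCo x0 x X y) = y i := rfl
lemma coSym_apply (a : CoV n) (i j : Fin n) : (coSym a).1 i j = coTT i j a := rfl
lemma coTT_symm (a : CoV n) (i j : Fin n) : coTT i j a = coTT j i a := (coSym a).2 i j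

lemma CoV.ext_components {a b : CoV n} (h0 : coTh0 n a = coTh0 n b)
    (h1 : ∀ i, coTh i a = coTh i b) (h2 : ∀ i j, coTT i j a = coTT i j b)
    (h3 : ∀ i, coOm i a = coOm i b) : a = b :=
  Prod.ext h0 (Prod.ext (funext h1) (Prod.ext (Subtype.ext (funext fun i => funext (h2 i)))
    (funext h3)))

lemma symMat_symm (X : symMat n) (i j : Fin n) : X.1 i j = X.1 j i := X.2 i j

/-- The infinitesimal action of the Lie algebra of `H₁` on `CoV n`. -/
noncomputable def infAct : H1Space n →ₗ[ℝ] CoV n →ₗ[ℝ] CoV n :=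
  LinearMap.mk₂ ℝ (fun X a => mkCo (X.1 * coTh0 n a)
    (fun i => ∑ j, X.2.1 i j * coTh j a + X.2.2.1 i * coTh0 n a)
    ⟨fun i j => -(X.1 * coTT i j a) + ∑ k, (X.2.1 i k * coTT k j a + coTT i k a * X.2.1 j k)
      + X.2.2.2.1.1 i j * coTh0 n a + ∑ m, (X.2.2.2.2.1 m).1 i j * coTh m a, by
      intro i j
      dsimp only
      rw [coTT_symm a i j, symMat_symm X.2.2.2.1 i j]
      congr 1
      · congr 2
        refine Finset.sum_congr rfl fun k _ => ?_
        rw [coTT_symm a k j, coTT_symm a i k]; ring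
      · exact Finset.sum_congr rfl fun m _ => by rw [symMat_symm (X.2.2.2.2.1 m) i j]⟩
    (fun i => X.1 * coOm i a - ∑ j, X.2.1 j i * coOm j a + ∑ j, X.2.2.2.2.2.1.1 i j * coTh j a
      + X.2.2.2.2.2.2 i * coTh0 n a))
  (by
    intro X Y a
    apply CoV.ext_components <;> intros <;>
      simp [add_mul, mul_add, Finset.sum_add_distrib] <;> ring)
  (by
    intro c X a
    apply CoV.ext_components <;> intros <;>
      simp [mul_add, Finset.mul_sum, Finset.sum_add_distrib, mul_sub, mul_assoc, mul_left_comm])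
  (by
    intro X a b
    apply CoV.ext_components <;> intros <;>
      simp [mul_add, add_mul, Finset.sum_add_distrib] <;> ring)
  (by
    intro c X a
    apply CoV.ext_components <;> intros <;>
      simp [mul_add, Finset.mul_sum, Finset.sum_add_distrib, mul_sub, mul_assoc, mul_left_comm])

@[simp] lemma coTh0_infAct (X : H1Space n) (a : CoV n) :
    coTh0 n (infAct X a) = pcRho X * coTh0 n a := rfl
@[simp] lemma coTh_infAct (X : H1Space n) (a : CoV n) (i : Fin n) :
    coTh i (infAct X a) = ∑ j, pcAlpha i j X * coTh j a + pcBeta i X * coTh0 n a := rfl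
@[simp] lemma coTT_infAct (X : H1Space n) (a : CoV n) (i j : Fin n) :
    coTT i j (infAct X a) = -(pcRho X * coTT i j a)
      + ∑ k, (pcAlpha i k X * coTT k j a + coTT i k a * pcAlpha j k X)
      + pcEps i j X * coTh0 n a + ∑ m, pcPi m i j X * coTh m a := rfl
@[simp] lemma coOm_infAct (X : H1Space n) (a : CoV n) (i : Fin n) :
    coOm i (infAct X a) = pcRho X * coOm i a - ∑ j, pcAlpha j i X * coOm j a
      + ∑ j, pcGamma i j X * coTh j a + pcMu i X * coTh0 n a := rfl

/-- The quadratic part `(-θᵗ ∧ ω, -Θ ∧ ω, 0, 0)` of the structure equations. -/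
noncomputable def stdTorsion : CoV n →ₗ[ℝ] CoV n →ₗ[ℝ] CoV n :=
  LinearMap.mk₂ ℝ (fun a b => mkCo (-∑ k, (coTh k a * coOm k b - coTh k b * coOm k a))
    (fun i => -∑ k, (coTT i k a * coOm k b - coTT i k b * coOm k a)) 0 0)
  (by
    intro X Y a
    apply CoV.ext_components <;> intros <;>
      simp [add_mul, mul_add, Finset.sum_add_distrib] <;> ring)
  (by
    intro c X a
    apply CoV.ext_components <;> intros <;>
      simp [Finset.mul_sum, mul_sub, mul_assoc, mul_left_comm])
  (by
    intro X a b
    apply CoV.ext_components <;> intros <;>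
      simp [mul_add, add_mul, Finset.sum_add_distrib] <;> ring)
  (by
    intro c X a
    apply CoV.ext_components <;> intros <;>
      simp [Finset.mul_sum, mul_sub, mul_assoc, mul_left_comm])

@[simp] lemma coTh0_stdTorsion (a b : CoV n) : coTh0 n (stdTorsion a b) =
    -∑ k, (coTh k a * coOm k b - coTh k b * coOm k a) := rfl
@[simp] lemma coTh_stdTorsion (a b : CoV n) (i : Fin n) : coTh i (stdTorsion a b) =
    -∑ k, (coTT i k a * coOm k b - coTT i k b * coOm k a) := rfl
@[simp] lemma coTT_stdTorsion (a b : CoV n) (i j : Fin n) : coTT i j (stdTorsion a b) = 0 := rfl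
@[simp] lemma coOm_stdTorsion (a b : CoV n) (i : Fin n) : coOm i (stdTorsion a b) = 0 := rfl

lemma stdTorsion_swap (a b : CoV n) : stdTorsion a b = -stdTorsion b a := by
  apply CoV.ext_components <;> intros <;> simp

/-- The values of the torsion forms `τ^{kl}` acting on `Θ`. -/
noncomputable def tauAct : (Fin n → Fin n → symMat n) →ₗ[ℝ] CoV n →ₗ[ℝ] CoV n :=
  LinearMap.mk₂ ℝ (fun t a => mkCo 0 0 (∑ k, ∑ l, coTT k l a • t k l) 0)
  (by
    intro X Y a
    apply CoV.ext_components <;> intros <;>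
      simp [Finset.sum_add_distrib])
  (by
    intro c X a
    apply CoV.ext_components <;> intros <;>
      simp [Finset.mul_sum, mul_left_comm])
  (by
    intro X a b
    apply CoV.ext_components <;> intros <;>
      simp [add_mul, Finset.sum_add_distrib])
  (by
    intro c X a
    apply CoV.ext_components <;> intros <;>
      simp [Finset.mul_sum, mul_assoc])

@[simp] lemma coTh0_tauAct (t : Fin n → Fin n → symMat n) (a : CoV n) :
    coTh0 n (tauAct t a) = 0 := rfl
@[simp] lemma coTh_tauAct (t : Fin n → Fin n → symMat n) (a : CoV n) (i : Fin n) :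
    coTh i (tauAct t a) = 0 := rfl
@[simp] lemma coOm_tauAct (t : Fin n → Fin n → symMat n) (a : CoV n) (i : Fin n) :
    coOm i (tauAct t a) = 0 := rfl
@[simp] lemma coTT_tauAct (t : Fin n → Fin n → symMat n) (a : CoV n) (i j : Fin n) :
    coTT i j (tauAct t a) = ∑ k, ∑ l, coTT k l a * (t k l).1 i j := by
  simp [tauAct]

/-- The kernel of `θ₀`. -/
noncomputable def filt0 (n : ℕ) : Submodule ℝ (CoV n) := (coTh0 n).ker

/-- The common kernel of `θ₀` and the `θ_i`. -/
noncomputable def filt1 (n : ℕ) : Submodule ℝ (CoV n) := filt0 n ⊓ ⨅ i, (coTh i : CoV n →L[ℝ] ℝ).ker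

/-- The common kernel of `θ₀`, the `θ_i` and the `Θ_ij`. -/
noncomputable def filt2 (n : ℕ) : Submodule ℝ (CoV n) :=
  filt1 n ⊓ ⨅ i, ⨅ j, (coTT i j : CoV n →L[ℝ] ℝ).ker

lemma mem_filt0 {a : CoV n} : a ∈ filt0 n ↔ coTh0 n a = 0 := Iff.rfl
lemma mem_filt1 {a : CoV n} : a ∈ filt1 n ↔ coTh0 n a = 0 ∧ ∀ i, coTh i a = 0 := by
  simp [filt1, mem_filt0, Submodule.mem_iInf]
lemma mem_filt2 {a : CoV n} : a ∈ filt2 n ↔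
    coTh0 n a = 0 ∧ (∀ i, coTh i a = 0) ∧ ∀ i j, coTT i j a = 0 := by
  simp [filt2, mem_filt1, Submodule.mem_iInf, and_assoc]

lemma filt1_le : filt1 n ≤ filt0 n := inf_le_left
lemma filt2_le : filt2 n ≤ filt1 n := inf_le_left

/-- The cyclic sum of `T (T a b) c`. -/
noncomputable def cycSum (T : CoV n →ₗ[ℝ] CoV n →ₗ[ℝ] CoV n) (a b c : CoV n) : CoV n :=
  T (T a b) c + T (T b c) a + T (T c a) b

/-- The algebraic properties of the torsion of an adapted coframe, at a point. -/
structure IsAdaptedTorsion (T : CoV n →ₗ[ℝ] CoV n →ₗ[ℝ] CoV n) : Prop where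
  swap : ∀ a b, T a b = -T b a
  sub_mem0 : ∀ a ∈ filt0 n, ∀ b ∈ filt0 n, T a b - stdTorsion a b ∈ filt0 n
  sub_mem1 : ∀ a ∈ filt1 n, ∀ b ∈ filt1 n, T a b - stdTorsion a b ∈ filt1 n
  mem2 : ∀ a ∈ filt2 n, ∀ b ∈ filt2 n, T a b ∈ filt2 n
  -- The two cyclic conditions are what remains of the Bianchi identity modulo the flag, where the
  -- derivatives of the torsion coefficients drop out.
  cyc0 : ∀ a ∈ filt0 n, ∀ b ∈ filt0 n, ∀ c ∈ filt0 n, cycSum T a b c ∈ filt0 n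
  cyc1 : ∀ a ∈ filt1 n, ∀ b ∈ filt1 n, ∀ c ∈ filt1 n, cycSum T a b c ∈ filt1 n

/-- The linear maps that relate the values of two adapted coframes at a point. -/
structure IsTransition (N : CoV n →ₗ[ℝ] CoV n) : Prop where
  bij : Function.Bijective N
  map0 : ∀ a ∈ filt0 n, N a ∈ filt0 n
  map1 : ∀ a ∈ filt1 n, N a ∈ filt1 n
  map2 : ∀ a ∈ filt2 n, N a ∈ filt2 n
  std0 : ∀ a ∈ filt0 n, ∀ b ∈ filt0 n, stdTorsion (N a) (N b) - N (stdTorsion a b) ∈ filt0 n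
  std1 : ∀ a ∈ filt1 n, ∀ b ∈ filt1 n, stdTorsion (N a) (N b) - N (stdTorsion a b) ∈ filt1 n

/-- In finite dimension an injective endomorphism that maps `W` into itself maps it onto itself.
This is why one-sided flag conditions suffice for transitions. -/
lemma mem_of_map_mem {N : CoV n →ₗ[ℝ] CoV n} (hN : Function.Injective N)
    {W : Submodule ℝ (CoV n)} (hW : ∀ a ∈ W, N a ∈ W) {a : CoV n} (ha : N a ∈ W) : a ∈ W := by
  have hinj : Function.Injective (N.restrict hW) := fun x y hxy =>
    Subtype.ext (hN (congrArg Subtype.val hxy))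
  obtain ⟨b, hb⟩ := (LinearMap.injective_iff_surjective.1 hinj) ⟨N a, ha⟩
  have : N b = N a := congrArg Subtype.val hb
  rw [← hN this]; exact b.2

/-- Equivariance of the algebraic properties of torsion. -/
lemma IsAdaptedTorsion.conj {T T' : CoV n →ₗ[ℝ] CoV n →ₗ[ℝ] CoV n} (hT : IsAdaptedTorsion T)
    {N : CoV n →ₗ[ℝ] CoV n} (hN : IsTransition N) (h : ∀ a b, T' (N a) (N b) = N (T a b)) :
    IsAdaptedTorsion T' := by
  have hsurj : ∀ {W : Submodule ℝ (CoV n)}, (∀ a ∈ W, N a ∈ W) → ∀ b ∈ W, ∃ a ∈ W, N a = b := by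
    intro W hW b hb
    obtain ⟨a, rfl⟩ := hN.bij.2 b
    exact ⟨a, mem_of_map_mem hN.bij.1 hW hb, rfl⟩
  have hcyc : ∀ a b c, cycSum T' (N a) (N b) (N c) = N (cycSum T a b c) := by
    intro a b c
    simp [cycSum, h]
  refine ⟨?_, ?_, ?_, ?_, ?_, ?_⟩
  · intro a b
    obtain ⟨a, rfl⟩ := hN.bij.2 a
    obtain ⟨b, rfl⟩ := hN.bij.2 b
    rw [h, h, hT.swap, map_neg]
  · intro a ha b hb
    obtain ⟨a, ham, rfl⟩ := hsurj hN.map0 a ha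
    obtain ⟨b, hbm, rfl⟩ := hsurj hN.map0 b hb
    have := (filt0 n).sub_mem (hN.map0 _ (hT.sub_mem0 a ham b hbm)) (hN.std0 a ham b hbm)
    rw [h]; convert this using 1; rw [map_sub]; abel
  · intro a ha b hb
    obtain ⟨a, ham, rfl⟩ := hsurj hN.map1 a ha
    obtain ⟨b, hbm, rfl⟩ := hsurj hN.map1 b hb
    have := (filt1 n).sub_mem (hN.map1 _ (hT.sub_mem1 a ham b hbm)) (hN.std1 a ham b hbm)
    rw [h]; convert this using 1; rw [map_sub]; abel
  · intro a ha b hb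
    obtain ⟨a, ham, rfl⟩ := hsurj hN.map2 a ha
    obtain ⟨b, hbm, rfl⟩ := hsurj hN.map2 b hb
    rw [h]; exact hN.map2 _ (hT.mem2 a ham b hbm)
  · intro a ha b hb c hc
    obtain ⟨a, ham, rfl⟩ := hsurj hN.map0 a ha
    obtain ⟨b, hbm, rfl⟩ := hsurj hN.map0 b hb
    obtain ⟨c, hcm, rfl⟩ := hsurj hN.map0 c hc
    rw [hcyc]; exact hN.map0 _ (hT.cyc0 a ham b hbm c hcm)
  · intro a ha b hb c hc
    obtain ⟨a, ham, rfl⟩ := hsurj hN.map1 a ha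
    obtain ⟨b, hbm, rfl⟩ := hsurj hN.map1 b hb
    obtain ⟨c, hcm, rfl⟩ := hsurj hN.map1 c hc
    rw [hcyc]; exact hN.map1 _ (hT.cyc1 a ham b hbm c hcm)

/-- The infinitesimal action of the Lie algebra respects the quadratic part, first step. -/
lemma infAct_std0 (X : H1Space n) {a b : CoV n} (ha : a ∈ filt0 n) (hb : b ∈ filt0 n) :
    coTh0 n (stdTorsion (infAct X a) b + stdTorsion a (infAct X b)) =
      coTh0 n (infAct X (stdTorsion a b)) := by
  rw [mem_filt0] at ha hb
  -- The form `θᵗ ∧ ω` is only scaled by `ρ`: the `α` terms on `θ` and `ω` cancel by transposition,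
  -- the `γ` terms by symmetry.
  have h1 : ∀ u v : Fin n → ℝ, ∑ k, (∑ j, pcAlpha k j X * u j) * v k =
      ∑ k, u k * ∑ j, pcAlpha j k X * v j := by
    intro u v
    simp only [Finset.sum_mul, Finset.mul_sum]
    rw [Finset.sum_comm]
    exact Finset.sum_congr rfl fun _ _ => Finset.sum_congr rfl fun _ _ => by ring
  have h2 : ∑ k, coTh k a * ∑ j, pcGamma k j X * coTh j b =
      ∑ k, coTh k b * ∑ j, pcGamma k j X * coTh j a := by
    simp only [Finset.mul_sum]
    rw [Finset.sum_comm]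
    refine Finset.sum_congr rfl fun i _ => Finset.sum_congr rfl fun j _ => ?_
    have : pcGamma j i X = pcGamma i j X := symMat_symm _ _ _
    rw [this]; ring
  have h3 := h1 (fun j => coTh j a) (fun j => coOm j b)
  have h4 := h1 (fun j => coTh j b) (fun j => coOm j a)
  simp only [map_add, coTh0_stdTorsion, coTh_infAct, coOm_infAct, coTh0_infAct, ha, hb, mul_zero,
    add_zero, mul_add, mul_sub, Finset.sum_sub_distrib, Finset.sum_add_distrib, mul_neg] at *
  have h5 : ∀ u v : Fin n → ℝ, ∑ k, u k * (pcRho X * v k) = pcRho X * ∑ k, u k * v k := by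
    intro u v; rw [Finset.mul_sum]; exact Finset.sum_congr rfl fun _ _ => by ring
  rw [h5 (fun k => coTh k a) (fun k => coOm k b), h5 (fun k => coTh k b) (fun k => coOm k a)]
  linear_combination -h3 + h4 - h2

/-- The infinitesimal action of the Lie algebra respects the quadratic part, second step. -/
lemma infAct_std1 (X : H1Space n) {a b : CoV n} (ha : a ∈ filt1 n) (hb : b ∈ filt1 n) (i : Fin n) :
    coTh i (stdTorsion (infAct X a) b + stdTorsion a (infAct X b)) =
      coTh i (infAct X (stdTorsion a b)) := by
  rw [mem_filt1] at ha hb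
  have h0 : coTh0 n (stdTorsion a b) = 0 := by simp [ha.2, hb.2]
  -- Only the left factor `α` on `Θ` survives. The right factor cancels against `-αᵗ` on `ω`, and so
  -- do the weights `-ρ` and `ρ`.
  have h1 : ∀ u v : CoV n, ∑ k, (∑ l, (pcAlpha i l X * coTT l k u)) * coOm k v =
      ∑ l, pcAlpha i l X * ∑ k, coTT l k u * coOm k v := by
    intro u v
    simp only [Finset.sum_mul, Finset.mul_sum]
    rw [Finset.sum_comm]
    exact Finset.sum_congr rfl fun _ _ => Finset.sum_congr rfl fun _ _ => by ring
  have h2 : ∀ u v : CoV n, ∑ k, (∑ l, coTT i l u * pcAlpha k l X) * coOm k v =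
      ∑ k, coTT i k u * ∑ j, pcAlpha j k X * coOm j v := by
    intro u v
    simp only [Finset.sum_mul, Finset.mul_sum]
    rw [Finset.sum_comm]
    exact Finset.sum_congr rfl fun _ _ => Finset.sum_congr rfl fun _ _ => by ring
  have h5 : ∀ u v : CoV n, ∑ k, coTT i k u * (pcRho X * coOm k v) =
      ∑ k, pcRho X * coTT i k u * coOm k v := by
    intro u v; exact Finset.sum_congr rfl fun _ _ => by ring
  rw [coTh_infAct, h0]
  simp only [map_add, coTh_stdTorsion, coTT_infAct, coOm_infAct, ha.1, hb.1, ha.2, hb.2,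
    mul_zero, Finset.sum_const_zero, add_mul, neg_mul, Finset.sum_neg_distrib,
    add_zero, mul_sub, Finset.sum_sub_distrib, Finset.sum_add_distrib, mul_neg, h1, h2, h5]
  ring

end Algebra

/-! ### Absorption of the torsion at a point -/

section Absorption

variable {n : ℕ}

/-- The difference of `T` and the torsion prescribed by the structure equations, for the values `ψ`
of a pseudoconnection. -/
noncomputable def torsionDefect (T : CoV n →ₗ[ℝ] CoV n →ₗ[ℝ] CoV n) (ψ : CoV n →ₗ[ℝ] H1Space n) :
    CoV n →ₗ[ℝ] CoV n →ₗ[ℝ] CoV n :=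
  T - stdTorsion + infAct ∘ₗ ψ - (infAct ∘ₗ ψ).flip

lemma torsionDefect_apply (T : CoV n →ₗ[ℝ] CoV n →ₗ[ℝ] CoV n) (ψ : CoV n →ₗ[ℝ] H1Space n)
    (a b : CoV n) : torsionDefect T ψ a b =
      T a b - stdTorsion a b + infAct (ψ a) b - infAct (ψ b) a := rfl

lemma torsionDefect_add (T : CoV n →ₗ[ℝ] CoV n →ₗ[ℝ] CoV n) (ψ ψ' : CoV n →ₗ[ℝ] H1Space n)
    (a b : CoV n) : torsionDefect T (ψ + ψ') a b =
      torsionDefect T ψ a b + (infAct (ψ' a) b - infAct (ψ' b) a) := by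
  simp only [torsionDefect_apply, LinearMap.add_apply, map_add]
  abel

lemma torsionDefect_swap {T : CoV n →ₗ[ℝ] CoV n →ₗ[ℝ] CoV n} (hT : ∀ a b, T a b = -T b a)
    (ψ : CoV n →ₗ[ℝ] H1Space n) (a b : CoV n) :
    torsionDefect T ψ a b = -torsionDefect T ψ b a := by
  simp only [torsionDefect_apply, hT a b, stdTorsion_swap a b]
  abel

lemma eq_of_torsionDefect (T : CoV n →ₗ[ℝ] CoV n →ₗ[ℝ] CoV n) (ψ : CoV n →ₗ[ℝ] H1Space n)
    (a b : CoV n) : T a b =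
      stdTorsion a b - infAct (ψ a) b + infAct (ψ b) a + torsionDefect T ψ a b := by
  rw [torsionDefect_apply]; abel

/-- Up to sign the cyclic sum is `∑ Θ_ik ∧ ω^k ∧ ω^i`, which vanishes because `Θ` is symmetric. -/
lemma stdTorsion_cyc0 (a b c : CoV n) :
    coTh0 n (stdTorsion (stdTorsion a b) c) + coTh0 n (stdTorsion (stdTorsion b c) a) +
      coTh0 n (stdTorsion (stdTorsion c a) b) = 0 := by
  have h : ∀ u v w : CoV n, coTh0 n (stdTorsion (stdTorsion u v) w) =
      ∑ i, ∑ k, coTT i k u * coOm k v * coOm i w - ∑ i, ∑ k, coTT i k v * coOm k u * coOm i w := by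
    intro u v w
    simp [Finset.sum_mul, sub_mul]
  have h' : ∀ u v w : CoV n, ∑ i, ∑ k, coTT i k u * coOm k v * coOm i w =
      ∑ i, ∑ k, coTT i k u * coOm k w * coOm i v := by
    intro u v w
    rw [Finset.sum_comm]
    refine Finset.sum_congr rfl fun i _ => Finset.sum_congr rfl fun k _ => ?_
    rw [coTT_symm]; ring
  rw [h, h, h, h' a b c, h' b c a, h' c a b]
  ring

/-- Consequence of the first Bianchi identity for the torsion defect. -/
lemma IsAdaptedTorsion.defect_cyc0 {T : CoV n →ₗ[ℝ] CoV n →ₗ[ℝ] CoV n} (hT : IsAdaptedTorsion T)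
    {ψ : CoV n →ₗ[ℝ] H1Space n} (h0 : ∀ a b, coTh0 n (torsionDefect T ψ a b) = 0)
    {a b c : CoV n} (ha : a ∈ filt0 n) (hb : b ∈ filt0 n) (hc : c ∈ filt0 n) :
    coTh0 n (stdTorsion (torsionDefect T ψ a b) c) + coTh0 n (stdTorsion (torsionDefect T ψ b c) a)
      + coTh0 n (stdTorsion (torsionDefect T ψ c a) b) = 0 := by
  -- Both copies of `T` are expanded. The derivation property `infAct_std0` rewrites the action of
  -- `ψ c` on the inner bracket, and all terms with `ψ` then cancel in the cyclic sum.
  have key : ∀ a ∈ filt0 n, ∀ b ∈ filt0 n, ∀ c ∈ filt0 n, coTh0 n (T (T a b) c) =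
      coTh0 n (stdTorsion (stdTorsion a b) c) - coTh0 n (stdTorsion (infAct (ψ a) b) c)
      + coTh0 n (stdTorsion (infAct (ψ b) a) c)
      + coTh0 n (stdTorsion (torsionDefect T ψ a b) c)
      + coTh0 n (stdTorsion (infAct (ψ c) a) b) - coTh0 n (stdTorsion (infAct (ψ c) b) a) := by
    intro a ha b hb c hc
    have e1 := congrArg (coTh0 n) (eq_of_torsionDefect T ψ (T a b) c)
    have e2 : coTh0 n (infAct (ψ c) (T a b)) = coTh0 n (infAct (ψ c) (stdTorsion a b)) := by
      have := hT.sub_mem0 a ha b hb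
      rw [mem_filt0, map_sub, sub_eq_zero] at this
      rw [coTh0_infAct, coTh0_infAct, this]
    have e3 := infAct_std0 (ψ c) ha hb
    have e4 := congrArg (coTh0 n) (stdTorsion_swap a (infAct (ψ c) b))
    have e5 : coTh0 n (infAct (ψ (T a b)) c) = 0 := by rw [coTh0_infAct, mem_filt0.1 hc, mul_zero]
    have e6 := congrArg (fun x => coTh0 n (stdTorsion x c)) (eq_of_torsionDefect T ψ a b)
    simp only [map_add, map_sub, map_neg, LinearMap.add_apply, LinearMap.sub_apply, h0]
      at e1 e3 e4 e6
    linear_combination e1 + e2 - e3 + e4 - e5 + e6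
  have hJ := hT.cyc0 a ha b hb c hc
  rw [mem_filt0, cycSum, map_add, map_add, key a ha b hb c hc, key b hb c hc a ha,
    key c hc a ha b hb] at hJ
  linear_combination hJ - stdTorsion_cyc0 a b c

/-- Consequence of the second Bianchi identity for the torsion defect. -/
lemma IsAdaptedTorsion.defect_cyc1 {T : CoV n →ₗ[ℝ] CoV n →ₗ[ℝ] CoV n} (hT : IsAdaptedTorsion T)
    {ψ : CoV n →ₗ[ℝ] H1Space n} (h1 : ∀ a b i, coTh i (torsionDefect T ψ a b) = 0)
    {a b c : CoV n} (ha : a ∈ filt1 n) (hb : b ∈ filt1 n) (hc : c ∈ filt1 n) (i : Fin n) :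
    coTh i (stdTorsion (torsionDefect T ψ a b) c) + coTh i (stdTorsion (torsionDefect T ψ b c) a)
      + coTh i (stdTorsion (torsionDefect T ψ c a) b) = 0 := by
  have key : ∀ a ∈ filt1 n, ∀ b ∈ filt1 n, ∀ c ∈ filt1 n, coTh i (T (T a b) c) =
      - coTh i (stdTorsion (infAct (ψ a) b) c)
      + coTh i (stdTorsion (infAct (ψ b) a) c)
      + coTh i (stdTorsion (torsionDefect T ψ a b) c)
      + coTh i (stdTorsion (infAct (ψ c) a) b) - coTh i (stdTorsion (infAct (ψ c) b) a) := by
    intro a ha b hb c hc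
    have e1 := congrArg (coTh i) (eq_of_torsionDefect T ψ (T a b) c)
    have e2 : coTh i (infAct (ψ c) (T a b)) = coTh i (infAct (ψ c) (stdTorsion a b)) := by
      have := mem_filt1.1 (hT.sub_mem1 a ha b hb)
      simp only [map_sub, sub_eq_zero] at this
      simp only [coTh_infAct, this.1, this.2]
    have e3 := infAct_std1 (ψ c) ha hb i
    have e4 := congrArg (coTh i) (stdTorsion_swap a (infAct (ψ c) b))
    have e5 : coTh i (infAct (ψ (T a b)) c) = 0 := by
      simp [coTh_infAct, (mem_filt1.1 hc).1, (mem_filt1.1 hc).2]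
    have e6 := congrArg (fun x => coTh i (stdTorsion x c)) (eq_of_torsionDefect T ψ a b)
    -- Values of `stdTorsion` have no `Θ` or `ω` component, so the model term contributes nothing to
    -- the second identity.
    have e7 : coTh i (stdTorsion (stdTorsion a b) c) = 0 := by simp
    simp only [map_add, map_sub, map_neg, LinearMap.add_apply, LinearMap.sub_apply, h1]
      at e1 e3 e4 e6
    linear_combination e1 + e2 - e3 + e4 - e5 + e6 + e7
  have hJ := (mem_filt1.1 (hT.cyc1 a ha b hb c hc)).2 i
  rw [cycSum, map_add, map_add, key a ha b hb c hc, key b hb c hc a ha,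
    key c hc a ha b hb] at hJ
  linear_combination hJ

/-- The vector dual to `θ₀`. -/
noncomputable def dualTh0 (n : ℕ) : CoV n := mkCo 1 0 0 0

/-- The vectors with only a component `θ`. -/
noncomputable def inclTh : (Fin n → ℝ) →ₗ[ℝ] CoV n where
  toFun x := mkCo 0 x 0 0
  map_add' x y := by apply CoV.ext_components <;> intros <;> simp
  map_smul' c x := by apply CoV.ext_components <;> intros <;> simp

/-- The vectors with only a component `Θ`. -/
noncomputable def inclTT : symMat n →ₗ[ℝ] CoV n where
  toFun X := mkCo 0 0 X 0
  map_add' x y := by apply CoV.ext_components <;> intros <;> simp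
  map_smul' c x := by apply CoV.ext_components <;> intros <;> simp

/-- The vectors with only a component `ω`. -/
noncomputable def inclOm : (Fin n → ℝ) →ₗ[ℝ] CoV n where
  toFun y := mkCo 0 0 0 y
  map_add' x y := by apply CoV.ext_components <;> intros <;> simp
  map_smul' c x := by apply CoV.ext_components <;> intros <;> simp

/-- The component `θ`, as a vector. -/
noncomputable def coThV : CoV n →ₗ[ℝ] (Fin n → ℝ) := LinearMap.pi fun i => (coTh i).toLinearMap

/-- The component `ω`, as a vector. -/
noncomputable def coOmV : CoV n →ₗ[ℝ] (Fin n → ℝ) := LinearMap.pi fun i => (coOm i).toLinearMap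

@[simp] lemma coThV_apply (a : CoV n) (i : Fin n) : coThV a i = coTh i a := rfl
@[simp] lemma coOmV_apply (a : CoV n) (i : Fin n) : coOmV a i = coOm i a := rfl
@[simp] lemma coSym_apply' (a : CoV n) (i j : Fin n) : (coSym a).1 i j = coTT i j a := rfl
@[simp] lemma coTh0_dualTh0 : coTh0 n (dualTh0 n) = 1 := rfl
@[simp] lemma coTh_dualTh0 (i : Fin n) : coTh i (dualTh0 n) = 0 := rfl
@[simp] lemma coTT_dualTh0 (i j : Fin n) : coTT i j (dualTh0 n) = 0 := rfl
@[simp] lemma coOm_dualTh0 (i : Fin n) : coOm i (dualTh0 n) = 0 := rfl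
@[simp] lemma coTh0_inclTh (x : Fin n → ℝ) : coTh0 n (inclTh x) = 0 := rfl
@[simp] lemma coTh_inclTh (x : Fin n → ℝ) (i : Fin n) : coTh i (inclTh x) = x i := rfl
@[simp] lemma coTT_inclTh (x : Fin n → ℝ) (i j : Fin n) : coTT i j (inclTh x) = 0 := rfl
@[simp] lemma coOm_inclTh (x : Fin n → ℝ) (i : Fin n) : coOm i (inclTh x) = 0 := rfl
@[simp] lemma coTh0_inclTT (x : symMat n) : coTh0 n (inclTT x) = 0 := rfl
@[simp] lemma coTh_inclTT (x : symMat n) (i : Fin n) : coTh i (inclTT x) = 0 := rfl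
@[simp] lemma coTT_inclTT (x : symMat n) (i j : Fin n) : coTT i j (inclTT x) = x.1 i j := rfl
@[simp] lemma coOm_inclTT (x : symMat n) (i : Fin n) : coOm i (inclTT x) = 0 := rfl
@[simp] lemma coTh0_inclOm (x : Fin n → ℝ) : coTh0 n (inclOm x) = 0 := rfl
@[simp] lemma coTh_inclOm (x : Fin n → ℝ) (i : Fin n) : coTh i (inclOm x) = 0 := rfl
@[simp] lemma coTT_inclOm (x : Fin n → ℝ) (i j : Fin n) : coTT i j (inclOm x) = 0 := rfl
@[simp] lemma coOm_inclOm (x : Fin n → ℝ) (i : Fin n) : coOm i (inclOm x) = x i := rfl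

/-- The projection to `filt1` along the vectors dual to `θ₀` and the `θ_i`. -/
noncomputable def proj1 : CoV n →ₗ[ℝ] CoV n := inclTT ∘ₗ coSym + inclOm ∘ₗ coOmV

lemma proj1_apply (a : CoV n) : proj1 a = inclTT (coSym a) + inclOm (coOmV a) := rfl

/-- The projection to `filt0`, with the `θ`-component halved. -/
noncomputable def projHalf : CoV n →ₗ[ℝ] CoV n := (2⁻¹ : ℝ) • (inclTh ∘ₗ coThV) + proj1

lemma projHalf_apply (a : CoV n) : projHalf a = (2⁻¹ : ℝ) • inclTh (coThV a) + proj1 a := rfl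

lemma proj1_mem (a : CoV n) : proj1 a ∈ filt1 n := by simp [mem_filt1, proj1_apply]

lemma projHalf_mem (a : CoV n) : projHalf a ∈ filt0 n := by
  simp [mem_filt0, projHalf_apply, proj1_apply]

lemma decomp (a : CoV n) : a = coTh0 n a • dualTh0 n + inclTh (coThV a) + proj1 a := by
  apply CoV.ext_components <;> intros <;> simp [proj1_apply]

lemma sum_smul_map_inclTh {W : Type*} [AddCommGroup W] [Module ℝ W] (f : CoV n →ₗ[ℝ] W)
    (x : Fin n → ℝ) : f (inclTh x) = ∑ j, x j • f (inclTh (Pi.single j 1)) := by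
  conv_lhs => rw [pi_eq_sum_univ' x]
  simp only [map_sum, map_smul]

/-- Decomposition of an alternating bilinear map along the filtration. -/
lemma alternating_split {W : Type*} [AddCommGroup W] [Module ℝ W]
    (B : CoV n →ₗ[ℝ] CoV n →ₗ[ℝ] W) (hB : ∀ a b, B a b = -B b a) (a b : CoV n) :
    B a b = coTh0 n a • B (dualTh0 n) b - coTh0 n b • B (dualTh0 n) a +
      ∑ j, (coTh j a • B (inclTh (Pi.single j 1)) (projHalf b) -
        coTh j b • B (inclTh (Pi.single j 1)) (projHalf a)) + B (proj1 a) (proj1 b) := by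
  have h1 : ∀ a b, ∑ j, coTh j a • B (inclTh (Pi.single j 1)) (projHalf b) =
      B (inclTh (coThV a)) (projHalf b) := by
    intro a b
    exact (sum_smul_map_inclTh (B.flip (projHalf b)) (coThV a)).symm
  have h0 : B (dualTh0 n) (dualTh0 n) = 0 := by
    have := hB (dualTh0 n) (dualTh0 n)
    rwa [eq_neg_iff_add_eq_zero, ← two_smul ℝ, smul_eq_zero_iff_right two_ne_zero] at this
  -- The two sums both produce the `θ ∧ θ` part of `B`; the factor `1/2` in `projHalf` makes it
  -- count once.
  rw [Finset.sum_sub_distrib, h1, h1]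
  have ea := decomp a
  have eb := decomp b
  set a0 := coTh0 n a
  set b0 := coTh0 n b
  rw [projHalf_apply, projHalf_apply]
  set a1 := inclTh (coThV a)
  set b1 := inclTh (coThV b)
  set a2 := proj1 a
  set b2 := proj1 b
  rw [ea, eb]
  simp only [map_add, map_smul, LinearMap.add_apply, LinearMap.smul_apply, h0]
  rw [hB a1 (dualTh0 n), hB a2 (dualTh0 n), hB a2 b1, hB b1 a1]
  module

/-- Absorption of `ρ`, `α` and `β`. -/
lemma IsAdaptedTorsion.absorb_theta {T : CoV n →ₗ[ℝ] CoV n →ₗ[ℝ] CoV n} (hT : IsAdaptedTorsion T) :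
    ∃ ψ : CoV n →ₗ[ℝ] H1Space n, (∀ a b, coTh0 n (torsionDefect T ψ a b) = 0) ∧
      ∀ a b i, coTh i (torsionDefect T ψ a b) = 0 := by
  set D := T - stdTorsion with hD
  have hDs : ∀ a b, D a b = -D b a := by
    intro a b
    simp only [hD, LinearMap.sub_apply, hT.swap a b, stdTorsion_swap a b]; abel
  -- The `θ₀` component of `D` is a multiple of `θ₀` and its `θ` components lie in the ideal of `θ₀,
  -- θ`, so `alternating_split` displays the coefficients that become `ρ`, `β` and `α`.
  let ρ : CoV n →ₗ[ℝ] ℝ := (coTh0 n).toLinearMap ∘ₗ D (dualTh0 n)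
  let α : CoV n →ₗ[ℝ] (Fin n → Fin n → ℝ) := LinearMap.pi fun i => LinearMap.pi fun j =>
    (coTh i).toLinearMap ∘ₗ D (inclTh (Pi.single j 1)) ∘ₗ projHalf
  let β : CoV n →ₗ[ℝ] (Fin n → ℝ) := coThV ∘ₗ D (dualTh0 n)
  refine ⟨ρ.prod (α.prod (β.prod 0)), ?_, ?_⟩
  · intro a b
    have h := alternating_split (D.compr₂ (coTh0 n).toLinearMap)
      (fun a b => by simp [hDs a b]) a b
    have h1 : coTh0 n (D (proj1 a) (proj1 b)) = 0 :=
      hT.sub_mem0 _ (filt1_le (proj1_mem a)) _ (filt1_le (proj1_mem b))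
    have h2 : ∀ j b, coTh0 n (D (inclTh (Pi.single j 1)) (projHalf b)) = 0 := fun j b =>
      hT.sub_mem0 _ (by simp [mem_filt0]) _ (projHalf_mem b)
    simp only [LinearMap.compr₂_apply, ContinuousLinearMap.coe_coe, h1, h2, smul_eq_mul, mul_zero,
      sub_zero, Finset.sum_const_zero, add_zero] at h
    have h3 : torsionDefect T (ρ.prod (α.prod (β.prod 0))) a b = D a b +
      infAct (ρ a, α a, β a, 0) b - infAct (ρ b, α b, β b, 0) a := rfl
    rw [h3, map_sub, map_add, h]
    simp [pcRho, ρ]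
    ring
  · intro a b i
    have h := alternating_split (D.compr₂ (coTh i).toLinearMap)
      (fun a b => by simp [hDs a b]) a b
    have h1 : coTh i (D (proj1 a) (proj1 b)) = 0 :=
      (mem_filt1.1 (hT.sub_mem1 _ (proj1_mem a) _ (proj1_mem b))).2 i
    simp only [LinearMap.compr₂_apply, ContinuousLinearMap.coe_coe, h1,
      add_zero, smul_eq_mul] at h
    have h3 : torsionDefect T (ρ.prod (α.prod (β.prod 0))) a b = D a b +
      infAct (ρ a, α a, β a, 0) b - infAct (ρ b, α b, β b, 0) a := rfl
    have h4 : ∀ a b : CoV n, coTh i (infAct ((ρ a, α a, β a, 0) : H1Space n) b) =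
        ∑ j, coTh j b * coTh i (D (inclTh (Pi.single j 1)) (projHalf a)) +
          coTh0 n b * coTh i (D (dualTh0 n) a) := by
      intro a b
      rw [coTh_infAct, mul_comm (pcBeta i _)]
      exact congrArg₂ _ (Finset.sum_congr rfl fun j _ => mul_comm _ _) rfl
    rw [h3, map_sub, map_add, h, h4, h4, Finset.sum_sub_distrib]
    ring

/-- Absorption of `γ` and `μ`. -/
lemma IsAdaptedTorsion.absorb_omega {T : CoV n →ₗ[ℝ] CoV n →ₗ[ℝ] CoV n} (hT : IsAdaptedTorsion T) :
    ∃ ψ : CoV n →ₗ[ℝ] H1Space n, (∀ a b, coTh0 n (torsionDefect T ψ a b) = 0) ∧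
      (∀ a b i, coTh i (torsionDefect T ψ a b) = 0) ∧
      ∀ a b i, coOm i (torsionDefect T ψ a b) = 0 := by
  obtain ⟨ψ, h0, h1⟩ := hT.absorb_theta
  set R := torsionDefect T ψ with hR
  have hRs : ∀ a b, R a b = -R b a := torsionDefect_swap hT.swap ψ
  -- This is `∑ θ_i ∧ R(ω^i) ≡ 0 mod θ₀`. What follows is Cartan's lemma, done by hand to obtain a
  -- symmetric `γ`.
  have hJ : ∀ a ∈ filt0 n, ∀ b ∈ filt0 n, ∀ c ∈ filt0 n, ∑ i, (coTh i c * coOm i (R a b) +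
      coTh i a * coOm i (R b c) + coTh i b * coOm i (R c a)) = 0 := by
    intro a ha b hb c hc
    have := hT.defect_cyc0 h0 ha hb hc
    simp only [coTh0_stdTorsion, ← hR, h1, zero_mul, zero_sub, Finset.sum_neg_distrib,
      neg_neg] at this
    simpa [Finset.sum_add_distrib] using this
  let e : Fin n → CoV n := fun j => inclTh (Pi.single j 1)
  have he : ∀ j, e j ∈ filt0 n := fun j => by simp [mem_filt0, e]
  have hs : ∀ i (f : Fin n → ℝ), ∑ k, coTh k (e i) * f k = f i := by
    intro i f; simp [e, Pi.single_apply]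
  have hsym : ∀ i j, ∀ x ∈ filt1 n, coOm i (R (e j) x) = coOm j (R (e i) x) := by
    intro i j x hx
    have := hJ _ (he i) _ (he j) _ (filt1_le hx)
    simp only [Finset.sum_add_distrib, hs, (mem_filt1.1 hx).2, zero_mul,
      Finset.sum_const_zero, hRs x] at this
    rw [map_neg] at this
    linear_combination this
  have hcyc : ∀ i j k, coOm i (R (e j) (e k)) + coOm j (R (e k) (e i)) + coOm k (R (e i) (e j))
      = 0 := by
    intro i j k
    have := hJ _ (he i) _ (he j) _ (he k)
    simp only [Finset.sum_add_distrib, hs] at this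
    linear_combination this
  have hflat : ∀ i, ∀ x ∈ filt1 n, ∀ y ∈ filt1 n, coOm i (R x y) = 0 := by
    intro i x hx y hy
    have := hJ _ (he i) _ (filt1_le hx) _ (filt1_le hy)
    simpa [Finset.sum_add_distrib, hs, (mem_filt1.1 hx).2, (mem_filt1.1 hy).2] using this
  -- An array that is alternating in `j, k` and has zero cyclic sum is the alternation in `j, k` of
  -- an array symmetric in `i, j`. Symmetrising in `i, j` with the factor `1/3` provides one.
  let g : Fin n → Fin n → Fin n → ℝ := fun i j k =>
    (coOm i (R (e j) (e k)) + coOm j (R (e i) (e k))) / 3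
  have hg : ∀ i j k, g i j k - g i k j = coOm i (R (e j) (e k)) := by
    intro i j k
    have e1 := hcyc i j k
    have e2 : coOm i (R (e k) (e j)) = - coOm i (R (e j) (e k)) := by rw [hRs, map_neg]
    have e3 : coOm j (R (e k) (e i)) = - coOm j (R (e i) (e k)) := by rw [hRs, map_neg]
    simp only [g]
    linear_combination (-1/3 : ℝ) * e1 + (-1/3 : ℝ) * e2 + (1/3 : ℝ) * e3
  let γ₀ : CoV n →ₗ[ℝ] (Fin n → Fin n → ℝ) := LinearMap.pi fun i => LinearMap.pi fun j =>
    (coOm i).toLinearMap ∘ₗ R (e j) ∘ₗ proj1 + ∑ k, g i j k • (coTh k).toLinearMap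
  have hγ₀ : ∀ a i j, γ₀ a i j = coOm i (R (e j) (proj1 a)) + ∑ k, g i j k * coTh k a := by
    intro a i j; simp [γ₀]
  let γ : CoV n →ₗ[ℝ] symMat n := LinearMap.codRestrict (symMat n) γ₀ fun a i j => by
    rw [hγ₀, hγ₀, hsym i j _ (proj1_mem a)]
    congr 1
    refine Finset.sum_congr rfl fun k _ => ?_
    simp only [g, add_comm]
  let μ : CoV n →ₗ[ℝ] (Fin n → ℝ) := coOmV ∘ₗ R (dualTh0 n)
  let ψ' : CoV n →ₗ[ℝ] H1Space n := LinearMap.prod 0 (LinearMap.prod 0 (LinearMap.prod 0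
    (LinearMap.prod 0 (LinearMap.prod 0 (γ.prod μ)))))
  have hψ' : ∀ a, ψ' a = (0, 0, 0, 0, 0, γ a, μ a) := fun a => rfl
  -- The correction has only `γ` and `μ` components and leaves the `θ₀` and `θ` equations intact.
  refine ⟨ψ + ψ', ?_, ?_, ?_⟩
  · intro a b
    rw [torsionDefect_add, map_add, ← hR, h0, hψ', hψ']
    simp [pcRho]
  · intro a b i
    rw [torsionDefect_add, map_add, ← hR, h1, hψ', hψ']
    simp [pcAlpha, pcBeta]
  · intro a b i
    rw [torsionDefect_add, map_add, ← hR, hψ', hψ']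
    have h := alternating_split (R.compr₂ (coOm i).toLinearMap)
      (fun a b => by simp [hRs a b]) a b
    simp only [LinearMap.compr₂_apply, ContinuousLinearMap.coe_coe,
      hflat i _ (proj1_mem a) _ (proj1_mem b), add_zero, smul_eq_mul] at h
    have h2 : ∀ j b, coOm i (R (e j) (projHalf b)) =
        coOm i (R (e j) (proj1 b)) + 2⁻¹ * ∑ k, coTh k b * coOm i (R (e j) (e k)) := by
      intro j b
      rw [projHalf_apply, map_add, map_smul, map_add, map_smul,
        show coOm i (R (e j) (inclTh (coThV b))) = ∑ k, coTh k b * coOm i (R (e j) (e k)) from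
          sum_smul_map_inclTh ((coOm i).toLinearMap ∘ₗ R (e j)) (coThV b)]
      simp; ring
    have h3 : ∀ j b, γ₀ b i j = coOm i (R (e j) (proj1 b)) + ∑ k, g i j k * coTh k b :=
      fun j b => hγ₀ b i j
    have h4 : ∀ a b : CoV n, ∑ j, coTh j a * ∑ k, coTh k b * coOm i (R (e j) (e k)) =
        ∑ j, coTh j a * ∑ k, g i j k * coTh k b - ∑ j, coTh j b * ∑ k, g i j k * coTh k a := by
      intro a b
      have : ∑ j, coTh j b * ∑ k, g i j k * coTh k a =
          ∑ j, coTh j a * ∑ k, g i k j * coTh k b := by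
        simp only [Finset.mul_sum]
        rw [Finset.sum_comm]
        exact Finset.sum_congr rfl fun _ _ => Finset.sum_congr rfl fun _ _ => by ring
      rw [this, ← Finset.sum_sub_distrib]
      refine Finset.sum_congr rfl fun j _ => ?_
      rw [← mul_sub, ← Finset.sum_sub_distrib]
      congr 1
      refine Finset.sum_congr rfl fun k _ => ?_
      rw [← hg]; ring
    change coOm i (R a b) = _ - _ + ∑ j, (coTh j a * coOm i (R (e j) (projHalf b)) -
      coTh j b * coOm i (R (e j) (projHalf a))) at h
    have h5 : ∀ a b : CoV n, ∑ x, coTh x a * (2⁻¹ * ∑ k, coTh k b * coOm i (R (e x) (e k))) =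
        2⁻¹ * ∑ j, coTh j a * ∑ k, coTh k b * coOm i (R (e j) (e k)) := by
      intro a b; rw [Finset.mul_sum]; exact Finset.sum_congr rfl fun _ _ => by ring
    have h6 : ∀ a b : CoV n, coOm i (infAct ((0, 0, 0, 0, 0, γ a, μ a) : H1Space n) b) =
        ∑ j, coTh j b * (coOm i (R (e j) (proj1 a)) + ∑ k, g i j k * coTh k a) +
          coTh0 n b * coOm i (R (dualTh0 n) a) := by
      intro a b
      have h7 : ∀ j, pcGamma i j ((0, 0, 0, 0, 0, γ a, μ a) : H1Space n) =
        coOm i (R (e j) (proj1 a)) + ∑ k, g i j k * coTh k a := fun j => h3 j a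
      rw [coOm_infAct]
      simp only [h7]
      simp only [pcRho, pcAlpha, pcMu, zero_mul, Pi.zero_apply, Finset.sum_const_zero, sub_zero,
        zero_add, mul_comm (μ a i)]
      exact congrArg₂ _ (Finset.sum_congr rfl fun j _ => mul_comm _ _) rfl
    rw [h, map_sub, h6, h6]
    simp only [h2, Finset.sum_sub_distrib, mul_add, Finset.sum_add_distrib, h5, h4]
    ring

/-- The symmetric matrix units. -/
noncomputable def symUnit (k l : Fin n) : symMat n :=
  ⟨fun i j => (2⁻¹ : ℝ) * ((if i = k ∧ j = l then 1 else 0) + (if i = l ∧ j = k then 1 else 0)),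
    fun i j => by
      simp only [add_comm, and_comm]⟩

lemma symUnit_symm (k l : Fin n) : symUnit k l = symUnit l k := by
  apply Subtype.ext; funext i j; simp only [symUnit, add_comm]

/-- The sum yields the mean of `X i j` and `X j i`; this is where the factor `1/2` in `symUnit`
comes from. -/
lemma sum_symUnit (X : symMat n) : X = ∑ k, ∑ l, X.1 k l • symUnit k l := by
  apply Subtype.ext
  funext i j
  have h : ∀ k l, (X.1 k l • symUnit k l : symMat n).1 i j =
      2⁻¹ * ((if i = k then (if j = l then X.1 k l else 0) else 0) +
        (if i = l then (if j = k then X.1 k l else 0) else 0)) := by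
    intro k l
    simp only [symUnit, Submodule.coe_smul, Pi.smul_apply, smul_eq_mul, mul_comm (X.1 k l),
      ite_and, mul_add, mul_ite, mul_one, mul_zero, add_mul, ite_mul, zero_mul]
  simp only [Submodule.coe_sum, Finset.sum_apply, h, ← Finset.mul_sum, Finset.sum_add_distrib]
  simp only [Finset.sum_ite_eq, Finset.sum_ite_irrel, Finset.sum_const_zero, Finset.mem_univ,
    if_true, symMat_symm X j i]
  ring

/-- Absorption: the torsion of an adapted coframe can be brought into the form of the structure
equations. -/
theorem IsAdaptedTorsion.absorb {T : CoV n →ₗ[ℝ] CoV n →ₗ[ℝ] CoV n} (hT : IsAdaptedTorsion T) :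
    ∃ (ψ : CoV n →ₗ[ℝ] H1Space n) (τ : CoV n →ₗ[ℝ] (Fin n → Fin n → symMat n)),
      (∀ a i j, τ a i j = τ a j i) ∧
      (∀ a b i j k, ∑ l, ((τ a i j).1 k l * coOm l b - (τ b i j).1 k l * coOm l a) = 0) ∧
      ∀ a b, T a b = stdTorsion a b - infAct (ψ a) b + infAct (ψ b) a
        + tauAct (τ b) a - tauAct (τ a) b := by
  obtain ⟨ψ, h0, h1, h3⟩ := hT.absorb_omega
  -- Integrability survives the earlier absorption: on `filt2` the action `infAct` produces no `Θ`
  -- component.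
  have h2 : ∀ a ∈ filt2 n, ∀ b ∈ filt2 n, coSym (torsionDefect T ψ a b) = 0 := by
    intro a ha b hb
    have h := (mem_filt2.1 (hT.mem2 a ha b hb)).2.2
    rw [mem_filt2] at ha hb
    apply Subtype.ext; funext i j
    rw [coSym_apply, torsionDefect_apply]
    simp [ha.1, ha.2.1, ha.2.2, hb.1, hb.2.1, hb.2.2, h]
  set R := torsionDefect T ψ with hR
  have hRs : ∀ a b, R a b = -R b a := torsionDefect_swap hT.swap ψ
  -- As the `ω` defect is already zero, `d²θ_i = 0` reduces to `∑ R(Θ_ik) ∧ ω^k ≡ 0 mod θ₀, θ`.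
  have hJ : ∀ a ∈ filt1 n, ∀ b ∈ filt1 n, ∀ c ∈ filt1 n, ∀ i,
      ∑ k, (coTT i k (R a b) * coOm k c + coTT i k (R b c) * coOm k a +
        coTT i k (R c a) * coOm k b) = 0 := by
    intro a ha b hb c hc i
    have := hT.defect_cyc1 h1 ha hb hc i
    simp only [coTh_stdTorsion, ← hR, h3, mul_zero, sub_zero] at this
    rw [Finset.sum_add_distrib, Finset.sum_add_distrib]
    linear_combination -this
  have hTT : ∀ x : symMat n, inclTT x ∈ filt1 n := fun x => by simp [mem_filt1]
  have hOm : ∀ y : Fin n → ℝ, inclOm y ∈ filt2 n := fun x => by simp [mem_filt2]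
  -- On two `Θ` vectors and one `ω` vector a single term of `hJ` survives, so there is no `Θ ∧ Θ`
  -- part. One `Θ` vector and two `ω` vectors will give `τ ∧ ω = 0`.
  have hflat : ∀ x y, coSym (R (inclTT x) (inclTT y)) = 0 := by
    intro x y
    apply Subtype.ext; funext i j
    have := hJ _ (hTT x) _ (hTT y) _ (filt2_le (hOm (Pi.single j 1))) i
    simpa [Pi.single_apply] using this
  -- `τ` collects the mixed `Θ ∧ ω` part of the defect and is a combination of the `ω^i` alone.
  let τ : CoV n →ₗ[ℝ] (Fin n → Fin n → symMat n) := LinearMap.pi fun k => LinearMap.pi fun l =>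
    coSym ∘ₗ R (inclTT (symUnit k l)) ∘ₗ inclOm ∘ₗ coOmV
  have hτ : ∀ a k l, τ a k l = coSym (R (inclTT (symUnit k l)) (inclOm (coOmV a))) :=
    fun a k l => rfl
  let ε : CoV n →ₗ[ℝ] symMat n := coSym ∘ₗ R (dualTh0 n)
  let ϖ : CoV n →ₗ[ℝ] (Fin n → symMat n) := LinearMap.pi fun k =>
    coSym ∘ₗ R (inclTh (Pi.single k 1)) ∘ₗ projHalf
  let ψ' : CoV n →ₗ[ℝ] H1Space n := LinearMap.prod 0 (LinearMap.prod 0 (LinearMap.prod 0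
    (ε.prod (ϖ.prod 0))))
  have hψ' : ∀ a, ψ' a = (0, 0, 0, ε a, ϖ a, 0) := fun a => rfl
  have htau : ∀ a b, coSym (tauAct (τ b) a) = coSym (R (inclTT (coSym a)) (inclOm (coOmV b))) := by
    intro a b
    conv_rhs => rw [sum_symUnit (coSym a)]
    simp only [map_sum, map_smul, LinearMap.sum_apply, LinearMap.smul_apply, ← hτ]
    rfl
  refine ⟨ψ + ψ', τ, ?_, ?_, ?_⟩
  · intro a i j
    rw [hτ, hτ, symUnit_symm]
  · intro a b i j k
    have := hJ _ (hTT (symUnit i j)) _ (filt2_le (hOm (coOmV a))) _ (filt2_le (hOm (coOmV b))) k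
    simp only [hτ, coSym_apply]
    rw [← this]
    refine Finset.sum_congr rfl fun l _ => ?_
    rw [hRs (inclOm (coOmV b)) (inclTT (symUnit i j))]
    simp; ring
  · intro a b
    rw [eq_of_torsionDefect T (ψ + ψ') a b]
    have key : torsionDefect T (ψ + ψ') a b = tauAct (τ b) a - tauAct (τ a) b := by
      rw [torsionDefect_add, ← hR, hψ', hψ']
      apply CoV.ext_components
      · simp [h0, pcRho]
      · intro i
        simp [h1, pcAlpha, pcBeta]
      · have h := alternating_split (R.compr₂ coSym)
          (fun a b => by simp [hRs a b]) a b
        have h4 : coSym (R (proj1 a) (proj1 b)) =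
            coSym (tauAct (τ b) a) - coSym (tauAct (τ a) b) := by
          rw [htau, htau, proj1_apply, proj1_apply]
          simp only [map_add, LinearMap.add_apply, hflat, h2 _ (hOm _) _ (hOm _)]
          rw [hRs (inclOm (coOmV a))]
          simp only [map_neg]
          abel
        intro i j
        have h5 := congrFun (congrFun (congrArg Subtype.val h) i) j
        simp only [LinearMap.compr₂_apply, h4] at h5
        simp only [Submodule.coe_add, Submodule.coe_sub, Submodule.coe_sum, Submodule.coe_smul,
          Pi.add_apply, Pi.sub_apply, Finset.sum_apply, Pi.smul_apply, coSym_apply,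
          smul_eq_mul] at h5
        have h6 : ∀ a b : CoV n, coTT i j (infAct ((0, 0, 0, ε a, ϖ a, 0) : H1Space n) b) =
            coTh0 n b * coTT i j (R (dualTh0 n) a) +
              ∑ m, coTh m b * coTT i j (R (inclTh (Pi.single m 1)) (projHalf a)) := by
          intro a b
          rw [coTT_infAct, mul_comm (pcEps i j _)]
          simp only [pcRho, pcAlpha, zero_mul, mul_zero, Pi.zero_apply, Finset.sum_const_zero,
            neg_zero, zero_add, add_zero]
          exact congrArg₂ _ rfl (Finset.sum_congr rfl fun j _ => mul_comm _ _)
        simp only [map_add, map_sub, h5, h6, Finset.sum_sub_distrib]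
        ring
      · intro i
        simp [h3, pcRho, pcAlpha, pcGamma, pcMu]
    rw [key]; abel

end Absorption

/-! ### Infinitesimal transitions, and absorption that is linear in the torsion -/

section Infinitesimal

variable {n : ℕ}

/-- The infinitesimal version of `IsTransition`. -/
structure IsInfinitesimalTransition (k : CoV n →ₗ[ℝ] CoV n) : Prop where
  map0 : ∀ a ∈ filt0 n, k a ∈ filt0 n
  map1 : ∀ a ∈ filt1 n, k a ∈ filt1 n
  map2 : ∀ a ∈ filt2 n, k a ∈ filt2 n
  std0 : ∀ a ∈ filt0 n, ∀ b ∈ filt0 n,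
    stdTorsion (k a) b + stdTorsion a (k b) - k (stdTorsion a b) ∈ filt0 n
  std1 : ∀ a ∈ filt1 n, ∀ b ∈ filt1 n,
    stdTorsion (k a) b + stdTorsion a (k b) - k (stdTorsion a b) ∈ filt1 n

lemma CoV.linearMap_ext {f g : CoV n →ₗ[ℝ] CoV n} (h0 : f (dualTh0 n) = g (dualTh0 n))
    (h1 : ∀ j, f (inclTh (Pi.single j 1)) = g (inclTh (Pi.single j 1)))
    (h2 : ∀ X, f (inclTT X) = g (inclTT X))
    (h3 : ∀ j, f (inclOm (Pi.single j 1)) = g (inclOm (Pi.single j 1))) : f = g := by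
  have h3' : f ∘ₗ inclOm = g ∘ₗ inclOm := LinearMap.pi_ext' fun j => by
    ext1; simpa using h3 j
  have h1' : f ∘ₗ inclTh = g ∘ₗ inclTh := LinearMap.pi_ext' fun j => by
    ext1; simpa using h1 j
  ext1 a
  rw [decomp a, proj1_apply]
  simp only [map_add, map_smul, h0, h2]
  rw [show f (inclTh (coThV a)) = g (inclTh (coThV a)) from LinearMap.congr_fun h1' _,
    show f (inclOm (coOmV a)) = g (inclOm (coOmV a)) from LinearMap.congr_fun h3' _]

/-- The infinitesimal transitions are given by the Lie algebra of `H₁`. -/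
theorem IsInfinitesimalTransition.exists_infAct {k : CoV n →ₗ[ℝ] CoV n}
    (hk : IsInfinitesimalTransition k) : ∃ X : H1Space n, infAct X = k := by
  have hTT : ∀ x : symMat n, inclTT x ∈ filt1 n := fun x => by simp [mem_filt1]
  have hOm : ∀ y : Fin n → ℝ, inclOm y ∈ filt2 n := fun x => by simp [mem_filt2]
  let e : Fin n → CoV n := fun j => inclTh (Pi.single j 1)
  let f : Fin n → CoV n := fun j => inclOm (Pi.single j 1)
  have he : ∀ j, e j ∈ filt0 n := fun j => by simp [mem_filt0, e]
  have hf : ∀ j, f j ∈ filt2 n := fun j => hOm _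
  have hkf := fun j => mem_filt2.1 (hk.map2 _ (hf j))
  have hkT := fun X => mem_filt1.1 (hk.map1 _ (hTT X))
  have hke := fun j => mem_filt0.1 (hk.map0 _ (he j))
  -- `Θ` vectors are in the radical of `θᵗ ∧ ω` on `filt0`, so their images have no `ω` component.
  have hOmT : ∀ X i, coOm i (k (inclTT X)) = 0 := by
    intro X i
    have h := hk.std0 _ (filt1_le (hTT X)) _ (he i)
    have h' : coTh0 n (k (stdTorsion (inclTT X) (e i))) = 0 :=
      hk.map0 _ (by simp [mem_filt0, e])
    rw [mem_filt0, map_sub, map_add, h'] at h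
    simpa [e, Pi.single_apply, hkT X] using h
  -- The pair `e i, e j` makes the `γ` block symmetric. The pair `f m, e j` below forces the `ω`
  -- block to be `ρ - αᵗ`.
  have hγ : ∀ i j, coOm i (k (e j)) = coOm j (k (e i)) := by
    intro i j
    have h := hk.std0 _ (he i) _ (he j)
    have h' : coTh0 n (k (stdTorsion (e i) (e j))) = 0 :=
      hk.map0 _ (by simp [mem_filt0, e])
    rw [mem_filt0, map_sub, map_add, h'] at h
    simp [e, Pi.single_apply] at h
    simp only [e]
    linear_combination -h
  have hOmf : ∀ j m, coOm j (k (f m)) =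
      (if j = m then coTh0 n (k (dualTh0 n)) else 0) - coTh m (k (e j)) := by
    intro j m
    have h := hk.std0 _ (filt1_le (filt2_le (hf m))) _ (he j)
    have h' : stdTorsion (f m) (e j) = (if j = m then (1 : ℝ) else 0) • dualTh0 n := by
      rcases eq_or_ne m j with rfl | hmj
      · apply CoV.ext_components <;> intros <;> simp [e, f, Pi.single_apply]
      · apply CoV.ext_components <;> intros <;> simp [e, f, Pi.single_apply, hmj, hmj.symm]
    rw [mem_filt0, map_sub, map_add, h', map_smul, map_smul] at h
    simp [e, f, Pi.single_apply, (hkf m).2.1] at h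
    simp only [e, f]
    have h1 := (hkf m).2.1
    split_ifs at h ⊢ <;> linear_combination h
  -- The block on `Θ` is not free either: `std1` on `inclTT X` and `f m` expresses it by `ρ` and
  -- `α`.
  have hTTT : ∀ X i m, coTT i m (k (inclTT X)) = -(coTh0 n (k (dualTh0 n)) * X.1 i m) +
      ∑ j, (coTh i (k (e j)) * X.1 j m + X.1 i j * coTh m (k (e j))) := by
    intro X i m
    have h := (mem_filt1.1 (hk.std1 _ (hTT X) _ (filt2_le (hf m)))).2 i
    have h' : stdTorsion (inclTT X) (f m) = -inclTh (fun j => X.1 j m) := by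
      apply CoV.ext_components <;> intros <;> simp [f, Pi.single_apply]
    have h2 : coTh i (k (inclTh (fun j => X.1 j m))) = ∑ j, X.1 j m * coTh i (k (e j)) :=
      sum_smul_map_inclTh ((coTh i).toLinearMap ∘ₗ k) _
    rw [map_sub, map_add, h', map_neg, map_neg, h2] at h
    simp only [coTh_stdTorsion, hOmf, (hkf m).2.2, hOmT, mul_zero, sub_zero] at h
    simp [f, Pi.single_apply, mul_sub, Finset.sum_sub_distrib] at h
    rw [Finset.sum_add_distrib]
    simp only [mul_comm (coTh i _)]
    linear_combination -h
  -- All free parameters can be read off from the images of `dualTh0` and of the `θ` vectors `e m`.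
  refine ⟨(coTh0 n (k (dualTh0 n)), fun i j => coTh i (k (e j)), coThV (k (dualTh0 n)),
    coSym (k (dualTh0 n)), fun m => coSym (k (e m)), ⟨fun i j => coOm i (k (e j)), hγ⟩,
    coOmV (k (dualTh0 n))), ?_⟩
  apply CoV.linearMap_ext
  · apply CoV.ext_components <;> intros <;>
      simp [pcRho, pcBeta, pcEps, pcMu]
  · intro m
    apply CoV.ext_components
    · simpa using (hke m).symm
    all_goals intros
    all_goals simp [pcAlpha, pcPi, pcGamma, Pi.single_apply, e]
  · intro X
    apply CoV.ext_components
    · simpa using (hkT X).1.symm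
    · simpa using fun i => ((hkT X).2 i).symm
    · intro i j
      rw [coTT_infAct, hTTT]
      simp [pcRho, pcAlpha]
    · simpa using fun i => (hOmT X i).symm
  · intro m
    apply CoV.ext_components
    · simpa using (hkf m).1.symm
    · simpa using fun i => ((hkf m).2.1 i).symm
    · simpa using fun i j => ((hkf m).2.2 i j).symm
    · intro i
      have := hOmf i m
      simp only [f] at this
      rw [coOm_infAct, this]
      simp [pcRho, pcAlpha, Pi.single_apply]

/-- All parameters show up in the images of `dualTh0` and the `θ` vectors. Injectivity makes a
generalized inverse of `infAct` a left inverse, as the Maurer–Cartan condition on the fibres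
requires. -/
lemma infAct_injective : Function.Injective (infAct : H1Space n →ₗ[ℝ] CoV n →ₗ[ℝ] CoV n) := by
  rw [← LinearMap.ker_eq_bot, LinearMap.ker_eq_bot']
  rintro ⟨r, A, b, e, S, c, f⟩ h
  have h0 := LinearMap.congr_fun h (dualTh0 n)
  have h1 := fun j => LinearMap.congr_fun h (inclTh (Pi.single j 1))
  have g0 := congrArg (coTh0 n) h0
  have g1 := fun i => congrArg (coTh i) h0
  have g2 := fun i j => congrArg (coTT i j) h0
  have g3 := fun i => congrArg (coOm i) h0
  have k1 := fun i j => congrArg (coTh i) (h1 j)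
  have k2 := fun m i j => congrArg (coTT i j) (h1 m)
  have k3 := fun i j => congrArg (coOm i) (h1 j)
  simp [pcRho, pcBeta, pcEps, pcMu] at g0 g1 g2 g3
  simp [pcAlpha, pcPi, pcGamma, Pi.single_apply] at k1 k2 k3
  refine Prod.ext g0 (Prod.ext (funext fun i => funext fun j => k1 i j) (Prod.ext (funext g1)
    (Prod.ext (Subtype.ext (funext fun i => funext fun j => g2 i j)) (Prod.ext
    (funext fun m => Subtype.ext (funext fun i => funext fun j => k2 m i j))
    (Prod.ext (Subtype.ext (funext fun i => funext fun j => k3 i j)) (funext g3))))))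

/-- A linear map to a vector space has a generalized inverse. -/
lemma LinearMap.exists_generalizedInverse {K V W : Type*} [Field K] [AddCommMonoid V] [Module K V]
    [AddCommGroup W] [Module K W] (f : V →ₗ[K] W) : ∃ r : W →ₗ[K] V, ∀ x, f (r (f x)) = f x := by
  let b := Module.Basis.ofVectorSpace K f.range
  obtain ⟨p, hp⟩ := f.range.subtype.exists_leftInverse_of_injective f.range.ker_subtype
  choose c hc using fun i => (b i).2
  refine ⟨b.constr K c ∘ₗ p, fun x => ?_⟩
  have h1 : p (f x) = ⟨f x, x, rfl⟩ := LinearMap.congr_fun hp ⟨f x, x, rfl⟩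
  have h2 : f ∘ₗ b.constr K c = f.range.subtype := b.ext fun i => by simp [hc]
  rw [LinearMap.comp_apply, h1]
  exact LinearMap.congr_fun h2 _

/-- The linear map from the absorbing data to torsions. -/
noncomputable def absorbMap (n : ℕ) :
    ((CoV n →ₗ[ℝ] H1Space n) × (CoV n →ₗ[ℝ] (Fin n → Fin n → symMat n))) →ₗ[ℝ]
      (CoV n →ₗ[ℝ] CoV n →ₗ[ℝ] CoV n) where
  toFun p := (infAct ∘ₗ p.1).flip - infAct ∘ₗ p.1 + (tauAct ∘ₗ p.2).flip - tauAct ∘ₗ p.2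
  map_add' p q := by
    ext1 a; ext1 b
    simp only [LinearMap.add_apply, LinearMap.sub_apply, LinearMap.flip_apply,
      LinearMap.comp_apply, Prod.fst_add, Prod.snd_add, map_add]
    abel
  map_smul' c p := by
    ext1 a; ext1 b
    simp only [LinearMap.add_apply, LinearMap.sub_apply, LinearMap.flip_apply,
      LinearMap.comp_apply, Prod.smul_fst, Prod.smul_snd, map_smul, LinearMap.smul_apply,
      RingHom.id_apply, smul_add, smul_sub]

/-- The conditions on the torsion forms `τ` in the structure equations. -/
def IsTorsionForm (τ : CoV n →ₗ[ℝ] (Fin n → Fin n → symMat n)) : Prop :=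
  (∀ a i j, τ a i j = τ a j i) ∧
    ∀ a b i j k, ∑ l, ((τ a i j).1 k l * coOm l b - (τ b i j).1 k l * coOm l a) = 0

/-- The admissible absorbing data. -/
noncomputable def absorbData (n : ℕ) :
    Submodule ℝ ((CoV n →ₗ[ℝ] H1Space n) × (CoV n →ₗ[ℝ] (Fin n → Fin n → symMat n))) where
  carrier := {p | IsTorsionForm p.2}
  zero_mem' := ⟨fun _ _ _ => rfl, fun _ _ _ _ _ => by simp⟩
  add_mem' {p q} hp hq := by
    refine ⟨fun a i j => ?_, fun a b i j k => ?_⟩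
    · simp [hp.1 a i j, hq.1 a i j]
    · have := congrArg₂ (· + ·) (hp.2 a b i j k) (hq.2 a b i j k)
      simp only [← Finset.sum_add_distrib, add_zero] at this
      rw [← this]
      exact Finset.sum_congr rfl fun l _ => by simp; ring
  smul_mem' c p hp := by
    refine ⟨fun a i j => ?_, fun a b i j k => ?_⟩
    · simp [hp.1 a i j]
    · have := congrArg (c * ·) (hp.2 a b i j k)
      simp only [Finset.mul_sum, mul_zero] at this
      rw [← this]
      exact Finset.sum_congr rfl fun l _ => by simp; ring

/-- The absorption can be chosen to depend linearly on the torsion. -/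
theorem exists_linear_absorption (n : ℕ) :
    ∃ (g : (CoV n →ₗ[ℝ] CoV n →ₗ[ℝ] CoV n) →ₗ[ℝ] (CoV n →ₗ[ℝ] H1Space n))
      (g' : (CoV n →ₗ[ℝ] CoV n →ₗ[ℝ] CoV n) →ₗ[ℝ] (CoV n →ₗ[ℝ] (Fin n → Fin n → symMat n))),
      ∀ T, IsTorsionForm (g' T) ∧ (IsAdaptedTorsion T → ∀ a b, T a b = stdTorsion a b
        - infAct (g (T - stdTorsion) a) b + infAct (g (T - stdTorsion) b) a
        + tauAct (g' (T - stdTorsion) b) a - tauAct (g' (T - stdTorsion) a) b) := by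
  -- A separate choice for each torsion would give no control over smoothness. A generalized inverse
  -- of the restricted map is one linear choice, and its values satisfy the conditions on `τ` for
  -- every `T`.
  let L := (absorbMap n).domRestrict (absorbData n)
  obtain ⟨s, hs⟩ := LinearMap.exists_generalizedInverse (K := ℝ) L
  refine ⟨LinearMap.fst ℝ _ _ ∘ₗ (absorbData n).subtype ∘ₗ s,
    LinearMap.snd ℝ _ _ ∘ₗ (absorbData n).subtype ∘ₗ s, fun T => ⟨(s T).2, fun hT a b => ?_⟩⟩
  -- Pointwise absorption only serves to show that `T - stdTorsion` is in the range of `L`, where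
  -- `s` is a right inverse.
  obtain ⟨ψ, τ, h1, h2, h3⟩ := hT.absorb
  have hmem : L ⟨(ψ, τ), h1, h2⟩ = T - stdTorsion := by
    ext1 a; ext1 b
    simp only [L, LinearMap.domRestrict_apply, absorbMap, LinearMap.coe_mk, AddHom.coe_mk,
      LinearMap.add_apply, LinearMap.sub_apply, LinearMap.flip_apply, LinearMap.comp_apply, h3]
    abel
  have e2 := hs ⟨(ψ, τ), h1, h2⟩
  rw [hmem] at e2
  have e3 := LinearMap.congr_fun (LinearMap.congr_fun e2 a) b
  simp only [L, LinearMap.domRestrict_apply, absorbMap, LinearMap.coe_mk, AddHom.coe_mk,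
      LinearMap.add_apply, LinearMap.sub_apply, LinearMap.flip_apply, LinearMap.comp_apply] at e3
  rw [sub_eq_iff_eq_add.1 e3.symm]
  simp only [LinearMap.comp_apply, LinearMap.fst_apply, LinearMap.snd_apply,
    Submodule.subtype_apply]
  abel

end Infinitesimal

/-! ### Coframes and one-forms in coordinates -/

section FlatForms

variable {E F V : Type*} [NormedAddCommGroup E] [NormedSpace ℝ E]
  [NormedAddCommGroup F] [NormedSpace ℝ F] [NormedAddCommGroup V] [NormedSpace ℝ V]

lemma clm_contDiff {X Y : Type*} [NormedAddCommGroup X] [NormedSpace ℝ X] [NormedAddCommGroup Y]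
    [NormedSpace ℝ Y] (G : X →L[ℝ] Y) : ContDiff ℝ ∞ G := G.contDiff

/-- The exterior derivative of a one-form on a normed space. -/
noncomputable def flatD (S : E → E →L[ℝ] F) (x : E) : E →L[ℝ] E →L[ℝ] F :=
  fderiv ℝ S x - (fderiv ℝ S x).flip

lemma flatD_apply (S : E → E →L[ℝ] F) (x v w : E) :
    flatD S x v w = fderiv ℝ S x v w - fderiv ℝ S x w v := rfl

lemma flatD_swap (S : E → E →L[ℝ] F) (x v w : E) : flatD S x v w = -flatD S x w v := by
  simp [flatD_apply]

lemma exists_equiv_of_bijective [FiniteDimensional ℝ E] [CompleteSpace V] {L : E →L[ℝ] V}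
    (h : Function.Bijective L) : ∃ e : E ≃L[ℝ] V, (e : E →L[ℝ] V) = L := by
  have : CompleteSpace E := FiniteDimensional.complete ℝ E
  exact ⟨ContinuousLinearEquiv.ofBijective L (LinearMap.ker_eq_bot.2 h.1)
    (LinearMap.range_eq_top.2 h.2), ContinuousLinearEquiv.coe_ofBijective _ _ _⟩

lemma inverse_apply_self [FiniteDimensional ℝ E] [CompleteSpace V] {L : E →L[ℝ] V}
    (h : Function.Bijective L) (v : E) : L.inverse (L v) = v := by
  obtain ⟨e, rfl⟩ := exists_equiv_of_bijective h
  simp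

lemma apply_inverse_self [FiniteDimensional ℝ E] [CompleteSpace V] {L : E →L[ℝ] V}
    (h : Function.Bijective L) (a : V) : L (L.inverse a) = a := by
  obtain ⟨e, rfl⟩ := exists_equiv_of_bijective h
  simp

lemma isOpen_bijective [FiniteDimensional ℝ E] [CompleteSpace V] :
    IsOpen {L : E →L[ℝ] V | Function.Bijective L} := by
  have : CompleteSpace E := FiniteDimensional.complete ℝ E
  convert ContinuousLinearEquiv.isOpen (𝕜 := ℝ) (E := E) (F := V)
  ext L
  exact ⟨fun h => exists_equiv_of_bijective h, by rintro ⟨e, rfl⟩; exact e.bijective⟩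

lemma contDiffOn_inverse [FiniteDimensional ℝ E] [CompleteSpace V] :
    ContDiffOn ℝ ∞ (ContinuousLinearMap.inverse : (E →L[ℝ] V) → _)
      {L : E →L[ℝ] V | Function.Bijective L} := by
  have : CompleteSpace E := FiniteDimensional.complete ℝ E
  intro L hL
  obtain ⟨e, rfl⟩ := exists_equiv_of_bijective hL
  exact (contDiffAt_map_inverse e).contDiffWithinAt

/-- The torsion of the coframe field `S`, expressed in the coframe `q.2` at the point `q.1`. -/
noncomputable def flatTorsion (S : E → E →L[ℝ] V) (q : E × (E →L[ℝ] V)) : V →L[ℝ] V →L[ℝ] V :=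
  (ContinuousLinearMap.compL ℝ V V V (q.2 ∘L (S q.1).inverse)) ∘L
    ((((ContinuousLinearMap.compL ℝ V E V).flip q.2.inverse) ∘L flatD S q.1) ∘L q.2.inverse)

lemma flatTorsion_apply (S : E → E →L[ℝ] V) (q : E × (E →L[ℝ] V)) (a b : V) :
    flatTorsion S q a b =
      q.2 ((S q.1).inverse (flatD S q.1 (q.2.inverse a) (q.2.inverse b))) := rfl

/-- The differential of `q.2 ∘ (S q.1)⁻¹`, composed with the inverse of that map. -/
noncomputable def fibreForm (S : E → E →L[ℝ] V) (q : E × (E →L[ℝ] V)) :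
    E × (E →L[ℝ] V) →L[ℝ] V →L[ℝ] V :=
  ((ContinuousLinearMap.compL ℝ V E V).flip q.2.inverse) ∘L
    (ContinuousLinearMap.snd ℝ E (E →L[ℝ] V) -
      (ContinuousLinearMap.compL ℝ E V V (q.2 ∘L (S q.1).inverse)) ∘L (fderiv ℝ S q.1) ∘L
        ContinuousLinearMap.fst ℝ E (E →L[ℝ] V))

lemma fibreForm_apply (S : E → E →L[ℝ] V) (q v : E × (E →L[ℝ] V)) (a : V) :
    fibreForm S q v a =
      v.2 (q.2.inverse a) - q.2 ((S q.1).inverse (fderiv ℝ S q.1 v.1 (q.2.inverse a))) := rfl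

/-- The one-form on the space of coframes that is constructed from the coframe field `S`, from a
linear map `κ` on the vertical part, and from a linear function `G` of the torsion. -/
noncomputable def coframeForm (κ : (V →L[ℝ] V) →L[ℝ] F)
    (G : (V →L[ℝ] V →L[ℝ] V) →L[ℝ] V →L[ℝ] F) (c : V →L[ℝ] V →L[ℝ] V) (S : E → E →L[ℝ] V)
    (q : E × (E →L[ℝ] V)) : E × (E →L[ℝ] V) →L[ℝ] F :=
  -- The first term carries the sign of the Maurer–Cartan form; the second is horizontal and does
  -- not affect the restriction to the fibres.
  -(κ ∘L fibreForm S q) +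
    G (flatTorsion S q - c) ∘L q.2 ∘L ContinuousLinearMap.fst ℝ E (E →L[ℝ] V)

lemma coframeForm_apply (κ : (V →L[ℝ] V) →L[ℝ] F)
    (G : (V →L[ℝ] V →L[ℝ] V) →L[ℝ] V →L[ℝ] F) (c : V →L[ℝ] V →L[ℝ] V) (S : E → E →L[ℝ] V)
    (q v : E × (E →L[ℝ] V)) : coframeForm κ G c S q v =
      -κ (fibreForm S q v) + G (flatTorsion S q - c) (q.2 v.1) := rfl

/-- The coframes at points of `W`. -/
def coframeDomain (V : Type*) [NormedAddCommGroup V] [NormedSpace ℝ V] (W : Set E) :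
    Set (E × (E →L[ℝ] V)) := {q | q.1 ∈ W ∧ Function.Bijective q.2}

lemma isOpen_coframeDomain [FiniteDimensional ℝ E] [CompleteSpace V] {W : Set E} (hW : IsOpen W) :
    IsOpen (coframeDomain V W) :=
  (hW.preimage continuous_fst).inter (isOpen_bijective.preimage continuous_snd)

section

variable [FiniteDimensional ℝ E] [FiniteDimensional ℝ V] {W : Set E} {S : E → E →L[ℝ] V}

lemma contDiffOn_inverse_apply (hS : ContDiffOn ℝ ∞ S W)
    (hb : ∀ x ∈ W, Function.Bijective (S x)) {f : E × (E →L[ℝ] V) → V}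
    (hf : ContDiffOn ℝ ∞ f (coframeDomain V W)) :
    ContDiffOn ℝ ∞ (fun q => q.2 ((S q.1).inverse (f q))) (coframeDomain V W) := by
  have : CompleteSpace V := FiniteDimensional.complete ℝ V
  have h1 : ContDiffOn ℝ ∞ (fun q : E × (E →L[ℝ] V) => (S q.1).inverse) (coframeDomain V W) :=
    contDiffOn_inverse.comp (hS.comp contDiffOn_fst fun _ hq => hq.1) fun _ hq => hb _ hq.1
  exact contDiffOn_snd.clm_apply (h1.clm_apply hf)

lemma contDiffOn_snd_inverse_apply (a : V) :
    ContDiffOn ℝ ∞ (fun q : E × (E →L[ℝ] V) => q.2.inverse a) (coframeDomain V W) := by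
  have : CompleteSpace V := FiniteDimensional.complete ℝ V
  have h1 : ContDiffOn ℝ ∞ (fun q : E × (E →L[ℝ] V) => q.2.inverse) (coframeDomain V W) :=
    contDiffOn_inverse.comp contDiffOn_snd fun _ hq => hq.2
  exact h1.clm_apply contDiffOn_const

omit [FiniteDimensional ℝ E] [FiniteDimensional ℝ V] in
lemma contDiffOn_fderiv_apply (hW : IsOpen W) (hS : ContDiffOn ℝ ∞ S W)
    {f g : E × (E →L[ℝ] V) → E} (hf : ContDiffOn ℝ ∞ f (coframeDomain V W))
    (hg : ContDiffOn ℝ ∞ g (coframeDomain V W)) :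
    ContDiffOn ℝ ∞ (fun q => fderiv ℝ S q.1 (f q) (g q)) (coframeDomain V W) := by
  have h3 : ContDiffOn ℝ ∞ (fun q : E × (E →L[ℝ] V) => fderiv ℝ S q.1) (coframeDomain V W) :=
    (hS.fderiv_of_isOpen hW le_rfl).comp contDiffOn_fst fun _ hq => hq.1
  exact (h3.clm_apply hf).clm_apply hg

lemma contDiffOn_flatTorsion (hW : IsOpen W) (hS : ContDiffOn ℝ ∞ S W)
    (hb : ∀ x ∈ W, Function.Bijective (S x)) :
    ContDiffOn ℝ ∞ (flatTorsion S) (coframeDomain V W) := by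
  refine contDiffOn_clm_apply.2 fun a => contDiffOn_clm_apply.2 fun b => ?_
  exact contDiffOn_inverse_apply hS hb
    ((contDiffOn_fderiv_apply hW hS (contDiffOn_snd_inverse_apply a)
      (contDiffOn_snd_inverse_apply b)).sub (contDiffOn_fderiv_apply hW hS
        (contDiffOn_snd_inverse_apply b) (contDiffOn_snd_inverse_apply a)))

lemma contDiffOn_fibreForm_apply (hW : IsOpen W) (hS : ContDiffOn ℝ ∞ S W)
    (hb : ∀ x ∈ W, Function.Bijective (S x)) (v : E × (E →L[ℝ] V)) :
    ContDiffOn ℝ ∞ (fun q => fibreForm S q v) (coframeDomain V W) := by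
  refine contDiffOn_clm_apply.2 fun a => ?_
  exact (contDiffOn_const.clm_apply (contDiffOn_snd_inverse_apply a)).sub
    (contDiffOn_inverse_apply hS hb
      (contDiffOn_fderiv_apply hW hS contDiffOn_const (contDiffOn_snd_inverse_apply a)))

set_option synthInstance.maxHeartbeats 200000 in
lemma contDiffOn_coframeForm (κ : (V →L[ℝ] V) →L[ℝ] F)
    (G : (V →L[ℝ] V →L[ℝ] V) →L[ℝ] V →L[ℝ] F) (c : V →L[ℝ] V →L[ℝ] V)
    (hW : IsOpen W) (hS : ContDiffOn ℝ ∞ S W) (hb : ∀ x ∈ W, Function.Bijective (S x)) :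
    ContDiffOn ℝ ∞ (coframeForm κ G c S) (coframeDomain V W) := by
  refine contDiffOn_clm_apply.2 fun v => ?_
  have h1 : ContDiffOn ℝ ∞ (fun q => κ (fibreForm S q v)) (coframeDomain V W) :=
    κ.contDiff.comp_contDiffOn (contDiffOn_fibreForm_apply hW hS hb v)
  have h2 : ContDiffOn ℝ ∞ (fun q => flatTorsion S q - c) (coframeDomain V W) :=
    (contDiffOn_flatTorsion hW hS hb).sub contDiffOn_const
  have hG := clm_contDiff (X := V →L[ℝ] V →L[ℝ] V) (Y := V →L[ℝ] F) G
  have h3 : ContDiffOn ℝ ∞ (fun q => G (flatTorsion S q - c)) (coframeDomain V W) :=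
    hG.comp_contDiffOn h2
  exact h1.neg.add (h3.clm_apply (contDiffOn_snd.clm_apply contDiffOn_const))

end

section

variable [FiniteDimensional ℝ E] [CompleteSpace V] {W : Set E} {S : E → E →L[ℝ] V}

/-- The exterior derivative of the tautological form, in terms of `fibreForm` and `flatTorsion`. -/
lemma fibreForm_torsion {q : E × (E →L[ℝ] V)} (hq : Function.Bijective q.2)
    (v w : E × (E →L[ℝ] V)) : v.2 w.1 - w.2 v.1 =
      fibreForm S q v (q.2 w.1) - fibreForm S q w (q.2 v.1) +
        flatTorsion S q (q.2 v.1) (q.2 w.1) := by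
  -- With `q.2 = N S` this is `d(N S) = dN N⁻¹ ∧ (N S) + N dS`.
  simp only [fibreForm_apply, flatTorsion_apply, flatD_apply, inverse_apply_self hq, map_sub]
  abel

/-- Velocities of curves of coframes: `fibreForm` is the logarithmic derivative of the transition
map. -/
lemma hasDerivAt_transition {x : ℝ → E} {L : ℝ → E →L[ℝ] V} {ξ : E} {Λ : E →L[ℝ] V} {t : ℝ}
    (hx : HasDerivAt x ξ t) (hL : HasDerivAt L Λ t) (hS : DifferentiableAt ℝ S (x t))
    (hb : Function.Bijective (S (x t))) (hbL : Function.Bijective (L t)) (a : V) :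
    HasDerivAt (fun s => L s ((S (x s)).inverse a))
      (fibreForm S (x t, L t) (ξ, Λ) (L t ((S (x t)).inverse a))) t := by
  have : CompleteSpace E := FiniteDimensional.complete ℝ E
  obtain ⟨e, he⟩ := exists_equiv_of_bijective hb
  have hSx : HasDerivAt (fun s => S (x s)) (fderiv ℝ S (x t) ξ) t :=
    hS.hasFDerivAt.comp_hasDerivAt t hx
  have hdiff : DifferentiableAt ℝ (fun s => (S (x s)).inverse) t := by
    have h1 : DifferentiableAt ℝ ContinuousLinearMap.inverse (S (x t)) := by
      rw [← he]; exact (contDiffAt_map_inverse (n := 1) e).differentiableAt one_ne_zero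
    exact h1.comp t hSx.differentiableAt
  set J := deriv (fun s => (S (x s)).inverse) t with hJ
  have hinv : HasDerivAt (fun s => (S (x s)).inverse) J t := hdiff.hasDerivAt
  have hev : ∀ᶠ s in 𝓝 t, S (x s) ((S (x s)).inverse a) = a := by
    have : ∀ᶠ s in 𝓝 t, Function.Bijective (S (x s)) :=
      hSx.continuousAt.eventually (isOpen_bijective.mem_nhds hb)
    filter_upwards [this] with s hs using apply_inverse_self hs a
  have hza : HasDerivAt (fun s => (S (x s)).inverse a) (J a) t :=
    hinv.clm_apply (hasDerivAt_const t a) |>.congr_deriv (by simp)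
  -- Differentiating `S S⁻¹ a = a` determines the derivative of the inverse.
  have h0 := (hSx.clm_apply hza).unique ((hasDerivAt_const t a).congr_of_eventuallyEq hev)
  have h1 : J a = -(S (x t)).inverse (fderiv ℝ S (x t) ξ ((S (x t)).inverse a)) := by
    have h2 := congrArg (S (x t)).inverse h0
    rw [map_add, inverse_apply_self hb, map_zero] at h2
    exact eq_neg_of_add_eq_zero_right h2
  refine (hL.clm_apply hza).congr_deriv ?_
  simp only [fibreForm_apply, h1, inverse_apply_self hbL, map_neg]
  abel

end

end FlatForms

/-! ### Adapted coframe fields in coordinates: Bianchi identity and transitions -/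

section FlatAdapted

/-- A finite-dimensional subspace is closed and so contains limits of difference quotients. Every
flag condition below is differentiated in this way. -/
lemma HasDerivAt.mem_submodule {V : Type*} [NormedAddCommGroup V] [NormedSpace ℝ V]
    [FiniteDimensional ℝ V] {P : Submodule ℝ V} {f : ℝ → V} {f' : V} {t : ℝ}
    (hf : HasDerivAt f f' t) (h : ∀ᶠ s in 𝓝 t, f s ∈ P) : f' ∈ P := by
  refine P.closed_of_finiteDimensional.mem_of_tendsto hf.tendsto_slope ?_
  filter_upwards [h.filter_mono nhdsWithin_le_nhds] with s hs
  rw [slope_def_module]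
  exact P.smul_mem _ (P.sub_mem hs h.self_of_nhds)

lemma HasFDerivAt.mem_submodule {E V : Type*} [NormedAddCommGroup E] [NormedSpace ℝ E]
    [NormedAddCommGroup V] [NormedSpace ℝ V]
    [FiniteDimensional ℝ V] {P : Submodule ℝ V} {f : E → V} {f' : E →L[ℝ] V} {x : E}
    (hf : HasFDerivAt f f' x) (h : ∀ᶠ y in 𝓝 x, f y ∈ P) (u : E) : f' u ∈ P := by
  have h1 : HasDerivAt (fun t : ℝ => x + t • u) u 0 := by
    simpa using ((hasDerivAt_id (0 : ℝ)).smul_const u).const_add x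
  have h2 : HasFDerivAt f f' (x + (0 : ℝ) • u) := by simpa using hf
  refine (h2.comp_hasDerivAt (0 : ℝ) h1).mem_submodule ?_
  have h3 : Filter.Tendsto (fun t : ℝ => x + t • u) (𝓝 0) (𝓝 x) := by
    simpa using h1.continuousAt.tendsto
  exact h3.eventually h

variable {n : ℕ} {E : Type*} [NormedAddCommGroup E] [NormedSpace ℝ E]

/-- An adapted coframe field, in coordinates. -/
structure IsFlatAdapted (S : E → E →L[ℝ] CoV n) (W : Set E) : Prop where
  isOpen : IsOpen W
  smooth : ContDiffOn ℝ ∞ S W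
  bij : ∀ x ∈ W, Function.Bijective (S x)
  d0 : ∀ x ∈ W, ∀ v w, S x v ∈ filt0 n → S x w ∈ filt0 n →
    flatD S x v w - stdTorsion (S x v) (S x w) ∈ filt0 n
  d1 : ∀ x ∈ W, ∀ v w, S x v ∈ filt1 n → S x w ∈ filt1 n →
    flatD S x v w - stdTorsion (S x v) (S x w) ∈ filt1 n
  d2 : ∀ x ∈ W, ∀ v w, S x v ∈ filt2 n → S x w ∈ filt2 n → flatD S x v w ∈ filt2 n

lemma IsFlatAdapted.mono {S : E → E →L[ℝ] CoV n} {W W' : Set E} (h : IsFlatAdapted S W)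
    (hW' : IsOpen W') (hsub : W' ⊆ W) : IsFlatAdapted S W' :=
  ⟨hW', h.smooth.mono hsub, fun x hx => h.bij x (hsub hx), fun x hx => h.d0 x (hsub hx),
    fun x hx => h.d1 x (hsub hx), fun x hx => h.d2 x (hsub hx)⟩

/-- Continuous bilinear maps as bilinear maps. -/
noncomputable def bilin {V : Type*} [NormedAddCommGroup V] [NormedSpace ℝ V] (T : V →L[ℝ] V →L[ℝ] V) :
    V →ₗ[ℝ] V →ₗ[ℝ] V :=
  LinearMap.mk₂ ℝ (fun a b => T a b) (fun _ _ _ => by simp) (fun _ _ _ => by simp)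
    (fun _ _ _ => by simp) (fun _ _ _ => by simp)

@[simp] lemma bilin_apply {V : Type*} [NormedAddCommGroup V] [NormedSpace ℝ V]
    (T : V →L[ℝ] V →L[ℝ] V) (a b : V) : bilin T a b = T a b := rfl

variable [FiniteDimensional ℝ E]

lemma flatTorsion_self {V : Type*} [NormedAddCommGroup V] [NormedSpace ℝ V] [CompleteSpace V]
    {S : E → E →L[ℝ] V} {x : E} (h : Function.Bijective (S x)) (v w : E) :
    flatTorsion S (x, S x) (S x v) (S x w) = flatD S x v w := by
  rw [flatTorsion_apply]
  simp only [apply_inverse_self h, inverse_apply_self h]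

/-- The first Bianchi identity. -/
lemma flatTorsion_bianchi {V : Type*} [NormedAddCommGroup V] [NormedSpace ℝ V]
    [FiniteDimensional ℝ V] {S : E → E →L[ℝ] V} {W : Set E} (hW : IsOpen W)
    (hS : ContDiffOn ℝ ∞ S W) (hb : ∀ x ∈ W, Function.Bijective (S x)) {x : E} (hx : x ∈ W)
    (T : E → V →L[ℝ] V →L[ℝ] V) (hT : T = fun y => flatTorsion S (y, S y)) :
    DifferentiableAt ℝ T x ∧ ∀ u v w,
      fderiv ℝ T x u (S x v) (S x w) + fderiv ℝ T x v (S x w) (S x u)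
        + fderiv ℝ T x w (S x u) (S x v) +
      (T x (T x (S x u) (S x v)) (S x w) + T x (T x (S x v) (S x w)) (S x u)
        + T x (T x (S x w) (S x u)) (S x v)) = 0 := by
  have : CompleteSpace V := FiniteDimensional.complete ℝ V
  have hxW : W ∈ 𝓝 x := hW.mem_nhds hx
  have hTd : DifferentiableAt ℝ T x := by
    have h1 : ContDiffOn ℝ ∞ T W := by
      rw [hT]
      exact (contDiffOn_flatTorsion hW hS hb).comp (contDiffOn_id.prodMk hS)
        fun y hy => ⟨hy, hb y hy⟩
    exact (h1.contDiffAt hxW).differentiableAt (by simp)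
  refine ⟨hTd, fun u v w => ?_⟩
  have hSx : ContDiffAt ℝ ∞ S x := hS.contDiffAt hxW
  have hSd : DifferentiableAt ℝ S x := hSx.differentiableAt (by simp)
  have hdd : DifferentiableAt ℝ (fderiv ℝ S) x :=
    (hSx.fderiv_right (m := 1) (by rw [one_add_one_eq_two]; exact ENat.LEInfty.out)).differentiableAt one_ne_zero
  have hsymm : IsSymmSndFDerivAt ℝ S x := hSx.isSymmSndFDerivAt (by simpa using ENat.LEInfty.out)
  -- The identity `T (S v) (S w) = dS(v, w)` is differentiated along `u`. In the cyclic sum the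
  -- second derivatives of `S` cancel by symmetry, and the first derivatives combine to `T (T · ·)
  -- ·`.
  have key : ∀ u v w, fderiv ℝ T x u (S x v) (S x w) + T x (fderiv ℝ S x u v) (S x w)
      + T x (S x v) (fderiv ℝ S x u w) =
      fderiv ℝ (fderiv ℝ S) x u v w - fderiv ℝ (fderiv ℝ S) x u w v := by
    intro u v w
    have e1 : ∀ z, HasFDerivAt (fun y => S y z) ((fderiv ℝ S x).flip z) x := fun z => by
      simpa using hSd.hasFDerivAt.clm_apply (hasFDerivAt_const z x)
    have e2 := (hTd.hasFDerivAt.clm_apply (e1 v)).clm_apply (e1 w)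
    have e3 : ∀ z z', HasFDerivAt (fun y => fderiv ℝ S y z z')
        (((fderiv ℝ (fderiv ℝ S) x).flip z).flip z') x := fun z z' => by
      simpa using (hdd.hasFDerivAt.clm_apply (hasFDerivAt_const z x)).clm_apply
        (hasFDerivAt_const z' x)
    have e4 := (e3 v w).sub (e3 w v)
    have e5 : (fun y => T y (S y v) (S y w)) =ᶠ[𝓝 x]
        fun y => fderiv ℝ S y v w - fderiv ℝ S y w v := by
      filter_upwards [hxW] with y hy
      rw [hT]; exact flatTorsion_self (hb y hy) v w
    have e6 := congrArg (fun L : E →L[ℝ] V => L u) (e2.unique (e4.congr_of_eventuallyEq e5))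
    simp at e6
    rw [← e6]; abel
  have hTx : ∀ v w, T x (S x v) (S x w) = fderiv ℝ S x v w - fderiv ℝ S x w v := fun v w => by
    rw [hT]; exact flatTorsion_self (hb x hx) v w
  have hswap : ∀ a b, T x a b = -T x b a := by
    intro a b
    obtain ⟨v, rfl⟩ := (hb x hx).2 a
    obtain ⟨w, rfl⟩ := (hb x hx).2 b
    rw [hTx, hTx, neg_sub]
  have k1 := key u v w
  have k2 := key v w u
  have k3 := key w u v
  rw [hswap (S x _) (fderiv ℝ S x _ _)] at k1 k2 k3
  simp only [hTx u v, hTx v w, hTx w u, map_sub, sub_apply]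
  have s1 := congrArg (fun L : E →L[ℝ] V => L w) (hsymm u v)
  have s2 := congrArg (fun L : E →L[ℝ] V => L u) (hsymm v w)
  have s3 := congrArg (fun L : E →L[ℝ] V => L v) (hsymm w u)
  have k := congrArg₂ (· + ·) (congrArg₂ (· + ·) k1 k2) k3
  simp only [s1, s2, s3] at k
  rw [← sub_eq_zero] at k
  rw [← k]
  abel

end FlatAdapted

section FlatAdapted

set_option synthInstance.maxHeartbeats 200000 in
lemma fderiv_apply_mem {E V : Type*} [NormedAddCommGroup E] [NormedSpace ℝ E]
    [NormedAddCommGroup V] [NormedSpace ℝ V] [FiniteDimensional ℝ V] {T : E → V →L[ℝ] V →L[ℝ] V}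
    {x : E} (hT : DifferentiableAt ℝ T x) {P : Submodule ℝ V} {a b c : V}
    (h : ∀ᶠ y in 𝓝 x, T y a b - c ∈ P) (u : E) : fderiv ℝ T x u a b ∈ P := by
  have e2 := ((hT.hasFDerivAt.clm_apply (hasFDerivAt_const a x)).clm_apply
    (hasFDerivAt_const b x)).sub_const c
  have e3 := e2.mem_submodule h u
  simpa using e3

variable {n : ℕ} {E : Type*} [NormedAddCommGroup E] [NormedSpace ℝ E] [FiniteDimensional ℝ E]
  {S S' : E → E →L[ℝ] CoV n} {W : Set E}

/-- In terms of an adapted coframe field, the torsion is adapted at each point. -/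
lemma IsFlatAdapted.sub_stdTorsion_mem0 (h : IsFlatAdapted S W) {x : E} (hx : x ∈ W) {a b : CoV n}
    (ha : a ∈ filt0 n) (hb : b ∈ filt0 n) :
    flatTorsion S (x, S x) a b - stdTorsion a b ∈ filt0 n := by
  obtain ⟨v, rfl⟩ := (h.bij x hx).2 a
  obtain ⟨w, rfl⟩ := (h.bij x hx).2 b
  have : CompleteSpace (CoV n) := FiniteDimensional.complete ℝ _
  rw [flatTorsion_self (h.bij x hx)]
  exact h.d0 x hx v w ha hb

lemma IsFlatAdapted.sub_stdTorsion_mem1 (h : IsFlatAdapted S W) {x : E} (hx : x ∈ W) {a b : CoV n}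
    (ha : a ∈ filt1 n) (hb : b ∈ filt1 n) :
    flatTorsion S (x, S x) a b - stdTorsion a b ∈ filt1 n := by
  obtain ⟨v, rfl⟩ := (h.bij x hx).2 a
  obtain ⟨w, rfl⟩ := (h.bij x hx).2 b
  have : CompleteSpace (CoV n) := FiniteDimensional.complete ℝ _
  rw [flatTorsion_self (h.bij x hx)]
  exact h.d1 x hx v w ha hb

/-- For `a, b` in one of the first two steps `P` of the flag, `T a b` stays in a fixed coset of `P`
as the point varies. Hence the derivatives of `T` in the Bianchi identity lie in `P`, and so does
the cyclic sum. -/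
lemma IsFlatAdapted.isAdaptedTorsion_self (h : IsFlatAdapted S W) {x : E} (hx : x ∈ W) :
    IsAdaptedTorsion (bilin (flatTorsion S (x, S x))) := by
  have : CompleteSpace (CoV n) := FiniteDimensional.complete ℝ _
  obtain ⟨hTd, hbi⟩ := flatTorsion_bianchi h.isOpen h.smooth h.bij hx _ rfl
  have hxW : W ∈ 𝓝 x := h.isOpen.mem_nhds hx
  have hfl := flatTorsion_self (h.bij x hx)
  set T : E → CoV n →L[ℝ] CoV n →L[ℝ] CoV n := fun y => flatTorsion S (y, S y) with hT
  have hder : ∀ (P : Submodule ℝ (CoV n)) (a b : CoV n),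
      (∀ y ∈ W, T y a b - stdTorsion a b ∈ P) → ∀ u, fderiv ℝ T x u a b ∈ P := by
    intro P a b hP u
    exact fderiv_apply_mem hTd (by filter_upwards [hxW] with y hy using hP y hy) u
  have hcyc : ∀ (P : Submodule ℝ (CoV n)),
      (∀ a ∈ P, ∀ b ∈ P, ∀ y ∈ W, T y a b - stdTorsion a b ∈ P) →
      ∀ a ∈ P, ∀ b ∈ P, ∀ c ∈ P, cycSum (bilin (flatTorsion S (x, S x))) a b c ∈ P := by
    intro P hP a ha b hb c hc
    obtain ⟨u, rfl⟩ := (h.bij x hx).2 a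
    obtain ⟨v, rfl⟩ := (h.bij x hx).2 b
    obtain ⟨w, rfl⟩ := (h.bij x hx).2 c
    have e := hbi u v w
    have e1 := P.add_mem (P.add_mem (hder P _ _ (hP _ hb _ hc) u)
      (hder P _ _ (hP _ hc _ ha) v)) (hder P _ _ (hP _ ha _ hb) w)
    have e2 := P.neg_mem e1
    rw [← eq_neg_of_add_eq_zero_right e] at e2
    exact e2
  refine ⟨?_, fun a ha b hb => h.sub_stdTorsion_mem0 hx ha hb,
    fun a ha b hb => h.sub_stdTorsion_mem1 hx ha hb, ?_,
    hcyc _ fun a ha b hb y hy => h.sub_stdTorsion_mem0 hy ha hb,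
    hcyc _ fun a ha b hb y hy => h.sub_stdTorsion_mem1 hy ha hb⟩
  · intro a b
    obtain ⟨v, rfl⟩ := (h.bij x hx).2 a
    obtain ⟨w, rfl⟩ := (h.bij x hx).2 b
    rw [bilin_apply, bilin_apply, hfl, hfl, flatD_swap]
  · intro a ha b hb
    obtain ⟨v, rfl⟩ := (h.bij x hx).2 a
    obtain ⟨w, rfl⟩ := (h.bij x hx).2 b
    rw [bilin_apply, hfl]
    exact h.d2 x hx v w ha hb

/-- The map that relates the coframe `L` at `x` to the value of `S` at `x`. -/
noncomputable def transition (S : E → E →L[ℝ] CoV n) (x : E) (L : E →L[ℝ] CoV n) :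
    CoV n →ₗ[ℝ] CoV n := (L ∘L (S x).inverse : CoV n →L[ℝ] CoV n)

omit [FiniteDimensional ℝ E] in
lemma transition_apply (S : E → E →L[ℝ] CoV n) (x : E) (L : E →L[ℝ] CoV n) (a : CoV n) :
    transition S x L a = L ((S x).inverse a) := rfl

lemma transition_coframe {x : E} (h : Function.Bijective (S x)) (L : E →L[ℝ] CoV n) (v : E) :
    transition S x L (S x v) = L v := by
  have : CompleteSpace (CoV n) := FiniteDimensional.complete ℝ _
  rw [transition_apply, inverse_apply_self h]

/-- The torsion in the coframe `L = N S` is the transform by `N` of the torsion in the coframe `S`,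
so `IsAdaptedTorsion.conj` applies. -/
lemma IsFlatAdapted.isAdaptedTorsion (h : IsFlatAdapted S W) {x : E} (hx : x ∈ W)
    {L : E →L[ℝ] CoV n} (hL : Function.Bijective L) (hN : IsTransition (transition S x L)) :
    IsAdaptedTorsion (bilin (flatTorsion S (x, L))) := by
  have : CompleteSpace (CoV n) := FiniteDimensional.complete ℝ _
  refine (h.isAdaptedTorsion_self hx).conj hN fun a b => ?_
  obtain ⟨v, rfl⟩ := (h.bij x hx).2 a
  obtain ⟨w, rfl⟩ := (h.bij x hx).2 b
  simp only [transition_coframe (h.bij x hx), bilin_apply, flatTorsion_apply,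
    inverse_apply_self hL, inverse_apply_self (h.bij x hx), apply_inverse_self (h.bij x hx),
    transition_apply]

/-- The contact structure and the system fix `filt0` and `filt2` only, and `filt1` has to be
recovered. A `Θ` vector pairs to zero with `filt0` under `θᵗ ∧ ω`. Hence so does its image, and
pairing with `ω` vectors shows that the image has no `θ` component. -/
lemma map_mem_filt1_of_std0 {N : CoV n →ₗ[ℝ] CoV n} (hb : Function.Bijective N)
    (h0 : ∀ a ∈ filt0 n, N a ∈ filt0 n) (h2 : ∀ a ∈ filt2 n, N a ∈ filt2 n)
    (hs : ∀ a ∈ filt0 n, ∀ b ∈ filt0 n, stdTorsion (N a) (N b) - N (stdTorsion a b) ∈ filt0 n)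
    {a : CoV n} (ha : a ∈ filt1 n) : N a ∈ filt1 n := by
  have e : a = inclTT (coSym a) + inclOm (coOmV a) := by
    apply CoV.ext_components <;> intros <;> simp [(mem_filt1.1 ha).1, (mem_filt1.1 ha).2, coOmV]
  rw [e, map_add]
  refine (filt1 n).add_mem ?_ (filt2_le (h2 _ (mem_filt2.2 (by simp))))
  set X := inclTT (coSym a)
  have hX0 : X ∈ filt0 n := mem_filt0.2 (by simp [X])
  refine mem_filt1.2 ⟨h0 X hX0, fun k => ?_⟩
  set b' : CoV n := inclOm (Pi.single k 1)
  have hb0 : b' ∈ filt0 n := mem_filt0.2 (by simp [b'])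
  obtain ⟨b, hbb⟩ := hb.2 b'
  have hbm : b ∈ filt0 n := mem_of_map_mem hb.1 h0 (by rw [hbb]; exact hb0)
  have e1 := hs X hX0 b hbm
  have e2 : stdTorsion X b ∈ filt0 n := by
    rw [mem_filt0]; simp [X]
  have e3 := (filt0 n).add_mem e1 (h0 _ e2)
  rw [sub_add_cancel, hbb, mem_filt0] at e3
  simpa [b', Pi.single_apply] using e3

/-- Adapted coframe fields for the same structure are related by admissible transitions. -/
theorem IsFlatAdapted.isTransition (h : IsFlatAdapted S W) (h' : IsFlatAdapted S' W)
    (e0 : ∀ x ∈ W, ∀ v, S x v ∈ filt0 n → S' x v ∈ filt0 n)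
    (e2 : ∀ x ∈ W, ∀ v, S x v ∈ filt2 n → S' x v ∈ filt2 n) {x : E} (hx : x ∈ W) :
    IsTransition (transition S x (S' x)) := by
  have : CompleteSpace (CoV n) := FiniteDimensional.complete ℝ _
  have : CompleteSpace E := FiniteDimensional.complete ℝ _
  have hmap : ∀ P : Submodule ℝ (CoV n), (∀ x ∈ W, ∀ v, S x v ∈ P → S' x v ∈ P) →
      ∀ x ∈ W, ∀ a ∈ P, transition S x (S' x) a ∈ P := by
    intro P hP x hx a ha
    obtain ⟨v, rfl⟩ := (h.bij x hx).2 a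
    rw [transition_coframe (h.bij x hx)]
    exact hP x hx v ha
  have hbij : ∀ x ∈ W, Function.Bijective (transition S x (S' x)) := by
    intro x hx
    have hc : (transition S x (S' x)) ∘ (S x) = S' x :=
      funext fun v => transition_coframe (h.bij x hx) _ v
    exact (Function.Bijective.of_comp_iff _ (h.bij x hx)).1 (hc ▸ h'.bij x hx)
  have hstd : ∀ P : Submodule ℝ (CoV n),
      (∀ x ∈ W, ∀ a ∈ P, transition S x (S' x) a ∈ P) →
      (∀ x ∈ W, ∀ v w, S x v ∈ P → S x w ∈ P → flatD S x v w - stdTorsion (S x v) (S x w) ∈ P) →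
      (∀ x ∈ W, ∀ v w, S' x v ∈ P → S' x w ∈ P →
        flatD S' x v w - stdTorsion (S' x v) (S' x w) ∈ P) → ∀ x ∈ W, ∀ a ∈ P, ∀ b ∈ P,
        stdTorsion (transition S x (S' x) a) (transition S x (S' x) b)
          - transition S x (S' x) (stdTorsion a b) ∈ P := by
    intro P hP hd hd' x hx a ha b hb
    obtain ⟨v, rfl⟩ := (h.bij x hx).2 a
    obtain ⟨w, rfl⟩ := (h.bij x hx).2 b
    have hxW : W ∈ 𝓝 x := h.isOpen.mem_nhds hx
    have hSd : DifferentiableAt ℝ S x := (h.smooth.contDiffAt hxW).differentiableAt (by simp)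
    have hSd' : DifferentiableAt ℝ S' x := (h'.smooth.contDiffAt hxW).differentiableAt (by simp)
    -- From `S' = M S` follows `dS' = dM ∧ S + M dS`. The derivatives of `M` preserve `P` because
    -- all values of `M` on `W` do, so the normalisations of `dS` and `dS'` can be compared modulo
    -- `P`.
    let M : E → CoV n →L[ℝ] CoV n := fun y => S' y ∘L (S y).inverse
    have hM : DifferentiableAt ℝ M x := by
      have h1 : ContDiffOn ℝ ∞ (fun y => (S y).inverse) W :=
        contDiffOn_inverse.comp h.smooth h.bij
      exact (h'.smooth.clm_comp h1).contDiffAt hxW |>.differentiableAt (by simp)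
    have hder : ∀ c ∈ P, ∀ u, fderiv ℝ M x u c ∈ P := by
      intro c hc u
      have := (hM.hasFDerivAt.clm_apply (hasFDerivAt_const c x)).mem_submodule (P := P)
        (by filter_upwards [hxW] with y hy using hP y hy c hc) u
      simpa using this
    have key : ∀ u z, fderiv ℝ S' x u z = fderiv ℝ M x u (S x z) + M x (fderiv ℝ S x u z) := by
      intro u z
      have k1 := hM.hasFDerivAt.clm_apply (hSd.hasFDerivAt.clm_apply (hasFDerivAt_const z x))
      have k2 := hSd'.hasFDerivAt.clm_apply (hasFDerivAt_const z x)
      have k3 : (fun y => S' y z) =ᶠ[𝓝 x] fun y => M y (S y z) := by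
        filter_upwards [hxW] with y hy
        exact (transition_coframe (h.bij y hy) (S' y) z).symm
      have k4 := congrArg (fun L : E →L[ℝ] CoV n => L u)
        (k2.unique (k1.congr_of_eventuallyEq k3))
      simp at k4
      rw [k4]; abel
    have hMx : ∀ c, M x c = transition S x (S' x) c := fun c => rfl
    have m1 := hder _ hb v
    have m2 := hder _ ha w
    have m3 := hd' x hx v w (by rw [← transition_coframe (h.bij x hx)]; exact hP x hx _ ha)
      (by rw [← transition_coframe (h.bij x hx)]; exact hP x hx _ hb)
    have m4 := hP x hx _ (hd x hx v w ha hb)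
    have m5 := P.sub_mem (P.sub_mem (P.add_mem m1 m4) m2) m3
    rw [transition_coframe (h.bij x hx), transition_coframe (h.bij x hx)]
    convert m5 using 1
    simp only [flatD_apply, key, hMx, map_sub]
    abel
  have hm0 := hmap _ e0
  have hm2 := hmap _ e2
  have hs0 := hstd _ hm0 h.d0 h'.d0
  -- The order matters: invariance of `filt1` uses the comparison on `filt0`, and the comparison on
  -- `filt1` uses this invariance.
  have hm1 : ∀ x ∈ W, ∀ a ∈ filt1 n, transition S x (S' x) a ∈ filt1 n := fun x hx a ha =>
    map_mem_filt1_of_std0 (hbij x hx) (hm0 x hx) (hm2 x hx) (hs0 x hx) ha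
  exact ⟨hbij x hx, hm0 x hx, hm1 x hx, hm2 x hx, hs0 x hx, hstd _ hm1 h.d1 h'.d1 x hx⟩

omit [FiniteDimensional ℝ E] in
/-- Velocities of curves of transitions are infinitesimal transitions. -/
theorem IsTransition.isInfinitesimalTransition {N : ℝ → CoV n →ₗ[ℝ] CoV n}
    {k : CoV n →ₗ[ℝ] CoV n} {t : ℝ} (hN : ∀ᶠ s in 𝓝 t, IsTransition (N s))
    (hk : ∀ a, HasDerivAt (fun s => N s a) (k (N t a)) t) : IsInfinitesimalTransition k := by
  -- The velocity is `k ∘ N t`, so vectors of `P` are first written as `N t a` with `a` in `P`.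
  have hsurj : ∀ {P : Submodule ℝ (CoV n)}, (∀ a ∈ P, N t a ∈ P) → ∀ b ∈ P, ∃ a ∈ P, N t a = b := by
    intro P hP b hb
    obtain ⟨a, rfl⟩ := hN.self_of_nhds.bij.2 b
    exact ⟨a, mem_of_map_mem hN.self_of_nhds.bij.1 hP hb, rfl⟩
  have hmap : ∀ P : Submodule ℝ (CoV n), (∀ᶠ s in 𝓝 t, ∀ a ∈ P, N s a ∈ P) → ∀ a ∈ P, k a ∈ P := by
    intro P hP a ha
    obtain ⟨b, hb, rfl⟩ := hsurj hP.self_of_nhds a ha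
    exact (hk b).mem_submodule (hP.mono fun s hs => hs b hb)
  have hstd : ∀ P : Submodule ℝ (CoV n), (∀ᶠ s in 𝓝 t, ∀ a ∈ P, N s a ∈ P) →
      (∀ᶠ s in 𝓝 t, ∀ a ∈ P, ∀ b ∈ P, stdTorsion (N s a) (N s b) - N s (stdTorsion a b) ∈ P) →
      ∀ a ∈ P, ∀ b ∈ P, stdTorsion (k a) b + stdTorsion a (k b) - k (stdTorsion a b) ∈ P := by
    intro P hP hQ a ha b hb
    obtain ⟨a, ham, rfl⟩ := hsurj hP.self_of_nhds a ha
    obtain ⟨b, hbm, rfl⟩ := hsurj hP.self_of_nhds b hb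
    let Q : CoV n →L[ℝ] CoV n →L[ℝ] CoV n :=
      LinearMap.toContinuousLinearMap (LinearMap.toContinuousLinearMap.toLinearMap ∘ₗ stdTorsion)
    have hQQ : ∀ x y, Q x y = stdTorsion x y := fun x y => rfl
    have d1 := ((Q.hasFDerivAt.comp_hasDerivAt t (hk a)).clm_apply (hk b)).sub
      (hk (stdTorsion a b))
    have d2 := d1.mem_submodule (P := P) (hQ.mono fun s hs => hs a ham b hbm)
    simp only [hQQ, Function.comp_apply] at d2
    have d3 := P.sub_mem d2 (hmap P hP _ (hQ.self_of_nhds a ham b hbm))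
    convert d3 using 1
    rw [map_sub]; abel
  exact ⟨hmap _ (hN.mono fun s hs => hs.map0), hmap _ (hN.mono fun s hs => hs.map1),
    hmap _ (hN.mono fun s hs => hs.map2),
    hstd _ (hN.mono fun s hs => hs.map0) (hN.mono fun s hs => hs.std0),
    hstd _ (hN.mono fun s hs => hs.map1) (hN.mono fun s hs => hs.std1)⟩

end FlatAdapted

/-! ### Universal linear data, and the structure equation in coordinates -/

section StructureEquations

variable {n : ℕ}

/-- Linear functions of the torsion with values in the one-forms. -/
abbrev TorsionMap (V F : Type*) [NormedAddCommGroup V] [NormedSpace ℝ V] [NormedAddCommGroup F]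
    [NormedSpace ℝ F] : Type _ := (V →L[ℝ] V →L[ℝ] V) →L[ℝ] V →L[ℝ] F

section Generic

variable {V F : Type*} [NormedAddCommGroup V] [NormedSpace ℝ V]
  [NormedAddCommGroup F] [NormedSpace ℝ F]

lemma coframeForm_zero_apply {E : Type*} [NormedAddCommGroup E] [NormedSpace ℝ E]
    (G : TorsionMap V F) (c : V →L[ℝ] V →L[ℝ] V) (S : E → E →L[ℝ] V) (q v : E × (E →L[ℝ] V)) :
    coframeForm 0 G c S q v = G (flatTorsion S q - c) (q.2 v.1) := by
  rw [coframeForm_apply, zero_apply, neg_zero, zero_add]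

variable [FiniteDimensional ℝ V]

/-- In finite dimension linear choices are continuous, so the pointwise algebra yields smooth
functions of the torsion. -/
lemma exists_torsionMap (g : (V →ₗ[ℝ] V →ₗ[ℝ] V) →ₗ[ℝ] (V →ₗ[ℝ] F)) :
    ∃ G : TorsionMap V F, ∀ T a, G T a = g (bilin T) a := by
  let b : (V →L[ℝ] V →L[ℝ] V) →ₗ[ℝ] (V →ₗ[ℝ] V →ₗ[ℝ] V) :=
    { toFun := bilin
      map_add' := fun _ _ => rfl
      map_smul' := fun _ _ => rfl }
  exact ⟨LinearMap.toContinuousLinearMap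
    ((LinearMap.toContinuousLinearMap : (V →ₗ[ℝ] F) ≃ₗ[ℝ] (V →L[ℝ] F)).toLinearMap ∘ₗ g ∘ₗ b),
    fun T a => rfl⟩

lemma exists_fibreMap (f : (V →ₗ[ℝ] V) →ₗ[ℝ] F) :
    ∃ κ : (V →L[ℝ] V) →L[ℝ] F, ∀ k : V →L[ℝ] V, κ k = f k :=
  ⟨LinearMap.toContinuousLinearMap (f ∘ₗ
    (LinearMap.toContinuousLinearMap : (V →ₗ[ℝ] V) ≃ₗ[ℝ] (V →L[ℝ] V)).symm.toLinearMap),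
    fun _ => rfl⟩

end Generic

/-- The algebraic data for the construction of a pseudoconnection. -/
structure IsConnectionData (κ : (CoV n →L[ℝ] CoV n) →L[ℝ] H1Space n)
    (G : TorsionMap (CoV n) (H1Space n)) (G' : TorsionMap (CoV n) (Fin n → Fin n → symMat n))
    (c : CoV n →L[ℝ] CoV n →L[ℝ] CoV n) : Prop where
  fibre : ∀ X : H1Space n, ∀ k : CoV n →L[ℝ] CoV n, (∀ a, k a = infAct X a) → κ k = X
  infAct_fibre : ∀ k : CoV n →L[ℝ] CoV n,
    IsInfinitesimalTransition (k : CoV n →ₗ[ℝ] CoV n) → ∀ a, infAct (κ k) a = k a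
  -- No adaptedness of `T` is asked, so `τ` will satisfy its conditions on all tangent vectors of
  -- the coframe space.
  torsionForm : ∀ T, (∀ a i j, G' T a i j = G' T a j i) ∧
    ∀ a b i j k, ∑ l, ((G' T a i j).1 k l * coOm l b - (G' T b i j).1 k l * coOm l a) = 0
  absorb : ∀ T, IsAdaptedTorsion (bilin T) → ∀ a b, T a b = stdTorsion a b
    - infAct (G (T - c) a) b + infAct (G (T - c) b) a
    + tauAct (G' (T - c) b) a - tauAct (G' (T - c) a) b

theorem exists_isConnectionData (n : ℕ) : ∃ (κ : (CoV n →L[ℝ] CoV n) →L[ℝ] H1Space n)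
    (G : TorsionMap (CoV n) (H1Space n)) (G' : TorsionMap (CoV n) (Fin n → Fin n → symMat n))
    (c : CoV n →L[ℝ] CoV n →L[ℝ] CoV n), IsConnectionData κ G G' c := by
  obtain ⟨g, g', h⟩ := exists_linear_absorption n
  obtain ⟨r, hr⟩ := LinearMap.exists_generalizedInverse (K := ℝ)
    (infAct : H1Space n →ₗ[ℝ] CoV n →ₗ[ℝ] CoV n)
  obtain ⟨G, hG⟩ := exists_torsionMap (V := CoV n) (F := H1Space n) g
  obtain ⟨G', hG'⟩ := exists_torsionMap (V := CoV n) (F := Fin n → Fin n → symMat n) g'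
  obtain ⟨κ, hκ⟩ := exists_fibreMap (V := CoV n) (F := H1Space n) r
  -- `c` is `stdTorsion` as a continuous map: the absorption is linear in `T - stdTorsion`, hence
  -- affine in `T`.
  let c : CoV n →L[ℝ] CoV n →L[ℝ] CoV n :=
    LinearMap.toContinuousLinearMap (LinearMap.toContinuousLinearMap.toLinearMap ∘ₗ stdTorsion)
  have hc : ∀ T, bilin (T - c) = bilin T - stdTorsion := fun T => rfl
  refine ⟨κ, G, G', c, ?_, ?_, ?_, ?_⟩
  · intro X k hk
    have e : (k : CoV n →ₗ[ℝ] CoV n) = infAct X := LinearMap.ext hk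
    exact (hκ k).trans (infAct_injective (by rw [e, hr]))
  · intro k hk a
    obtain ⟨X, hX⟩ := hk.exists_infAct
    have e1 := hr X
    rw [hX] at e1
    have e2 := LinearMap.congr_fun e1 a
    rw [show κ k = r k from hκ k]
    exact e2
  · intro T
    have := (h (bilin T)).1
    refine ⟨fun a i j => ?_, fun a b i j k => ?_⟩
    · rw [hG']; exact this.1 a i j
    · rw [hG', hG']; exact this.2 a b i j k
  · intro T hT a b
    have := (h (bilin T)).2 hT a b
    rw [← hc] at this
    rw [hG, hG, hG', hG']
    exact this

variable {E : Type*} [NormedAddCommGroup E] [NormedSpace ℝ E] [FiniteDimensional ℝ E]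

/-- In `fibreForm_torsion` the torsion is absorbed by `G` and `G'`, and `fibreForm` is replaced by
the action of its image under `κ`. The replacement needs values in the Lie algebra, which vectors
tangent to `F1` provide. -/
theorem IsConnectionData.structure_equation {κ : (CoV n →L[ℝ] CoV n) →L[ℝ] H1Space n}
    {G : TorsionMap (CoV n) (H1Space n)} {G' : TorsionMap (CoV n) (Fin n → Fin n → symMat n)}
    {c : CoV n →L[ℝ] CoV n →L[ℝ] CoV n} (hd : IsConnectionData κ G G' c)
    {S : E → E →L[ℝ] CoV n} {q : E × (E →L[ℝ] CoV n)} (hq : Function.Bijective q.2)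
    (hT : IsAdaptedTorsion (bilin (flatTorsion S q))) {v w : E × (E →L[ℝ] CoV n)}
    (hv : IsInfinitesimalTransition (fibreForm S q v : CoV n →ₗ[ℝ] CoV n))
    (hw : IsInfinitesimalTransition (fibreForm S q w : CoV n →ₗ[ℝ] CoV n)) :
    v.2 w.1 - w.2 v.1 = stdTorsion (q.2 v.1) (q.2 w.1)
      - infAct (coframeForm κ G c S q v) (q.2 w.1) + infAct (coframeForm κ G c S q w) (q.2 v.1)
      + tauAct (coframeForm 0 G' c S q w) (q.2 v.1)
      - tauAct (coframeForm 0 G' c S q v) (q.2 w.1) := by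
  have : CompleteSpace (CoV n) := FiniteDimensional.complete ℝ _
  rw [fibreForm_torsion (S := S) hq, hd.absorb _ hT]
  have e : ∀ (u : E × (E →L[ℝ] CoV n)) a,
      IsInfinitesimalTransition (fibreForm S q u : CoV n →ₗ[ℝ] CoV n) →
      infAct (coframeForm κ G c S q u) a =
        -fibreForm S q u a + infAct (G (flatTorsion S q - c) (q.2 u.1)) a := by
    intro u a hu
    rw [← hd.infAct_fibre _ hu, ← LinearMap.neg_apply, ← LinearMap.add_apply, ← map_neg, ← map_add]
    rfl
  have e' : ∀ (u : E × (E →L[ℝ] CoV n)),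
      coframeForm 0 G' c S q u = G' (flatTorsion S q - c) (q.2 u.1) := by
    intro u
    exact coframeForm_zero_apply _ _ _ _ _
  rw [e v _ hv, e w _ hw, e', e']
  abel

end StructureEquations

/-! ### Differentiating the action of the structure group -/

section Derivative

variable {n : ℕ}

/-- Velocities of curves in orbits of `H₁` are given by the infinitesimal action. -/
lemma hasDerivAt_h1Act {h : ℝ → H1Space n} {X : H1Space n} {a a' : CoV n} (h0 : h 0 = h1One n)
    (hh : HasDerivAt h X 0) (ha : HasDerivAt (fun t => h1Act (h t) a) a' 0) :
    a' = infAct X a := by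
  have d0 : HasDerivAt (fun t => (h t).1) (pcRho X) 0 := hh.fst
  have dA : ∀ i j, HasDerivAt (fun t => (h t).2.1 i j) (pcAlpha i j X) 0 := fun i j =>
    hasDerivAt_pi.1 (hasDerivAt_pi.1 hh.snd.fst i) j
  have db : ∀ i, HasDerivAt (fun t => (h t).2.2.1 i) (pcBeta i X) 0 := fun i =>
    hasDerivAt_pi.1 hh.snd.snd.fst i
  have hval : ∀ {f : ℝ → symMat n} {Y : symMat n}, HasDerivAt f Y 0 → ∀ i j,
      HasDerivAt (fun t => (f t).1 i j) (Y.1 i j) 0 := fun hf i j =>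
    hasDerivAt_pi.1 (hasDerivAt_pi.1
      ((symMat n).subtypeL.hasFDerivAt.comp_hasDerivAt (0 : ℝ) hf) i) j
  have de : ∀ i j, HasDerivAt (fun t => (h t).2.2.2.1.1 i j) (pcEps i j X) 0 :=
    hval hh.snd.snd.snd.fst
  have dS : ∀ k i j, HasDerivAt (fun t => ((h t).2.2.2.2.1 k).1 i j) (pcPi k i j X) 0 := fun k =>
    hval (hasDerivAt_pi.1 hh.snd.snd.snd.snd.fst k)
  have dc : ∀ i j, HasDerivAt (fun t => (h t).2.2.2.2.2.1.1 i j) (pcGamma i j X) 0 :=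
    hval hh.snd.snd.snd.snd.snd.fst
  have df : ∀ i, HasDerivAt (fun t => (h t).2.2.2.2.2.2 i) (pcMu i X) 0 := fun i =>
    hasDerivAt_pi.1 hh.snd.snd.snd.snd.snd.snd i
  have z1 : (h 0).1 = 1 := by rw [h0]; rfl
  have z2 : ∀ i j, (h 0).2.1 i j = if i = j then 1 else 0 := by intro i j; rw [h0]; rfl
  have z3 : ∀ i, (h 0).2.2.1 i = 0 := by intro i; rw [h0]; rfl
  have z4 : ∀ i j, (h 0).2.2.2.1.1 i j = 0 := by intro i j; rw [h0]; rfl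
  have z5 : ∀ k i j, ((h 0).2.2.2.2.1 k).1 i j = 0 := by intro k i j; rw [h0]; rfl
  have z6 : ∀ i j, (h 0).2.2.2.2.2.1.1 i j = 0 := by intro i j; rw [h0]; rfl
  have z7 : ∀ i, (h 0).2.2.2.2.2.2 i = 0 := by intro i; rw [h0]; rfl
  have dcomp : ∀ L : CoV n →L[ℝ] ℝ, HasDerivAt (fun t => L (h1Act (h t) a)) (L a') 0 := fun L =>
    L.hasFDerivAt.comp_hasDerivAt (0 : ℝ) ha
  have f0 : ∀ t, coTh0 n (h1Act (h t) a) = (h t).1 * coTh0 n a := fun t => rfl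
  have f1 : ∀ t i, coTh i (h1Act (h t) a) =
      ∑ j, (h t).2.1 i j * (coTh j a + (h t).2.2.1 j * coTh0 n a) := fun t i => rfl
  have f2 : ∀ t i j, coTT i j (h1Act (h t) a) = (h t).1⁻¹ * ∑ k, ∑ l,
        (h t).2.1 i k * (coTT k l a + (h t).2.2.2.1.1 k l * coTh0 n a
          + ∑ m, ((h t).2.2.2.2.1 m).1 k l * coTh m a) * (h t).2.1 j l := fun t i j => rfl
  have f3 : ∀ t i, coOm i (h1Act (h t) a) =
      (h t).1 * (∑ j, ((Matrix.of (h t).2.1)⁻¹) j i *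
        (coOm j a + ∑ k, (h t).2.2.2.2.2.1.1 j k * coTh k a)) + (h t).2.2.2.2.2.2 i * coTh0 n a :=
    fun t i => rfl
  apply CoV.ext_components
  · refine (dcomp _).unique ?_
    simp only [f0]
    exact (d0.mul_const _).congr_deriv (by simp)
  · intro i
    refine (dcomp _).unique ?_
    simp only [f1]
    refine (HasDerivAt.fun_sum fun j _ => (dA i j).fun_mul
      (((db j).mul_const (coTh0 n a)).const_add (coTh j a))).congr_deriv ?_
    simp [z2, z3, Finset.sum_add_distrib]
  · intro i j
    refine (dcomp _).unique ?_
    simp only [f2]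
    refine ((d0.fun_inv (by rw [z1]; exact one_ne_zero)).fun_mul (HasDerivAt.fun_sum fun k _ =>
      HasDerivAt.fun_sum fun l _ => ((dA i k).fun_mul ((((de k l).mul_const (coTh0 n a)).const_add
        (coTT k l a)).fun_add (HasDerivAt.fun_sum fun m _ => (dS m k l).mul_const
          (coTh m a)))).fun_mul (dA j l))).congr_deriv ?_
    simp [z1, z2, z4, z5, Finset.sum_add_distrib]
    ring
  · intro i
    -- Invertibility of `A` is known only near `t = 0`, from `h 0 = h1One n`. There, multiplying the
    -- `ω` component by `Aᵗ` avoids differentiating the inverse matrix.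
    have hdet : ∀ᶠ t in 𝓝 (0 : ℝ), (Matrix.of (h t).2.1).det ≠ 0 := by
      have hcont : ContinuousAt (fun t => (Matrix.of (h t).2.1).det) 0 := by
        have h1 : ContinuousAt (fun t => Matrix.of (h t).2.1) 0 :=
          HasDerivAt.continuousAt (f' := X.2.1) hh.snd.fst
        exact (continuous_id.matrix_det).continuousAt.comp h1
      refine hcont.eventually_ne ?_
      have : Matrix.of (h 0).2.1 = 1 := by ext i j; simp [z2, Matrix.one_apply]
      rw [this, Matrix.det_one]; exact one_ne_zero
    have hev : (fun t => ∑ k, (h t).2.1 k i *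
        (coOm k (h1Act (h t) a) - (h t).2.2.2.2.2.2 k * coTh0 n a)) =ᶠ[𝓝 0]
        fun t => (h t).1 * (coOm i a + ∑ k, (h t).2.2.2.2.2.1.1 i k * coTh k a) := by
      filter_upwards [hdet] with t ht
      have hinv : (Matrix.of (h t).2.1)⁻¹ * Matrix.of (h t).2.1 = 1 :=
        Matrix.nonsing_inv_mul _ (isUnit_iff_ne_zero.2 ht)
      have hent : ∀ j, ∑ k, (Matrix.of (h t).2.1)⁻¹ j k * (h t).2.1 k i = if j = i then 1 else 0 :=
        fun j => by rw [← Matrix.one_apply, ← hinv]; rfl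
      simp only [f3, add_sub_cancel_right]
      simp only [Finset.mul_sum]
      rw [Finset.sum_comm]
      rw [Finset.sum_congr rfl fun j _ => show _ = (∑ k, (Matrix.of (h t).2.1)⁻¹ j k *
        (h t).2.1 k i) * ((h t).1 *
          (coOm j a + ∑ k, (h t).2.2.2.2.2.1.1 j k * coTh k a)) by
        rw [Finset.sum_mul]; exact Finset.sum_congr rfl fun k _ => by ring]
      simp [hent]
    have l1 := HasDerivAt.fun_sum (u := Finset.univ) fun k _ =>
      (dA k i).fun_mul ((dcomp (coOm k)).fun_sub ((df k).mul_const (coTh0 n a)))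
    have l2 := d0.fun_mul ((HasDerivAt.fun_sum (u := Finset.univ) fun k _ =>
      (dc i k).mul_const (coTh k a)).const_add (coOm i a))
    have e := l1.unique (l2.congr_of_eventuallyEq hev)
    have g3 : ∀ k, coOm k (h1Act (h 0) a) = coOm k a := fun k => by
      rw [f3, h0]
      have : Matrix.of (h1One n).2.1 = 1 := by
        ext i j; simp [h1One, Matrix.one_apply]
      rw [this, inv_one]
      simp [h1One, Matrix.one_apply]
    simp [z1, z2, z6, z7, g3, Finset.sum_add_distrib] at e
    rw [coOm_infAct]
    linarith

end Derivative

/-! ### From one vector-valued identity to the structure equations -/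

section Manifold

variable {n : ℕ} {Z : Type*} [TopologicalSpace Z]
  [ChartedSpace (EuclideanSpace ℝ (Fin (dimZ n))) Z] [IsManifold (𝓡 (dimZ n)) ∞ Z]

/-- The four equations are the components of one identity. The two terms `ρ/2` around `Θ` add up to
the weight `-ρ` of `Θ` in `infAct`. -/
lemma StructureEquations.of_eq {p : CoframeSpace n Z}
    {φ : TangentSpace (modelCo n) p →L[ℝ] H1Space n}
    {τ : TangentSpace (modelCo n) p →L[ℝ] (Fin n → Fin n → symMat n)}
    {v w : TangentSpace (modelCo n) p}
    (h : extD (modelCo n) (taut n) p v w = stdTorsion (taut n p v) (taut n p w)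
      - infAct (φ v) (taut n p w) + infAct (φ w) (taut n p v)
      + tauAct (τ w) (taut n p v) - tauAct (τ v) (taut n p w)) :
    StructureEquations p φ τ v w := by
  refine ⟨?_, fun i => ?_, fun i j => ?_, fun i => ?_⟩
  · rw [h]; simp [wedge]; ring
  · rw [h]; simp [wedge]; ring
  · rw [h]; simp [wedge]; simp [sub_mul, mul_sub, Finset.sum_add_distrib]; ring
  · rw [h]; simp [wedge]; simp [sub_mul]; ring

end Manifold

/-! ### One-forms in the charts of a manifold -/

section ChartForms

variable {E H M F : Type*} [NormedAddCommGroup E] [NormedSpace ℝ E] [TopologicalSpace H]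
  [TopologicalSpace M] [ChartedSpace H M] [NormedAddCommGroup F] [NormedSpace ℝ F]
  {I : ModelWithCorners ℝ E H}

/-- The coordinate expression of a one-form in the preferred chart at `x₀`. -/
noncomputable def chartForm (x₀ : M) (η : ∀ x : M, TangentSpace I x →L[ℝ] F) (y : E) : E →L[ℝ] F :=
  (η ((extChartAt I x₀).symm y)).comp (mfderiv 𝓘(ℝ, E) I (extChartAt I x₀).symm y)

/-- The one-form with given coordinate expression in the preferred chart at `x₀`. -/
noncomputable def pullForm (x₀ : M) (f : E → E →L[ℝ] F) (x : M) : TangentSpace I x →L[ℝ] F :=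
  (f (extChartAt I x₀ x)).comp (mfderiv I 𝓘(ℝ, E) (extChartAt I x₀) x)

lemma extD_eq_flatD (η : ∀ x : M, TangentSpace I x →L[ℝ] F) (x : M) (v w : TangentSpace I x) :
    extD I η x v w = flatD (chartForm x η) (extChartAt I x x) v w := rfl

/-- The coordinate expression of a covector at `x` in the preferred chart at `x₀`. -/
noncomputable def covecCoord (x₀ : M) {x : M} (u : TangentSpace I x →L[ℝ] F) : E →L[ℝ] F :=
  ContinuousLinearMap.comp (show E →L[ℝ] F from u)
    (show E →L[ℝ] E from mfderiv 𝓘(ℝ, E) I (extChartAt I x₀).symm (extChartAt I x₀ x))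

lemma chartForm_extChartAt {x₀ x : M} (η : ∀ x : M, TangentSpace I x →L[ℝ] F)
    (hx : x ∈ (extChartAt I x₀).source) :
    chartForm x₀ η (extChartAt I x₀ x) = covecCoord x₀ (η x) := by
  have h : ∀ {x' : M} (_ : x' = x) (A : E →L[ℝ] E),
      ContinuousLinearMap.comp (show E →L[ℝ] F from η x') A =
        ContinuousLinearMap.comp (show E →L[ℝ] F from η x) A := by
    rintro _ rfl _; rfl
  exact h ((extChartAt I x₀).left_inv hx) _

variable [I.Boundaryless] [IsManifold I ∞ M]

lemma symmL_eq {x₀ x : M} (hx : x ∈ (extChartAt I x₀).source) :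
    (trivializationAt E (TangentSpace I) x₀).symmL ℝ x =
      mfderiv 𝓘(ℝ, E) I (extChartAt I x₀).symm (extChartAt I x₀ x) := by
  rw [extChartAt_source] at hx
  rw [TangentBundle.symmL_trivializationAt hx, I.range_eq_univ, mfderivWithin_univ]

/-- The bundle trivialization of `Hom(TM, F)` is the coordinate expression of covectors, so
smoothness of a form becomes smoothness of its `chartForm`. -/
lemma trivialization_hom_apply {x₀ x : M} (u : TangentSpace I x →L[ℝ] F)
    (hx : x ∈ (extChartAt I x₀).source) :
    (trivializationAt (E →L[ℝ] F)
      (fun x : M => TangentSpace I x →L[ℝ] Bundle.Trivial M F x) x₀ ⟨x, u⟩).2 =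
    covecCoord x₀ u := by
  rw [hom_trivializationAt_apply]
  refine ContinuousLinearMap.ext fun v => ?_
  simp only [ContinuousLinearMap.inCoordinates]
  rw [symmL_eq hx]
  simp
  rfl

lemma isSmoothFormOn_iff {x₀ : M} {η : ∀ x : M, TangentSpace I x →L[ℝ] F} {U : Set M}
    (hU : IsOpen U) (hUs : U ⊆ (extChartAt I x₀).source) : IsSmoothFormOn I η U ↔
    ContMDiffOn I 𝓘(ℝ, E →L[ℝ] F) ∞ (fun x => chartForm x₀ η (extChartAt I x₀ x)) U := by
  rw [IsSmoothFormOn, (trivializationAt (E →L[ℝ] F)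
      (fun x : M => TangentSpace I x →L[ℝ] Bundle.Trivial M F x) x₀).contMDiffOn_section_iff hU
      (by
        intro x hx
        have := hUs hx
        simpa using this)]
  exact contMDiffOn_congr fun x hx =>
    (trivialization_hom_apply _ (hUs hx)).trans (chartForm_extChartAt η (hUs hx)).symm

/-- The coordinate expressions of a smooth form are smooth. -/
lemma IsSmoothFormOn.contDiffOn_chartForm {x₀ : M} {η : ∀ x : M, TangentSpace I x →L[ℝ] F}
    {U : Set M} (h : IsSmoothFormOn I η U) (hU : IsOpen U) :
    ContDiffOn ℝ ∞ (chartForm x₀ η)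
      ((extChartAt I x₀).target ∩ (extChartAt I x₀).symm ⁻¹' U) := by
  have hV : IsOpen (U ∩ (extChartAt I x₀).source) := hU.inter (isOpen_extChartAt_source x₀)
  have h1 := (isSmoothFormOn_iff (x₀ := x₀) hV inter_subset_right).1 (h.mono inter_subset_left)
  rw [← contMDiffOn_iff_contDiffOn]
  have h2 := h1.comp ((contMDiffOn_extChartAt_symm (I := I) (n := ∞) x₀).mono
    (s := (extChartAt I x₀).target) (t := (extChartAt I x₀).target ∩ (extChartAt I x₀).symm ⁻¹' U)
    inter_subset_left) fun y hy => ⟨hy.2, (extChartAt I x₀).map_target hy.1⟩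
  refine h2.congr fun y hy => ?_
  simp only [Function.comp_apply, (extChartAt I x₀).right_inv hy.1]

lemma mfderiv_symm_comp_mfderiv {x₀ x : M} (hx : x ∈ (extChartAt I x₀).source)
    (v : TangentSpace I x) :
    (mfderiv 𝓘(ℝ, E) I (extChartAt I x₀).symm (extChartAt I x₀ x)
      (mfderiv I 𝓘(ℝ, E) (extChartAt I x₀) x v) : E) = v := by
  have := mfderivWithin_extChartAt_symm_comp_mfderiv_extChartAt' (I := I) hx
  rw [I.range_eq_univ, mfderivWithin_univ] at this
  exact congrArg (fun L : E →L[ℝ] E => L v) this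

lemma mfderiv_comp_mfderiv_symm {x₀ : M} {y : E} (hy : y ∈ (extChartAt I x₀).target) (v : E) :
    (mfderiv I 𝓘(ℝ, E) (extChartAt I x₀) ((extChartAt I x₀).symm y)
      (mfderiv 𝓘(ℝ, E) I (extChartAt I x₀).symm y v) : E) = v := by
  have := mfderiv_extChartAt_comp_mfderivWithin_extChartAt_symm (I := I) hy
  rw [I.range_eq_univ, mfderivWithin_univ] at this
  exact congrArg (fun L : E →L[ℝ] E => L v) this

lemma chartForm_pullForm {x₀ : M} (f : E → E →L[ℝ] F) {y : E}
    (hy : y ∈ (extChartAt I x₀).target) : chartForm x₀ (pullForm (I := I) x₀ f) y = f y := by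
  refine ContinuousLinearMap.ext fun v => ?_
  refine (congrArg (f (extChartAt I x₀ ((extChartAt I x₀).symm y)))
    (mfderiv_comp_mfderiv_symm hy v)).trans ?_
  rw [(extChartAt I x₀).right_inv hy]

lemma covecCoord_apply {x₀ x : M} (u : TangentSpace I x →L[ℝ] F)
    (hx : x ∈ (extChartAt I x₀).source) (v : TangentSpace I x) :
    covecCoord x₀ u (mfderiv I 𝓘(ℝ, E) (extChartAt I x₀) x v) = u v :=
  congrArg (show E →L[ℝ] F from u) (mfderiv_symm_comp_mfderiv hx v)

lemma chartForm_apply {x₀ x : M} (η : ∀ x : M, TangentSpace I x →L[ℝ] F)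
    (hx : x ∈ (extChartAt I x₀).source) (v : TangentSpace I x) :
    chartForm x₀ η (extChartAt I x₀ x) (mfderiv I 𝓘(ℝ, E) (extChartAt I x₀) x v) = η x v := by
  rw [chartForm_extChartAt η hx]
  exact covecCoord_apply (η x) hx v

omit [I.Boundaryless] in
lemma mfderiv_extChartAt_bijective {x₀ x : M} (hx : x ∈ (extChartAt I x₀).source) :
    Function.Bijective (mfderiv I 𝓘(ℝ, E) (extChartAt I x₀) x) := by
  obtain ⟨e, he⟩ := isInvertible_mfderiv_extChartAt (I := I) hx
  rw [← he]
  exact e.bijective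

lemma covecCoord_bijective {x₀ x : M} {u : TangentSpace I x →L[ℝ] F}
    (hx : x ∈ (extChartAt I x₀).source) (hu : Function.Bijective u) :
    Function.Bijective (covecCoord x₀ u) := by
  have h := mfderiv_extChartAt_bijective (I := I) hx
  have hc : covecCoord x₀ u ∘ (mfderiv I 𝓘(ℝ, E) (extChartAt I x₀) x) = u :=
    funext fun v => covecCoord_apply u hx v
  exact (Function.Bijective.of_comp_iff _ h).1 (hc ▸ hu)

lemma isSmoothFormOn_pullForm {x₀ : M} {f : E → E →L[ℝ] F} {O : Set E}
    (hf : ContDiffOn ℝ ∞ f O) {U : Set M} (hU : IsOpen U) (hUs : U ⊆ (extChartAt I x₀).source)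
    (hUO : ∀ x ∈ U, extChartAt I x₀ x ∈ O) : IsSmoothFormOn I (pullForm x₀ f) U := by
  rw [isSmoothFormOn_iff hU hUs]
  have h1 : ContMDiffOn I 𝓘(ℝ, E →L[ℝ] F) ∞ (fun x => f (extChartAt I x₀ x)) U :=
    hf.contMDiffOn.comp ((contMDiffOn_extChartAt (I := I) (n := ∞)).mono (by
      rwa [extChartAt_source] at hUs)) hUO
  exact h1.congr fun x hx => chartForm_pullForm f ((extChartAt I x₀).map_source (hUs hx))

end ChartForms

/-! ### Independence of the exterior derivative from the chart -/

section ChangeOfChart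

/-- The second derivative of `ψ` enters symmetrically in `v, w` and drops out on alternation. -/
lemma flatD_pullback {E F : Type*} [NormedAddCommGroup E] [NormedSpace ℝ E]
    [NormedAddCommGroup F] [NormedSpace ℝ F] {E' : Type*} [NormedAddCommGroup E'] [NormedSpace ℝ E']
    {S : E → E →L[ℝ] F} {S' : E' → E' →L[ℝ] F} {ψ : E → E'}
    {y : E} (hS' : DifferentiableAt ℝ S' (ψ y)) (hψ : ContDiffAt ℝ ∞ ψ y)
    (h : S =ᶠ[𝓝 y] fun z => (S' (ψ z)).comp (fderiv ℝ ψ z)) (v w : E) :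
    flatD S y v w = flatD S' (ψ y) (fderiv ℝ ψ y v) (fderiv ℝ ψ y w) := by
  have hd : DifferentiableAt ℝ ψ y := hψ.differentiableAt (by simp)
  have hdd : DifferentiableAt ℝ (fderiv ℝ ψ) y :=
    (hψ.fderiv_right (m := 1) (by rw [one_add_one_eq_two]; exact ENat.LEInfty.out)).differentiableAt
      one_ne_zero
  have hsymm : IsSymmSndFDerivAt ℝ ψ y := hψ.isSymmSndFDerivAt (by simpa using ENat.LEInfty.out)
  have h1 := (hS'.hasFDerivAt.comp y hd.hasFDerivAt).clm_comp hdd.hasFDerivAt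
  have h2 := (h1.congr_of_eventuallyEq h).fderiv
  rw [flatD_apply, flatD_apply, h2]
  have e := hsymm v w
  simp [e]

variable {E H M F : Type*} [NormedAddCommGroup E] [NormedSpace ℝ E] [TopologicalSpace H]
  [TopologicalSpace M] [ChartedSpace H M] [NormedAddCommGroup F] [NormedSpace ℝ F]
  {I : ModelWithCorners ℝ E H} [I.Boundaryless] [IsManifold I ∞ M]

/-- The exterior derivative may be computed in any chart. -/
theorem extD_eq_chart {x₀ x : M} (hx : x ∈ (extChartAt I x₀).source)
    {η : ∀ x : M, TangentSpace I x →L[ℝ] F}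
    (hη : DifferentiableAt ℝ (chartForm x₀ η) (extChartAt I x₀ x)) (v w : TangentSpace I x) :
    extD I η x v w = flatD (chartForm x₀ η) (extChartAt I x₀ x)
      (mfderiv I 𝓘(ℝ, E) (extChartAt I x₀) x v) (mfderiv I 𝓘(ℝ, E) (extChartAt I x₀) x w) := by
  set Φ := extChartAt I x with hΦ
  set Φ₀ := extChartAt I x₀ with hΦ₀
  have hxx : Φ.symm (Φ x) = x := extChartAt_to_inv x
  -- `extD` is defined by the preferred chart at `x`; the pullback rule is applied to the change of
  -- coordinates to the chart at `x₀`.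
  let ψ : E → E := Φ₀ ∘ Φ.symm
  have hψx : ψ (Φ x) = Φ₀ x := congrArg Φ₀ hxx
  have hO : ∀ᶠ z in 𝓝 (Φ x), z ∈ Φ.target ∧ Φ.symm z ∈ Φ₀.source := by
    have h1 : Φ.target ∈ 𝓝 (Φ x) := extChartAt_target_mem_nhds x
    have h2 : ContinuousAt Φ.symm (Φ x) := continuousAt_extChartAt_symm x
    have h3 : Φ₀.source ∈ 𝓝 (Φ.symm (Φ x)) := by
      rw [hxx]; exact (isOpen_extChartAt_source x₀).mem_nhds hx
    filter_upwards [h1, h2.eventually h3] with z hz hz' using ⟨hz, hz'⟩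
  have hs : ∀ z, z ∈ Φ.target → ContMDiffAt 𝓘(ℝ, E) I ∞ Φ.symm z := fun z hz =>
    (contMDiffOn_extChartAt_symm (I := I) (n := ∞) x).contMDiffAt
      ((isOpen_extChartAt_target x).mem_nhds hz)
  have hs₀ : ∀ x', x' ∈ Φ₀.source → ContMDiffAt I 𝓘(ℝ, E) ∞ Φ₀ x' := fun x' hx' =>
    contMDiffAt_extChartAt' (by rwa [hΦ₀, extChartAt_source] at hx')
  have hfd : ∀ z, z ∈ Φ.target → Φ.symm z ∈ Φ₀.source → ∀ u : E,
      (mfderiv I 𝓘(ℝ, E) Φ₀ (Φ.symm z) (mfderiv 𝓘(ℝ, E) I Φ.symm z u) : E) = fderiv ℝ ψ z u := by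
    intro z hz hz' u
    rw [← mfderiv_eq_fderiv, mfderiv_comp z ((hs₀ _ hz').mdifferentiableAt (by simp))
      ((hs z hz).mdifferentiableAt (by simp))]
    rfl
  have hψ : ContDiffAt ℝ ∞ ψ (Φ x) := by
    obtain ⟨h1, h2⟩ := hO.self_of_nhds
    exact ((hs₀ _ h2).comp _ (hs _ h1)).contDiffAt
  have hS : chartForm x η =ᶠ[𝓝 (Φ x)] fun z => (chartForm x₀ η (ψ z)).comp (fderiv ℝ ψ z) := by
    filter_upwards [hO] with z hz
    refine ContinuousLinearMap.ext fun u => ?_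
    refine (chartForm_apply η hz.2 (mfderiv 𝓘(ℝ, E) I Φ.symm z u)).symm.trans ?_
    exact congrArg (chartForm x₀ η (ψ z)) (hfd z hz.1 hz.2 u)
  have hv : ∀ v : TangentSpace I x,
      fderiv ℝ ψ (Φ x) v = (mfderiv I 𝓘(ℝ, E) Φ₀ x v : E) := by
    intro v
    have e1 := hfd _ (mem_extChartAt_target x) (by rw [hxx]; exact hx) v
    rw [← e1]
    have e2 : (mfderiv 𝓘(ℝ, E) I Φ.symm (Φ x) v : E) = v := by
      have h3 := mfderivWithin_range_extChartAt_symm (I := I) (x := x)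
      rw [I.range_eq_univ, mfderivWithin_univ] at h3
      exact congrArg (fun L : E →L[ℝ] E => L v) h3
    have e3 : ∀ x', x' = x → ∀ u : E,
        ((show E →L[ℝ] E from mfderiv I 𝓘(ℝ, E) Φ₀ x') u : E) =
        (show E →L[ℝ] E from mfderiv I 𝓘(ℝ, E) Φ₀ x) u := by
      rintro _ rfl u; rfl
    refine (e3 _ hxx _).trans ?_
    exact congrArg (show E →L[ℝ] E from mfderiv I 𝓘(ℝ, E) Φ₀ x) e2
  have e := flatD_pullback (by rw [hψx]; exact hη) hψ hS (show E from v) (show E from w)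
  rw [hψx] at e
  refine (extD_eq_flatD η x v w).trans (e.trans ?_)
  exact congrArg₂ (fun a b => flatD (chartForm x₀ η) (Φ₀ x) a b) (hv v) (hv w)

end ChangeOfChart

/-! ### The tautological form on the manifold of coframes -/

section CoframeChart

variable {n : ℕ} {Z : Type*} [TopologicalSpace Z]
  [ChartedSpace (EuclideanSpace ℝ (Fin (dimZ n))) Z] [IsManifold (𝓡 (dimZ n)) ∞ Z]

/-- The base point, over `z`, of the charts of the manifold of coframes. -/
noncomputable def zeroCoframe (n : ℕ) {Z : Type*} [TopologicalSpace Z]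
    [ChartedSpace (EuclideanSpace ℝ (Fin (dimZ n))) Z] [IsManifold (𝓡 (dimZ n)) ∞ Z] (z : Z) : CoframeSpace n Z := ⟨z, 0⟩

/-- Charts of the bundle depend only on the base point of their centre, so the zero element of the
fibre can serve as centre although it is not a coframe. -/
lemma extChartAt_coframe (z₀ : Z) (p : CoframeSpace n Z)
    (hp : p.proj ∈ (extChartAt (𝓡 (dimZ n)) z₀).source) :
    extChartAt (modelCo n) (zeroCoframe n z₀) p =
      (extChartAt (𝓡 (dimZ n)) z₀ p.proj, covecCoord (I := 𝓡 (dimZ n)) (F := CoV n) z₀ p.snd) := by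
  have h1 : extChartAt (modelCo n) (zeroCoframe n z₀) p =
      (extChartAt (𝓡 (dimZ n)) z₀ p.proj,
        (trivializationAt (EuclideanSpace ℝ (Fin (dimZ n)) →L[ℝ] CoV n)
          (fun z : Z => TangentSpace (𝓡 (dimZ n)) z →L[ℝ] Bundle.Trivial Z (CoV n) z) z₀ p).2) := by
    rw [FiberBundle.extChartAt]
    refine Prod.ext (congrArg (extChartAt (𝓡 (dimZ n)) z₀) ?_) rfl
    refine Trivialization.coe_fst' (trivializationAt (EuclideanSpace ℝ (Fin (dimZ n)) →L[ℝ] CoV n)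
      (fun z : Z => TangentSpace (𝓡 (dimZ n)) z →L[ℝ] Bundle.Trivial Z (CoV n) z) z₀) ?_
    simpa [zeroCoframe] using hp
  rw [h1]
  exact congrArg _ (trivialization_hom_apply (I := 𝓡 (dimZ n)) (F := CoV n) _ hp)

lemma mem_extChartAt_coframe_source (z₀ : Z) (p : CoframeSpace n Z) :
    p ∈ (extChartAt (modelCo n) (zeroCoframe n z₀)).source ↔
      p.proj ∈ (extChartAt (𝓡 (dimZ n)) z₀).source := by
  rw [FiberBundle.extChartAt]
  rw [PartialEquiv.trans_source]
  have hb : p ∈ (trivializationAt (EuclideanSpace ℝ (Fin (dimZ n)) →L[ℝ] CoV n)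
      (fun z : Z => TangentSpace (𝓡 (dimZ n)) z →L[ℝ] Bundle.Trivial Z (CoV n) z) z₀).source ↔
      p.proj ∈ (extChartAt (𝓡 (dimZ n)) z₀).source := by simp
  refine ⟨fun h => hb.1 h.1, fun h => ⟨hb.2 h, ?_, mem_univ _⟩⟩
  have e : ((trivializationAt (EuclideanSpace ℝ (Fin (dimZ n)) →L[ℝ] CoV n)
      (fun z : Z => TangentSpace (𝓡 (dimZ n)) z →L[ℝ] Bundle.Trivial Z (CoV n) z) z₀) p).1 =
      p.proj := Trivialization.coe_fst _ (hb.2 h)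
  exact mem_of_eq_of_mem e h

lemma contMDiff_coframe_proj :
    ContMDiff (modelCo n) (𝓡 (dimZ n)) ∞ (fun q : CoframeSpace n Z => q.proj) :=
  Bundle.contMDiff_proj _

/-- The differential of a chart of the manifold of coframes. -/
noncomputable def coframeDeriv (z₀ : Z) (p : CoframeSpace n Z) : TangentSpace (modelCo n) p →L[ℝ]
    EuclideanSpace ℝ (Fin (dimZ n)) × (EuclideanSpace ℝ (Fin (dimZ n)) →L[ℝ] CoV n) :=
  mfderiv (modelCo n) 𝓘(ℝ, EuclideanSpace ℝ (Fin (dimZ n)) ×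
    (EuclideanSpace ℝ (Fin (dimZ n)) →L[ℝ] CoV n)) (extChartAt (modelCo n) (zeroCoframe n z₀)) p

/-- The tautological form in a chart of the manifold of coframes. -/
lemma taut_apply (z₀ : Z) {p : CoframeSpace n Z}
    (hp : p.proj ∈ (extChartAt (𝓡 (dimZ n)) z₀).source)
    (v : TangentSpace (modelCo n) p) :
    taut n p v = (extChartAt (modelCo n) (zeroCoframe n z₀) p).2 (coframeDeriv z₀ p v).1 := by
  have hpp := (mem_extChartAt_coframe_source z₀ p).2 hp
  set Ψ := extChartAt (modelCo n) (zeroCoframe n z₀) with hΨ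
  have hΨd : MDifferentiableAt (modelCo n) 𝓘(ℝ, EuclideanSpace ℝ (Fin (dimZ n)) ×
      (EuclideanSpace ℝ (Fin (dimZ n)) →L[ℝ] CoV n)) Ψ p :=
    mdifferentiableAt_extChartAt (by rwa [hΨ, extChartAt_source] at hpp)
  have hfst : MDifferentiableAt 𝓘(ℝ, EuclideanSpace ℝ (Fin (dimZ n)) ×
      (EuclideanSpace ℝ (Fin (dimZ n)) →L[ℝ] CoV n)) 𝓘(ℝ, EuclideanSpace ℝ (Fin (dimZ n)))
      Prod.fst (Ψ p) := differentiableAt_fst.mdifferentiableAt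
  have h1 := mfderiv_comp p hfst hΨd
  have hΦd : MDifferentiableAt (𝓡 (dimZ n)) 𝓘(ℝ, EuclideanSpace ℝ (Fin (dimZ n)))
      (extChartAt (𝓡 (dimZ n)) z₀) p.proj :=
    mdifferentiableAt_extChartAt (by rwa [extChartAt_source] at hp)
  have h2 := mfderiv_comp p hΦd (contMDiff_coframe_proj.mdifferentiableAt (by simp))
  have h3 : Prod.fst ∘ Ψ =ᶠ[𝓝 p] extChartAt (𝓡 (dimZ n)) z₀ ∘ fun q => q.proj := by
    filter_upwards [(isOpen_extChartAt_source (I := modelCo n) (zeroCoframe n z₀)).mem_nhds hpp]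
      with q hq
    exact congrArg Prod.fst (extChartAt_coframe z₀ q ((mem_extChartAt_coframe_source z₀ q).1 hq))
  rw [h3.mfderiv_eq, h2] at h1
  have h4 := congrArg (fun L : EuclideanSpace ℝ (Fin (dimZ n)) ×
      (EuclideanSpace ℝ (Fin (dimZ n)) →L[ℝ] CoV n) →L[ℝ] EuclideanSpace ℝ (Fin (dimZ n)) =>
      L v) h1
  rw [mfderiv_eq_fderiv, fderiv_fst] at h4
  have h5 : (coframeDeriv z₀ p v).1 = mfderiv (𝓡 (dimZ n)) 𝓘(ℝ, EuclideanSpace ℝ (Fin (dimZ n)))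
      (extChartAt (𝓡 (dimZ n)) z₀) p.proj
        (mfderiv (modelCo n) (𝓡 (dimZ n)) (fun q : CoframeSpace n Z => q.proj) p v) := h4.symm
  rw [h5, extChartAt_coframe z₀ p hp]
  exact (covecCoord_apply (I := 𝓡 (dimZ n)) (F := CoV n) p.snd hp _).symm

end CoframeChart

section CoframeChart

variable {n : ℕ} {Z : Type*} [TopologicalSpace Z]
  [ChartedSpace (EuclideanSpace ℝ (Fin (dimZ n))) Z] [IsManifold (𝓡 (dimZ n)) ∞ Z]

lemma coframeDeriv_surjective (z₀ : Z) {p : CoframeSpace n Z}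
    (hp : p.proj ∈ (extChartAt (𝓡 (dimZ n)) z₀).source) :
    Function.Surjective (coframeDeriv z₀ p) :=
  (mfderiv_extChartAt_bijective (I := modelCo n)
    ((mem_extChartAt_coframe_source z₀ p).2 hp)).2

/-- The tautological form in a chart of the manifold of coframes. -/
lemma chartForm_taut (z₀ : Z) {q : EuclideanSpace ℝ (Fin (dimZ n)) ×
      (EuclideanSpace ℝ (Fin (dimZ n)) →L[ℝ] CoV n)}
    (hq : q ∈ (extChartAt (modelCo n) (zeroCoframe n z₀)).target) :
    chartForm (I := modelCo n) (zeroCoframe n z₀) (taut n) q =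
      q.2 ∘L ContinuousLinearMap.fst ℝ _ _ := by
  set Ψ := extChartAt (modelCo n) (zeroCoframe n z₀) with hΨ
  have hs := Ψ.map_target hq
  have hr : Ψ (Ψ.symm q) = q := Ψ.right_inv hq
  have hp := (mem_extChartAt_coframe_source z₀ _).1 hs
  refine ContinuousLinearMap.ext fun u => ?_
  obtain ⟨v, rfl⟩ := coframeDeriv_surjective z₀ hp u
  have h1 := chartForm_apply (I := modelCo n) (x₀ := zeroCoframe n z₀) (taut n) hs v
  rw [← hΨ, hr] at h1
  refine h1.trans ?_
  rw [taut_apply z₀ hp, ← hΨ, hr]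
  rfl

/-- The exterior derivative of the tautological form. -/
lemma extD_taut (z₀ : Z) {p : CoframeSpace n Z}
    (hp : p.proj ∈ (extChartAt (𝓡 (dimZ n)) z₀).source) (v w : TangentSpace (modelCo n) p) :
    extD (modelCo n) (taut n) p v w = (coframeDeriv z₀ p v).2 (coframeDeriv z₀ p w).1
      - (coframeDeriv z₀ p w).2 (coframeDeriv z₀ p v).1 := by
  have hpp := (mem_extChartAt_coframe_source z₀ p).2 hp
  set Ψ := extChartAt (modelCo n) (zeroCoframe n z₀) with hΨ
  -- In coordinates `(x, L)` the tautological form is `L dx`. Its coefficients are linear in the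
  -- point, so their derivative is the constant `A`.
  set A : EuclideanSpace ℝ (Fin (dimZ n)) × (EuclideanSpace ℝ (Fin (dimZ n)) →L[ℝ] CoV n) →L[ℝ]
      EuclideanSpace ℝ (Fin (dimZ n)) × (EuclideanSpace ℝ (Fin (dimZ n)) →L[ℝ] CoV n) →L[ℝ] CoV n :=
    ((ContinuousLinearMap.compL ℝ (EuclideanSpace ℝ (Fin (dimZ n)) ×
      (EuclideanSpace ℝ (Fin (dimZ n)) →L[ℝ] CoV n)) (EuclideanSpace ℝ (Fin (dimZ n))) (CoV n)).flip
      (ContinuousLinearMap.fst ℝ _ _)) ∘L ContinuousLinearMap.snd ℝ _ _ with hA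
  have h1 : chartForm (I := modelCo n) (zeroCoframe n z₀) (taut n) =ᶠ[𝓝 (Ψ p)] A := by
    filter_upwards [(isOpen_extChartAt_target (I := modelCo n) (zeroCoframe n z₀)).mem_nhds
      (Ψ.map_source hpp)] with q hq using chartForm_taut z₀ hq
  have h2 : HasFDerivAt (chartForm (I := modelCo n) (zeroCoframe n z₀) (taut n)) A (Ψ p) :=
    A.hasFDerivAt.congr_of_eventuallyEq h1
  have h3 : ∀ a b, flatD (chartForm (I := modelCo n) (zeroCoframe n z₀) (taut n)) (Ψ p) a b =
      A a b - A b a := by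
    intro a b
    rw [flatD_apply, h2.fderiv]
  exact (extD_eq_chart (I := modelCo n) hpp h2.differentiableAt v w).trans (h3 _ _)

end CoframeChart

/-! ### Coordinate domains, and adapted coframe fields in them -/

section ChartDomain

variable {n : ℕ} {Z : Type*} [TopologicalSpace Z]
  [ChartedSpace (EuclideanSpace ℝ (Fin (dimZ n))) Z] {U : Set Z}

/-- The coordinate domain of an open set. -/
def chartDomain (n : ℕ) {Z : Type*} [TopologicalSpace Z]
    [ChartedSpace (EuclideanSpace ℝ (Fin (dimZ n))) Z] (z₀ : Z) (U : Set Z) :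
    Set (EuclideanSpace ℝ (Fin (dimZ n))) :=
  (extChartAt (𝓡 (dimZ n)) z₀).target ∩ (extChartAt (𝓡 (dimZ n)) z₀).symm ⁻¹' U

lemma isOpen_chartDomain (z₀ : Z) (hU : IsOpen U) : IsOpen (chartDomain n z₀ U) :=
  (continuousOn_extChartAt_symm z₀).isOpen_inter_preimage (isOpen_extChartAt_target z₀) hU

/-- Points and vectors in the coordinate domain come from the manifold. -/
lemma exists_of_mem_chartDomain {z₀ : Z} {y : EuclideanSpace ℝ (Fin (dimZ n))}
    (hy : y ∈ chartDomain n z₀ U) : ∃ z ∈ U, z ∈ (extChartAt (𝓡 (dimZ n)) z₀).source ∧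
      extChartAt (𝓡 (dimZ n)) z₀ z = y :=
  ⟨_, hy.2, (extChartAt (𝓡 (dimZ n)) z₀).map_target hy.1, (extChartAt (𝓡 (dimZ n)) z₀).right_inv hy.1⟩

lemma mem_chartDomain {z₀ z : Z} (hz : z ∈ U) (hzs : z ∈ (extChartAt (𝓡 (dimZ n)) z₀).source) :
    extChartAt (𝓡 (dimZ n)) z₀ z ∈ chartDomain n z₀ U := by
  refine ⟨(extChartAt (𝓡 (dimZ n)) z₀).map_source hzs, ?_⟩
  rw [mem_preimage, (extChartAt (𝓡 (dimZ n)) z₀).left_inv hzs]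
  exact hz

end ChartDomain

section AdaptedFields

variable {n : ℕ} {Y Z : Type*} [TopologicalSpace Y]
  [ChartedSpace (EuclideanSpace ℝ (Fin (2 * n + 1))) Y] [IsManifold (𝓡 (2 * n + 1)) ∞ Y]
  [TopologicalSpace Z]
  [ChartedSpace (EuclideanSpace ℝ (Fin (dimZ n))) Z] [IsManifold (𝓡 (dimZ n)) ∞ Z]
  {G : LegendrianPathGeometry n Y Z} {U U' : Set Z}
  {s s' : ∀ z : Z, TangentSpace (𝓡 (dimZ n)) z →L[ℝ] CoV n}

/-- The congruences are conditions on the steps of the flag and pass to coordinates by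
`extD_eq_chart`. -/
lemma IsAdaptedCoframeField.isFlatAdapted (h : IsAdaptedCoframeField G U s) (z₀ : Z) :
    IsFlatAdapted (chartForm (I := 𝓡 (dimZ n)) z₀ s) (chartDomain n z₀ U) := by
  have hW := isOpen_chartDomain (n := n) z₀ h.isOpen
  have hS : ContDiffOn ℝ ∞ (chartForm (I := 𝓡 (dimZ n)) z₀ s) (chartDomain n z₀ U) :=
    h.smooth.contDiffOn_chartForm h.isOpen
  have hext : ∀ z ∈ U, ∀ hz : z ∈ (extChartAt (𝓡 (dimZ n)) z₀).source,
      ∀ v w : TangentSpace (𝓡 (dimZ n)) z,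
      extD (𝓡 (dimZ n)) s z v w = flatD (chartForm (I := 𝓡 (dimZ n)) z₀ s)
        (extChartAt (𝓡 (dimZ n)) z₀ z)
        (mfderiv (𝓡 (dimZ n)) 𝓘(ℝ, EuclideanSpace ℝ (Fin (dimZ n))) (extChartAt (𝓡 (dimZ n)) z₀) z v)
        (mfderiv (𝓡 (dimZ n)) 𝓘(ℝ, EuclideanSpace ℝ (Fin (dimZ n)))
          (extChartAt (𝓡 (dimZ n)) z₀) z w) := fun z hzU hz v w =>
    extD_eq_chart hz ((hS.contDiffAt (hW.mem_nhds (mem_chartDomain hzU hz))).differentiableAt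
      (by simp)) v w
  refine ⟨hW, hS, ?_, ?_, ?_, ?_⟩
  · intro y hy
    obtain ⟨z, hzU, hz, rfl⟩ := exists_of_mem_chartDomain hy
    rw [chartForm_extChartAt s hz]
    exact covecCoord_bijective hz (h.coframe z hzU)
  · intro y hy v w hv hw
    obtain ⟨z, hzU, hz, rfl⟩ := exists_of_mem_chartDomain hy
    obtain ⟨v, rfl⟩ := (mfderiv_extChartAt_bijective (I := 𝓡 (dimZ n)) hz).2 v
    obtain ⟨w, rfl⟩ := (mfderiv_extChartAt_bijective (I := 𝓡 (dimZ n)) hz).2 w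
    have hv' : s z v ∈ filt0 n := by rw [← chartForm_apply s hz v]; exact hv
    have hw' : s z w ∈ filt0 n := by rw [← chartForm_apply s hz w]; exact hw
    have key : extD (𝓡 (dimZ n)) s z v w - stdTorsion (s z v) (s z w) ∈ filt0 n := by
      have := h.d_th0 z hzU v w hv' hw'
      simp only [mem_filt0, map_sub, this, coTh0_stdTorsion, wedge]
      simp [mul_comm]
    rw [hext z hzU hz, ← chartForm_apply s hz v, ← chartForm_apply s hz w] at key
    exact key
  · intro y hy v w hv hw
    obtain ⟨z, hzU, hz, rfl⟩ := exists_of_mem_chartDomain hy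
    obtain ⟨v, rfl⟩ := (mfderiv_extChartAt_bijective (I := 𝓡 (dimZ n)) hz).2 v
    obtain ⟨w, rfl⟩ := (mfderiv_extChartAt_bijective (I := 𝓡 (dimZ n)) hz).2 w
    have hv' : s z v ∈ filt1 n := by rw [← chartForm_apply s hz v]; exact hv
    have hw' : s z w ∈ filt1 n := by rw [← chartForm_apply s hz w]; exact hw
    have key : extD (𝓡 (dimZ n)) s z v w - stdTorsion (s z v) (s z w) ∈ filt1 n := by
      have hv1 := mem_filt1.1 hv'
      have hw1 := mem_filt1.1 hw'
      have e0 := h.d_th0 z hzU v w hv1.1 hw1.1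
      have e1 := h.d_th z hzU v w hv1.1 hw1.1 hv1.2 hw1.2
      refine mem_filt1.2 ⟨?_, fun i => ?_⟩
      · simp [e0, wedge, hv1.2, hw1.2]
      · simp only [map_sub, e1, coTh_stdTorsion, wedge]
        simp [mul_comm]
    rw [hext z hzU hz, ← chartForm_apply s hz v, ← chartForm_apply s hz w] at key
    exact key
  · intro y hy v w hv hw
    obtain ⟨z, hzU, hz, rfl⟩ := exists_of_mem_chartDomain hy
    obtain ⟨v, rfl⟩ := (mfderiv_extChartAt_bijective (I := 𝓡 (dimZ n)) hz).2 v
    obtain ⟨w, rfl⟩ := (mfderiv_extChartAt_bijective (I := 𝓡 (dimZ n)) hz).2 w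
    have hv' : s z v ∈ filt2 n := by rw [← chartForm_apply s hz v]; exact hv
    have hw' : s z w ∈ filt2 n := by rw [← chartForm_apply s hz w]; exact hw
    have key : extD (𝓡 (dimZ n)) s z v w ∈ filt2 n := by
      obtain ⟨a0, a1, a2⟩ := mem_filt2.1 hv'
      obtain ⟨b0, b1, b2⟩ := mem_filt2.1 hw'
      have e0 := h.d_th0 z hzU v w a0 b0
      have e1 := h.d_th z hzU v w a0 b0 a1 b1
      have e2 := h.d_TT z hzU v w a0 b0 a1 b1 a2 b2
      exact mem_filt2.2 ⟨by simp [e0, wedge, a1, b1], fun i => by simp [e1, wedge, a2, b2], e2⟩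
    rw [hext z hzU hz] at key
    exact key

/-- Together with `mem_filt2_iff`: the preimages of the largest and the smallest step of the flag
depend on the geometry alone. This, with the congruences, makes any two adapted fields comparable.
-/
lemma IsAdaptedCoframeField.mem_filt0_iff (h : IsAdaptedCoframeField G U s) {z : Z} (hz : z ∈ U)
    (v : TangentSpace (𝓡 (dimZ n)) z) : s z v ∈ filt0 n ↔
      mfderiv (𝓡 (dimZ n)) (𝓡 (2 * n + 1)) G.proj z v ∈ G.D (G.proj z) :=
  h.contact z hz v

lemma IsAdaptedCoframeField.mem_filt2_iff (h : IsAdaptedCoframeField G U s) {z : Z} (hz : z ∈ U)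
    (v : TangentSpace (𝓡 (dimZ n)) z) : s z v ∈ filt2 n ↔ ∀ ξ ∈ G.sys z, ξ v = 0 := by
  rw [h.sys z hz, mem_filt2]
  constructor
  · rintro ⟨h0, h1, h2⟩ ξ hξ
    induction hξ using Submodule.span_induction with
    | mem ξ hξ =>
      rcases hξ with (rfl | ⟨i, rfl⟩) | ⟨ij, rfl⟩
      · exact h0
      · exact h1 i
      · exact h2 _ _
    | zero => rfl
    | add a b _ _ ha hb => simp [ha, hb]
    | smul c a _ ha => simp [ha]
  · intro h
    exact ⟨h _ (Submodule.subset_span (Or.inl (Or.inl rfl))),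
      fun i => h _ (Submodule.subset_span (Or.inl (Or.inr ⟨i, rfl⟩))),
      fun i j => h _ (Submodule.subset_span (Or.inr ⟨(i, j), rfl⟩))⟩

/-- Two adapted coframe fields are related by admissible transitions. -/
lemma IsAdaptedCoframeField.isTransition (h : IsAdaptedCoframeField G U s)
    (h' : IsAdaptedCoframeField G U' s') {z₀ z : Z} (hzs : z ∈ (extChartAt (𝓡 (dimZ n)) z₀).source)
    (hz : z ∈ U) (hz' : z ∈ U') :
    IsTransition (transition (chartForm (I := 𝓡 (dimZ n)) z₀ s) (extChartAt (𝓡 (dimZ n)) z₀ z)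
      (covecCoord (I := 𝓡 (dimZ n)) z₀ (s' z))) := by
  have hW := isOpen_chartDomain (n := n) z₀ (h.isOpen.inter h'.isOpen)
  have f := (h.isFlatAdapted z₀).mono hW (inter_subset_inter_right _ fun _ hy => hy.1)
  have f' := (h'.isFlatAdapted z₀).mono hW (inter_subset_inter_right _ fun _ hy => hy.2)
  rw [← chartForm_extChartAt s' hzs]
  refine f.isTransition f' ?_ ?_ (mem_chartDomain ⟨hz, hz'⟩ hzs)
  · intro y hy v hv
    obtain ⟨z, hzU, hz, rfl⟩ := exists_of_mem_chartDomain hy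
    obtain ⟨v, rfl⟩ := (mfderiv_extChartAt_bijective (I := 𝓡 (dimZ n)) hz).2 v
    have hv' : s z v ∈ filt0 n := by rw [← chartForm_apply s hz v]; exact hv
    have hw' := (h'.mem_filt0_iff hzU.2 v).2 ((h.mem_filt0_iff hzU.1 v).1 hv')
    rw [← chartForm_apply s' hz v] at hw'; exact hw'
  · intro y hy v hv
    obtain ⟨z, hzU, hz, rfl⟩ := exists_of_mem_chartDomain hy
    obtain ⟨v, rfl⟩ := (mfderiv_extChartAt_bijective (I := 𝓡 (dimZ n)) hz).2 v
    have hv' : s z v ∈ filt2 n := by rw [← chartForm_apply s hz v]; exact hv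
    have hw' := (h'.mem_filt2_iff hzU.2 v).2 ((h.mem_filt2_iff hzU.1 v).1 hv')
    rw [← chartForm_apply s' hz v] at hw'; exact hw'

end AdaptedFields

/-! ### The pseudoconnection defined by one adapted coframe field -/

section LocalConnection

variable {n : ℕ} {Y Z : Type*} [TopologicalSpace Y]
  [ChartedSpace (EuclideanSpace ℝ (Fin (2 * n + 1))) Y] [IsManifold (𝓡 (2 * n + 1)) ∞ Y]
  [TopologicalSpace Z]
  [ChartedSpace (EuclideanSpace ℝ (Fin (dimZ n))) Z] [IsManifold (𝓡 (dimZ n)) ∞ Z]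
  {G : LegendrianPathGeometry n Y Z} {U : Set Z}
  {s : ∀ z : Z, TangentSpace (𝓡 (dimZ n)) z →L[ℝ] CoV n}

/-- A pseudoconnection `φ`, with torsion forms `τ`, over the subset `U` of `Z`, that satisfies the
structure equations. -/
structure IsConnectionOver (G : LegendrianPathGeometry n Y Z) (U : Set Z)
    (φ : ∀ p : CoframeSpace n Z, TangentSpace (modelCo n) p →L[ℝ] H1Space n)
    (τ : ∀ p : CoframeSpace n Z,
      TangentSpace (modelCo n) p →L[ℝ] (Fin n → Fin n → symMat n)) : Prop where
  smooth : ∀ p ∈ F1 G, p.proj ∈ U → ∃ O : Set (CoframeSpace n Z), IsOpen O ∧ p ∈ O ∧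
    IsSmoothFormOn (modelCo n) φ O ∧ IsSmoothFormOn (modelCo n) τ O
  fibre : ∀ z ∈ U, ∀ (u : ℝ → (TangentSpace (𝓡 (dimZ n)) z →L[ℝ] CoV n)) (h : ℝ → H1Space n)
    (X : H1Space n),
    (∀ t, (⟨z, u t⟩ : CoframeSpace n Z) ∈ F1 G) →
    ContMDiff 𝓘(ℝ, ℝ) (modelCo n) ∞ (fun t => (⟨z, u t⟩ : CoframeSpace n Z)) →
    (∀ t v, u t v = h1Act (h t) (u 0 v)) → h 0 = h1One n → HasDerivAt h X 0 →
    φ ⟨z, u 0⟩ (mfderiv 𝓘(ℝ, ℝ) (modelCo n) (fun t => (⟨z, u t⟩ : CoframeSpace n Z)) 0 (1 : ℝ)) = -X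
  symm : ∀ p ∈ F1 G, p.proj ∈ U → ∀ v i j, τ p v i j = τ p v j i
  wedge_om : ∀ p ∈ F1 G, p.proj ∈ U → ∀ v w i j k,
    ∑ l, ((τ p v i j).1 k l * coOm l (taut n p w) - (τ p w i j).1 k l * coOm l (taut n p v)) = 0
  structure_eq : ∀ p ∈ F1 G, p.proj ∈ U → ∀ v ∈ tangentVectors (modelCo n) (F1 G) p,
    ∀ w ∈ tangentVectors (modelCo n) (F1 G) p,
    extD (modelCo n) (taut n) p v w = stdTorsion (taut n p v) (taut n p w)
      - infAct (φ p v) (taut n p w) + infAct (φ p w) (taut n p v)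
      + tauAct (τ p w) (taut n p v) - tauAct (τ p v) (taut n p w)

lemma hasDerivAt_coframe_curve (z₀ : Z) {c : ℝ → CoframeSpace n Z}
    (hc : ContMDiff 𝓘(ℝ, ℝ) (modelCo n) ∞ c)
    (h0 : (c 0).proj ∈ (extChartAt (𝓡 (dimZ n)) z₀).source) :
    HasDerivAt (fun t => extChartAt (modelCo n) (zeroCoframe n z₀) (c t))
      (coframeDeriv z₀ (c 0) (mfderiv 𝓘(ℝ, ℝ) (modelCo n) c 0 (1 : ℝ))) 0 := by
  have hpp := (mem_extChartAt_coframe_source z₀ (c 0)).2 h0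
  set Ψ := extChartAt (modelCo n) (zeroCoframe n z₀) with hΨ
  have hΨd : MDifferentiableAt (modelCo n) 𝓘(ℝ, EuclideanSpace ℝ (Fin (dimZ n)) ×
      (EuclideanSpace ℝ (Fin (dimZ n)) →L[ℝ] CoV n)) Ψ (c 0) :=
    mdifferentiableAt_extChartAt (by rwa [hΨ, extChartAt_source] at hpp)
  have hcd : MDifferentiableAt 𝓘(ℝ, ℝ) (modelCo n) c 0 := hc.mdifferentiableAt (by simp)
  have h1 := mfderiv_comp (0 : ℝ) hΨd hcd
  have h2 : DifferentiableAt ℝ (Ψ ∘ c) 0 := (hΨd.comp (0 : ℝ) hcd).differentiableAt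
  have h3 := h2.hasDerivAt
  refine h3.congr_deriv ?_
  rw [← fderiv_apply_one_eq_deriv, ← mfderiv_eq_fderiv, h1]
  rfl

lemma mem_F1_bijective {p : CoframeSpace n Z} (hp : p ∈ F1 G) :
    Function.Bijective (show TangentSpace (𝓡 (dimZ n)) p.proj →L[ℝ] CoV n from p.snd) := by
  obtain ⟨U', s', hpU, h', e⟩ := hp
  rw [e]
  exact h'.coframe _ hpU

/-- A point of `F1` is a value of some adapted field, in general not of `s`; the two fields are
compared near the point. -/
lemma F1_isTransition (h : IsAdaptedCoframeField G U s) {z₀ : Z} {p : CoframeSpace n Z}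
    (hp : p ∈ F1 G) (hpU : p.proj ∈ U) (hps : p.proj ∈ (extChartAt (𝓡 (dimZ n)) z₀).source) :
    IsTransition (transition (chartForm (I := 𝓡 (dimZ n)) z₀ s)
      (extChartAt (modelCo n) (zeroCoframe n z₀) p).1
      (extChartAt (modelCo n) (zeroCoframe n z₀) p).2) := by
  rw [extChartAt_coframe z₀ p hps]
  obtain ⟨U', s', hpU', h', e⟩ := hp
  rw [e]
  exact h.isTransition h' hps hpU hpU'

lemma F1_bijective {z₀ : Z} {p : CoframeSpace n Z}
    (hp : p ∈ F1 G) (hps : p.proj ∈ (extChartAt (𝓡 (dimZ n)) z₀).source) :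
    Function.Bijective (extChartAt (modelCo n) (zeroCoframe n z₀) p).2 := by
  rw [extChartAt_coframe z₀ p hps]
  exact covecCoord_bijective hps (mem_F1_bijective hp)

/-- A tangent vector of `F1` is the velocity of a curve in `F1`. Along the curve the map relating it
to `s` is a transition, and `fibreForm` is its logarithmic derivative. No manifold structure on `F1`
is used. -/
lemma F1_isInfinitesimalTransition (h : IsAdaptedCoframeField G U s) {z₀ : Z}
    {p : CoframeSpace n Z} (hpU : p.proj ∈ U)
    (hps : p.proj ∈ (extChartAt (𝓡 (dimZ n)) z₀).source) {v : TangentSpace (modelCo n) p}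
    (hv : v ∈ tangentVectors (modelCo n) (F1 G) p) :
    IsInfinitesimalTransition (fibreForm (chartForm (I := 𝓡 (dimZ n)) z₀ s)
      (extChartAt (modelCo n) (zeroCoframe n z₀) p) (coframeDeriv z₀ p v) : CoV n →ₗ[ℝ] CoV n) := by
  have : CompleteSpace (CoV n) := FiniteDimensional.complete ℝ _
  obtain ⟨c, hc, hF, rfl, hv⟩ := hv
  have hder := hasDerivAt_coframe_curve z₀ hc hps
  have hv' : mfderiv 𝓘(ℝ, ℝ) (modelCo n) c 0 (1 : ℝ) = v := hv
  rw [hv'] at hder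
  have hfl := h.isFlatAdapted z₀
  set S := chartForm (I := 𝓡 (dimZ n)) z₀ s with hS
  set Ψ := extChartAt (modelCo n) (zeroCoframe n z₀) with hΨ
  have hev : ∀ᶠ t in 𝓝 (0 : ℝ), (c t).proj ∈ U ∩ (extChartAt (𝓡 (dimZ n)) z₀).source := by
    have h1 : ContinuousAt (fun t => (c t).proj) 0 :=
      (contMDiff_coframe_proj.comp hc).continuous.continuousAt
    exact h1.eventually ((h.isOpen.inter (isOpen_extChartAt_source z₀)).mem_nhds ⟨hpU, hps⟩)
  have hx : (Ψ (c 0)).1 ∈ chartDomain n z₀ U := by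
    rw [hΨ, extChartAt_coframe z₀ _ hps]
    exact mem_chartDomain hpU hps
  have hd := fun a => hasDerivAt_transition (S := S) hder.fst hder.snd
    ((hfl.smooth.contDiffAt (hfl.isOpen.mem_nhds hx)).differentiableAt (by simp))
    (hfl.bij _ hx) (F1_bijective (hF 0) hps) a
  exact IsTransition.isInfinitesimalTransition (N := fun t => transition S (Ψ (c t)).1 (Ψ (c t)).2)
    (hev.mono fun t ht => F1_isTransition h (hF t) ht.1 ht.2) hd

/-- The domain of a chart of the bundle of coframes. -/
def coframeChartDomain (z₀ : Z) (U : Set Z) : Set (CoframeSpace n Z) :=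
  (extChartAt (modelCo n) (zeroCoframe n z₀)).source ∩
    extChartAt (modelCo n) (zeroCoframe n z₀) ⁻¹' coframeDomain (CoV n) (chartDomain n z₀ U)

lemma isOpen_coframeChartDomain (z₀ : Z) (hU : IsOpen U) :
    IsOpen (coframeChartDomain z₀ U : Set (CoframeSpace n Z)) := by
  have : CompleteSpace (CoV n) := FiniteDimensional.complete ℝ _
  exact (continuousOn_extChartAt _).isOpen_inter_preimage (isOpen_extChartAt_source _)
    (isOpen_coframeDomain (isOpen_chartDomain z₀ hU))

lemma F1_mem_coframeChartDomain {z₀ : Z} {p : CoframeSpace n Z} (hp : p ∈ F1 G) (hpU : p.proj ∈ U)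
    (hps : p.proj ∈ (extChartAt (𝓡 (dimZ n)) z₀).source) : p ∈ coframeChartDomain z₀ U := by
  refine ⟨(mem_extChartAt_coframe_source z₀ p).2 hps, ?_, F1_bijective hp hps⟩
  rw [extChartAt_coframe z₀ p hps]
  exact mem_chartDomain hpU hps

section

variable {F : Type*} [NormedAddCommGroup F] [NormedSpace ℝ F]

/-- The form on the space of coframes that is constructed, in a chart, from the adapted coframe
field `s`. -/
noncomputable def coordForm (s : ∀ z : Z, TangentSpace (𝓡 (dimZ n)) z →L[ℝ] CoV n) (z₀ : Z)
    (κ : (CoV n →L[ℝ] CoV n) →L[ℝ] F) (K : TorsionMap (CoV n) F)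
    (c : CoV n →L[ℝ] CoV n →L[ℝ] CoV n) (p : CoframeSpace n Z) :
    TangentSpace (modelCo n) p →L[ℝ] F :=
  pullForm (I := modelCo n) (zeroCoframe n z₀)
    (coframeForm κ K c (chartForm (I := 𝓡 (dimZ n)) z₀ s)) p

lemma coordForm_apply (z₀ : Z) (κ : (CoV n →L[ℝ] CoV n) →L[ℝ] F) (K : TorsionMap (CoV n) F)
    (c : CoV n →L[ℝ] CoV n →L[ℝ] CoV n) (p : CoframeSpace n Z) (v : TangentSpace (modelCo n) p) :
    coordForm s z₀ κ K c p v = coframeForm κ K c (chartForm (I := 𝓡 (dimZ n)) z₀ s)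
      (extChartAt (modelCo n) (zeroCoframe n z₀) p) (coframeDeriv z₀ p v) := rfl

/-- The choice `κ = 0` leaves only the horizontal term, which is the form of `τ`. -/
lemma coordForm_zero_apply {z₀ : Z} (K : TorsionMap (CoV n) F)
    (c : CoV n →L[ℝ] CoV n →L[ℝ] CoV n) {p : CoframeSpace n Z}
    (hps : p.proj ∈ (extChartAt (𝓡 (dimZ n)) z₀).source) (v : TangentSpace (modelCo n) p) :
    coordForm s z₀ 0 K c p v = K (flatTorsion (chartForm (I := 𝓡 (dimZ n)) z₀ s)
        (extChartAt (modelCo n) (zeroCoframe n z₀) p) - c) (taut n p v) := by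
  rw [taut_apply z₀ hps, coordForm_apply, coframeForm_zero_apply]

lemma coordForm_apply_of_fibre {z₀ : Z} (κ : (CoV n →L[ℝ] CoV n) →L[ℝ] F)
    (K : TorsionMap (CoV n) F)
    (c : CoV n →L[ℝ] CoV n →L[ℝ] CoV n) {p : CoframeSpace n Z} {v : TangentSpace (modelCo n) p}
    (hv : (coframeDeriv z₀ p v).1 = 0) :
    coordForm s z₀ κ K c p v = -κ (fibreForm (chartForm (I := 𝓡 (dimZ n)) z₀ s)
      (extChartAt (modelCo n) (zeroCoframe n z₀) p) (coframeDeriv z₀ p v)) := by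
  rw [coordForm_apply, coframeForm_apply, hv, map_zero, map_zero, add_zero]

lemma isSmoothFormOn_coordForm (h : IsAdaptedCoframeField G U s) (z₀ : Z)
    (κ : (CoV n →L[ℝ] CoV n) →L[ℝ] F)
    (K : TorsionMap (CoV n) F) (c : CoV n →L[ℝ] CoV n →L[ℝ] CoV n) :
    IsSmoothFormOn (modelCo n) (coordForm s z₀ κ K c) (coframeChartDomain z₀ U) := by
  have hfl := h.isFlatAdapted z₀
  exact isSmoothFormOn_pullForm (I := modelCo n)
    (contDiffOn_coframeForm κ K c hfl.isOpen hfl.smooth hfl.bij)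
    (isOpen_coframeChartDomain z₀ h.isOpen) inter_subset_left fun _ hx => hx.2

end

variable {κ : (CoV n →L[ℝ] CoV n) →L[ℝ] H1Space n} {K : TorsionMap (CoV n) (H1Space n)}
    {K' : TorsionMap (CoV n) (Fin n → Fin n → symMat n)} {c : CoV n →L[ℝ] CoV n →L[ℝ] CoV n}

/-- On vertical vectors the absorbing term vanishes and `fibreForm` is `infAct X`, from which `κ`
recovers `X`. -/
lemma coordForm_fibre (hd : IsConnectionData κ K K' c) {z₀ z : Z}
    (hz : z ∈ (extChartAt (𝓡 (dimZ n)) z₀).source)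
    {u : ℝ → (TangentSpace (𝓡 (dimZ n)) z →L[ℝ] CoV n)} {g : ℝ → H1Space n} {X : H1Space n}
    (hF : ∀ t, (⟨z, u t⟩ : CoframeSpace n Z) ∈ F1 G)
    (hc : ContMDiff 𝓘(ℝ, ℝ) (modelCo n) ∞ (fun t => (⟨z, u t⟩ : CoframeSpace n Z)))
    (hu : ∀ t v, u t v = h1Act (g t) (u 0 v)) (h0 : g 0 = h1One n) (hX : HasDerivAt g X 0) :
    coordForm s z₀ κ K c ⟨z, u 0⟩
      (mfderiv 𝓘(ℝ, ℝ) (modelCo n) (fun t => (⟨z, u t⟩ : CoframeSpace n Z)) 0 (1 : ℝ)) = -X := by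
  have : CompleteSpace (CoV n) := FiniteDimensional.complete ℝ _
  have hder := hasDerivAt_coframe_curve z₀ hc hz
  set S := chartForm (I := 𝓡 (dimZ n)) z₀ s with hS
  set Ψ := extChartAt (modelCo n) (zeroCoframe n z₀) with hΨ
  set V := mfderiv 𝓘(ℝ, ℝ) (modelCo n) (fun t => (⟨z, u t⟩ : CoframeSpace n Z)) 0 (1 : ℝ) with hV
  have hΨt : ∀ t, Ψ (⟨z, u t⟩ : CoframeSpace n Z) = (extChartAt (𝓡 (dimZ n)) z₀ z,
      covecCoord (I := 𝓡 (dimZ n)) (F := CoV n) z₀ (u t)) := fun t => extChartAt_coframe z₀ _ hz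
  have hb : Function.Bijective (Ψ (⟨z, u 0⟩ : CoframeSpace n Z)).2 := F1_bijective (hF 0) hz
  have e1 : (coframeDeriv z₀ (⟨z, u 0⟩ : CoframeSpace n Z) V).1 = 0 := by
    have h1 : HasDerivAt (fun t => (Ψ (⟨z, u t⟩ : CoframeSpace n Z)).1)
        (coframeDeriv z₀ (⟨z, u 0⟩ : CoframeSpace n Z) V).1 0 := hder.fst
    simp only [hΨt] at h1
    exact h1.unique (hasDerivAt_const _ _)
  have e2 : ∀ a, fibreForm S (Ψ (⟨z, u 0⟩ : CoframeSpace n Z))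
      (coframeDeriv z₀ (⟨z, u 0⟩ : CoframeSpace n Z) V) a = infAct X a := by
    intro a
    obtain ⟨w, rfl⟩ := hb.2 a
    rw [fibreForm_apply, e1, inverse_apply_self hb]
    simp only [map_zero, zero_apply, sub_zero]
    refine hasDerivAt_h1Act h0 hX ?_
    have h1 : HasDerivAt (fun t => (Ψ (⟨z, u t⟩ : CoframeSpace n Z)).2)
        (coframeDeriv z₀ (⟨z, u 0⟩ : CoframeSpace n Z) V).2 0 := hder.snd
    have h2 := h1.clm_apply (hasDerivAt_const (0 : ℝ) w)
    simp only [map_zero, add_zero, hΨt] at h2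
    simp only [hΨt]
    refine h2.congr_of_eventuallyEq (Filter.Eventually.of_forall fun t => ?_)
    exact (hu t _).symm
  refine (coordForm_apply_of_fibre κ K c e1).trans ?_
  exact congrArg Neg.neg (hd.fibre X _ e2)

lemma coordForm_structure_eq (hd : IsConnectionData κ K K' c) (h : IsAdaptedCoframeField G U s)
    {z₀ : Z} {p : CoframeSpace n Z} (hp : p ∈ F1 G) (hpU : p.proj ∈ U)
    (hps : p.proj ∈ (extChartAt (𝓡 (dimZ n)) z₀).source) {v w : TangentSpace (modelCo n) p}
    (hv : v ∈ tangentVectors (modelCo n) (F1 G) p) (hw : w ∈ tangentVectors (modelCo n) (F1 G) p) :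
    extD (modelCo n) (taut n) p v w = stdTorsion (taut n p v) (taut n p w)
      - infAct (coordForm s z₀ κ K c p v) (taut n p w)
      + infAct (coordForm s z₀ κ K c p w) (taut n p v)
      + tauAct (coordForm s z₀ 0 K' c p w) (taut n p v)
      - tauAct (coordForm s z₀ 0 K' c p v) (taut n p w) := by
  have hx : (extChartAt (modelCo n) (zeroCoframe n z₀) p).1 ∈ chartDomain n z₀ U := by
    rw [extChartAt_coframe z₀ _ hps]
    exact mem_chartDomain hpU hps
  have hq := F1_bijective hp hps
  rw [extD_taut z₀ hps, taut_apply z₀ hps, taut_apply z₀ hps]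
  exact hd.structure_equation hq
    ((h.isFlatAdapted z₀).isAdaptedTorsion hx hq (F1_isTransition h hp hpU hps))
    (F1_isInfinitesimalTransition h hpU hps hv) (F1_isInfinitesimalTransition h hpU hps hw)

theorem IsAdaptedCoframeField.isConnectionOver (h : IsAdaptedCoframeField G U s) (z₀ : Z)
    (hd : IsConnectionData κ K K' c) :
    IsConnectionOver G (U ∩ (extChartAt (𝓡 (dimZ n)) z₀).source)
      (coordForm s z₀ κ K c) (coordForm s z₀ 0 K' c) where
  smooth p hp hpU := ⟨_, isOpen_coframeChartDomain z₀ h.isOpen,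
    F1_mem_coframeChartDomain hp hpU.1 hpU.2, isSmoothFormOn_coordForm h z₀ κ K c,
    isSmoothFormOn_coordForm h z₀ 0 K' c⟩
  fibre z hz u g X hF hc hu h0 hX := coordForm_fibre hd hz.2 hF hc hu h0 hX
  symm p hp hpU v i j := by
    have e := coordForm_zero_apply (s := s) K' c hpU.2 v
    rw [e]
    exact (hd.torsionForm _).1 _ _ _
  wedge_om p hp hpU v w i j k := by
    have e := coordForm_zero_apply (s := s) K' c hpU.2 v
    have e' := coordForm_zero_apply (s := s) K' c hpU.2 w
    rw [e, e']
    exact (hd.torsionForm _).2 _ _ _ _ _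
  structure_eq p hp hpU v hv w hw := coordForm_structure_eq hd h hp hpU.1 hpU.2 hv hw

end LocalConnection

/-! ### Partitions of unity and gluing of one-forms -/

section Gluing

variable {E H M F : Type*} [NormedAddCommGroup E] [NormedSpace ℝ E] [TopologicalSpace H]
  [TopologicalSpace M] [ChartedSpace H M] [NormedAddCommGroup F] [NormedSpace ℝ F]
  {I : ModelWithCorners ℝ E H} {ι : Type*}

/-- Smooth partitions of unity on the union of a family of open sets. -/
theorem exists_smooth_partition [FiniteDimensional ℝ E] [IsManifold I ∞ M] [T2Space M]
    [SecondCountableTopology M] (U : ι → Set M) (hU : ∀ i, IsOpen (U i)) :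
    ∃ g : ι → M → ℝ, (∀ i, ∀ z ∈ ⋃ i, U i, ContMDiffAt I 𝓘(ℝ, ℝ) ∞ (g i) z) ∧
      ∀ z ∈ ⋃ i, U i, ∃ s : Finset ι, (∀ i ∈ s, z ∈ U i) ∧ ∑ i ∈ s, g i z = 1 ∧
        ∀ᶠ x in 𝓝 z, ∀ i, i ∉ s → g i x = 0 := by
  classical
  -- The `U i` need not cover `M`. The partition lives on the open submanifold `W` and is extended
  -- by zero, with smoothness claimed only at points of `W`.
  let W : TopologicalSpace.Opens M := ⟨⋃ i, U i, isOpen_iUnion hU⟩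
  have : LocallyCompactSpace M := Manifold.locallyCompact_of_finiteDimensional I
  have : LocallyCompactSpace W := W.isOpen.locallyCompactSpace
  obtain ⟨f, hf⟩ := SmoothPartitionOfUnity.exists_isSubordinate I (isClosed_univ (X := W))
    (fun i => Subtype.val ⁻¹' U i) (fun i => (hU i).preimage continuous_subtype_val) (by
      rintro ⟨x, hx⟩ -
      obtain ⟨i, hi⟩ := mem_iUnion.1 hx
      exact mem_iUnion.2 ⟨i, hi⟩)
  let g : ι → M → ℝ := fun i x => if h : x ∈ W then f i ⟨x, h⟩ else 0
  have hg : ∀ i, (fun x : W => g i x) = f i := fun i => by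
    ext x; simp [g]
  refine ⟨g, fun i z hz => ?_, fun z hz => ?_⟩
  · have h1 : ContMDiffAt I 𝓘(ℝ, ℝ) ∞ (fun x : W => g i x) ⟨z, hz⟩ := by
      rw [hg]; exact (f i).contMDiff.contMDiffAt
    exact contMDiffAt_subtype_iff.1 h1
  · have hzz : (⟨z, hz⟩ : W) ∈ univ := mem_univ _
    -- `fintsupport` uses closed supports, so it contains every index active near the point and
    -- still gives `z ∈ U i`.
    refine ⟨f.fintsupport ⟨z, hz⟩, fun i hi => hf i ((f.mem_fintsupport_iff _ i).1 hi), ?_, ?_⟩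
    · have h1 := f.sum_finsupport' (x₀ := (⟨z, hz⟩ : W)) hzz (f.finsupport_subset_fintsupport _)
      rw [← h1]
      exact Finset.sum_congr rfl fun i _ => congrFun (hg i) ⟨z, hz⟩
    · have h1 := f.eventually_fintsupport_subset (x₀ := (⟨z, hz⟩ : W))
      have h2 : ∀ᶠ x : W in 𝓝 ⟨z, hz⟩, ∀ i, i ∉ f.fintsupport ⟨z, hz⟩ → g i x = 0 := by
        filter_upwards [h1] with y hy i hi
        have h3 : i ∉ f.fintsupport y := fun h => hi (hy h)
        rw [f.mem_fintsupport_iff] at h3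
        exact (congrFun (hg i) y).trans (image_eq_zero_of_notMem_tsupport h3)
      have h4 : Filter.map (Subtype.val : W → M) (𝓝 ⟨z, hz⟩) = 𝓝 z :=
        W.isOpen.isOpenEmbedding_subtypeVal.map_nhds_eq _
      rw [← h4]
      exact h2

/-- Locally finite linear combinations of one-forms. -/
noncomputable def gluedForm (ρ : ι → M → ℝ) (η : ι → ∀ x : M, TangentSpace I x →L[ℝ] F) (x : M) :
    TangentSpace I x →L[ℝ] F := ∑ᶠ i, ρ i x • η i x

lemma gluedForm_eq_sum {ρ : ι → M → ℝ} {s : Finset ι} {x : M} (h : ∀ i, i ∉ s → ρ i x = 0)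
    (η : ι → ∀ x : M, TangentSpace I x →L[ℝ] F) :
    gluedForm ρ η x = ∑ i ∈ s, ρ i x • η i x := by
  refine finsum_eq_sum_of_support_subset _ fun i hi => ?_
  by_contra his
  exact hi (by simp [h i his])

lemma gluedForm_apply {ρ : ι → M → ℝ} {s : Finset ι} {x : M} (h : ∀ i, i ∉ s → ρ i x = 0)
    (η : ι → ∀ x : M, TangentSpace I x →L[ℝ] F) (v : TangentSpace I x) :
    gluedForm ρ η x v = ∑ i ∈ s, ρ i x • η i x v := by
  rw [gluedForm_eq_sum h]
  simp

lemma map_gluedForm {F' : Type*} [NormedAddCommGroup F'] [NormedSpace ℝ F'] {ρ : ι → M → ℝ}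
    {s : Finset ι} {x : M} (h : ∀ i, i ∉ s → ρ i x = 0)
    (η : ι → ∀ x : M, TangentSpace I x →L[ℝ] F) (v : TangentSpace I x) (f : F → F')
    (hadd : ∀ a b, f (a + b) = f a + f b) (hsmul : ∀ (c : ℝ) a, f (c • a) = c • f a) :
    f (gluedForm ρ η x v) = ∑ i ∈ s, ρ i x • f (η i x v) := by
  let L : F →ₗ[ℝ] F' := ⟨⟨f, hadd⟩, hsmul⟩
  change L _ = ∑ i ∈ s, ρ i x • L (η i x v)
  rw [gluedForm_apply h]
  simp

/-- Weights with sum one keep a common value; this preserves the Maurer–Cartan condition on the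
fibres. -/
lemma gluedForm_const {ρ : ι → M → ℝ}
    {s : Finset ι} {x : M} (h : ∀ i, i ∉ s → ρ i x = 0) (h1 : ∑ i ∈ s, ρ i x = 1)
    (η : ι → ∀ x : M, TangentSpace I x →L[ℝ] F) {v : TangentSpace I x} {a : F}
    (ha : ∀ i ∈ s, η i x v = a) : gluedForm ρ η x v = a := by
  rw [gluedForm_apply h, Finset.sum_congr rfl fun i hi => by rw [ha i hi], ← Finset.sum_smul, h1,
    one_smul]

lemma contMDiffAt_gluedForm [IsManifold I ∞ M] {ρ : ι → M → ℝ} {s : Finset ι} {x : M}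
    {η : ι → ∀ x : M, TangentSpace I x →L[ℝ] F}
    (hρ : ∀ i ∈ s, ContMDiffAt I 𝓘(ℝ, ℝ) ∞ (ρ i) x)
    (hη : ∀ i ∈ s, ContMDiffAt I (I.prod 𝓘(ℝ, E →L[ℝ] F)) ∞
      (fun x => TotalSpace.mk' (E →L[ℝ] F)
        (E := fun x : M => TangentSpace I x →L[ℝ] Bundle.Trivial M F x) x (η i x)) x)
    (h0 : ∀ᶠ y in 𝓝 x, ∀ i, i ∉ s → ρ i y = 0) :
    ContMDiffAt I (I.prod 𝓘(ℝ, E →L[ℝ] F)) ∞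
      (fun x => TotalSpace.mk' (E →L[ℝ] F)
        (E := fun x : M => TangentSpace I x →L[ℝ] Bundle.Trivial M F x) x (gluedForm ρ η x)) x := by
  have h1 := ContMDiffAt.sum_section (I := I) (F := E →L[ℝ] F)
    (V := fun x : M => TangentSpace I x →L[ℝ] Bundle.Trivial M F x) (s := s)
    (t := fun i x => ρ i x • η i x) (n := ∞) (x₀ := x)
    fun i hi => (hρ i hi).smul_section (hη i hi)
  refine h1.congr_of_eventuallyEq ?_
  filter_upwards [h0] with y hy
  exact congrArg _ (gluedForm_eq_sum hy η)

lemma isSmoothFormOn_gluedForm [IsManifold I ∞ M] {ρ : ι → M → ℝ} {O : Set M}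
    {η : ι → ∀ x : M, TangentSpace I x →L[ℝ] F} (h : ∀ x ∈ O, ∃ s : Finset ι,
      (∀ i ∈ s, ContMDiffAt I 𝓘(ℝ, ℝ) ∞ (ρ i) x) ∧
      (∀ i ∈ s, ∃ O' : Set M, IsOpen O' ∧ x ∈ O' ∧ IsSmoothFormOn I (η i) O') ∧
      ∀ᶠ y in 𝓝 x, ∀ i, i ∉ s → ρ i y = 0) : IsSmoothFormOn I (gluedForm ρ η) O := by
  intro x hx
  obtain ⟨s, h1, h2, h3⟩ := h x hx
  refine (contMDiffAt_gluedForm h1 (fun i hi => ?_) h3).contMDiffWithinAt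
  obtain ⟨O', b1, b2, b3⟩ := h2 i hi
  exact b3.contMDiffAt (b1.mem_nhds b2)

end Gluing

/-! ### Gluing local pseudoconnections -/

section Globalization

variable {n : ℕ} {Y Z : Type*} [TopologicalSpace Y]
  [ChartedSpace (EuclideanSpace ℝ (Fin (2 * n + 1))) Y] [IsManifold (𝓡 (2 * n + 1)) ∞ Y]
  [TopologicalSpace Z]
  [ChartedSpace (EuclideanSpace ℝ (Fin (dimZ n))) Z] [IsManifold (𝓡 (dimZ n)) ∞ Z]
  {G : LegendrianPathGeometry n Y Z}

/-- The structure equation is affine in the pseudoconnection and in `τ`, so averaging with weights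
of sum one preserves it. -/
lemma sum_smul_structure {ι : Type*} (s : Finset ι) (r : ι → ℝ) (h1 : ∑ i ∈ s, r i = 1)
    {V : Type*} [AddCommGroup V] [Module ℝ V] (X Q : V) (a b c d : ι → V)
    (h : ∀ i ∈ s, X = Q - a i + b i + c i - d i) :
    X = Q - ∑ i ∈ s, r i • a i + ∑ i ∈ s, r i • b i + ∑ i ∈ s, r i • c i - ∑ i ∈ s, r i • d i := by
  have e : ∑ i ∈ s, r i • X = ∑ i ∈ s, r i • (Q - a i + b i + c i - d i) :=
    Finset.sum_congr rfl fun i hi => by rw [← h i hi]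
  simp only [smul_sub, smul_add, Finset.sum_sub_distrib, Finset.sum_add_distrib,
    ← Finset.sum_smul, h1, one_smul] at e
  exact e

lemma infAct_gluedForm {ι : Type*} {ρ : ι → CoframeSpace n Z → ℝ} {s : Finset ι}
    {p : CoframeSpace n Z} (h : ∀ i, i ∉ s → ρ i p = 0)
    (φ : ι → ∀ p : CoframeSpace n Z, TangentSpace (modelCo n) p →L[ℝ] H1Space n)
    (u : TangentSpace (modelCo n) p) (a : CoV n) :
    infAct (gluedForm (I := modelCo n) (F := H1Space n) ρ φ p u) a =
      ∑ m ∈ s, ρ m p • infAct (φ m p u) a :=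
  map_gluedForm (I := modelCo n) (F := H1Space n) h φ u (fun t => infAct t a)
    (fun x y => LinearMap.congr_fun (infAct.map_add x y) a)
    (fun c x => LinearMap.congr_fun (infAct.map_smul c x) a)

lemma tauAct_gluedForm {ι : Type*} {ρ : ι → CoframeSpace n Z → ℝ} {s : Finset ι}
    {p : CoframeSpace n Z} (h : ∀ i, i ∉ s → ρ i p = 0)
    (τ : ι → ∀ p : CoframeSpace n Z,
      TangentSpace (modelCo n) p →L[ℝ] (Fin n → Fin n → symMat n))
    (u : TangentSpace (modelCo n) p) (a : CoV n) :
    tauAct (gluedForm (I := modelCo n) (F := Fin n → Fin n → symMat n) ρ τ p u) a =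
      ∑ m ∈ s, ρ m p • tauAct (τ m p u) a :=
  map_gluedForm (I := modelCo n) (F := Fin n → Fin n → symMat n) h τ u (fun t => tauAct t a)
    (fun x y => LinearMap.congr_fun (tauAct.map_add x y) a)
    (fun c x => LinearMap.congr_fun (tauAct.map_smul c x) a)

set_option maxHeartbeats 1000000 in
/-- Pseudoconnections that satisfy the structure equations can be glued by a partition of unity. -/
theorem exists_isConnectionOver_iUnion [T2Space Z] [SecondCountableTopology Z] {ι : Type*}
    {U : ι → Set Z} (hU : ∀ i, IsOpen (U i))
    {φ : ι → ∀ p : CoframeSpace n Z, TangentSpace (modelCo n) p →L[ℝ] H1Space n}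
    {τ : ι → ∀ p : CoframeSpace n Z,
      TangentSpace (modelCo n) p →L[ℝ] (Fin n → Fin n → symMat n)}
    (h : ∀ i, IsConnectionOver G (U i) (φ i) (τ i)) :
    ∃ φ' τ', IsConnectionOver G (⋃ i, U i) φ' τ' := by
  obtain ⟨g, hgs, hg⟩ := exists_smooth_partition (I := 𝓡 (dimZ n)) U hU
  let ρ : ι → CoframeSpace n Z → ℝ := fun i p => g i p.proj
  have hρ : ∀ p : CoframeSpace n Z, p.proj ∈ ⋃ i, U i → ∃ s : Finset ι, (∀ i ∈ s, p.proj ∈ U i) ∧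
      ∑ i ∈ s, ρ i p = 1 ∧ ∀ᶠ q in 𝓝 p, ∀ i, i ∉ s → ρ i q = 0 := by
    intro p hp
    obtain ⟨s, h1, h2, h3⟩ := hg p.proj hp
    have hc : ContinuousAt (fun q : CoframeSpace n Z => q.proj) p :=
      contMDiff_coframe_proj.continuous.continuousAt
    exact ⟨s, h1, h2, hc.eventually h3⟩
  have hρs : ∀ i (p : CoframeSpace n Z), p.proj ∈ ⋃ i, U i →
      ContMDiffAt (modelCo n) 𝓘(ℝ, ℝ) ∞ (ρ i) p := fun i p hp =>
    (hgs i p.proj hp).comp p contMDiff_coframe_proj.contMDiffAt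
  refine ⟨gluedForm (I := modelCo n) (F := H1Space n) ρ φ,
    gluedForm (I := modelCo n) (F := Fin n → Fin n → symMat n) ρ τ, ?_, ?_, ?_, ?_, ?_⟩
  · intro p hp hpU
    obtain ⟨s, h1, h2, h3⟩ := hρ p hpU
    have hO : ∀ᶠ q in 𝓝 p, ∀ i ∈ s, ∃ O : Set (CoframeSpace n Z), IsOpen O ∧ q ∈ O ∧
        IsSmoothFormOn (modelCo n) (φ i) O ∧ IsSmoothFormOn (modelCo n) (τ i) O := by
      refine (Filter.eventually_all_finset s).2 fun i hi => ?_
      obtain ⟨O, hO, hpO, e⟩ := (h i).smooth p hp (h1 i hi)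
      filter_upwards [hO.mem_nhds hpO] with q hq using ⟨O, hO, hq, e⟩
    have hW : ∀ᶠ q : CoframeSpace n Z in 𝓝 p, q.proj ∈ ⋃ i, U i :=
      contMDiff_coframe_proj.continuous.continuousAt.eventually
        ((isOpen_iUnion hU).mem_nhds hpU)
    obtain ⟨O, hOsub, hO', hpO⟩ := mem_nhds_iff.1 (hO.and (hW.and h3.eventually_nhds))
    refine ⟨O, hO', hpO, ?_, ?_⟩
    · refine isSmoothFormOn_gluedForm (I := modelCo n) (F := H1Space n) fun q hq => ?_
      obtain ⟨a1, a2, a3⟩ := hOsub hq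
      exact ⟨s, fun i _ => hρs i q a2,
        fun i hi => (a1 i hi).imp fun _ e => ⟨e.1, e.2.1, e.2.2.1⟩, a3⟩
    · refine isSmoothFormOn_gluedForm (I := modelCo n) (F := Fin n → Fin n → symMat n)
        fun q hq => ?_
      obtain ⟨a1, a2, a3⟩ := hOsub hq
      exact ⟨s, fun i _ => hρs i q a2,
        fun i hi => (a1 i hi).imp fun _ e => ⟨e.1, e.2.1, e.2.2.2⟩, a3⟩
  · intro z hz u a X hF hc hu h0 hX
    obtain ⟨s, h1, h2, h3⟩ := hρ ⟨z, u 0⟩ hz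
    have e := gluedForm_const (I := modelCo n) (F := H1Space n) h3.self_of_nhds h2 φ
      (v := mfderiv 𝓘(ℝ, ℝ) (modelCo n) (fun t => (⟨z, u t⟩ : CoframeSpace n Z)) 0 (1 : ℝ))
      (a := -X) fun i hi => (h i).fibre z (h1 i hi) u a X hF hc hu h0 hX
    exact e
  · intro p hp hpU v i j
    obtain ⟨s, h1, h2, h3⟩ := hρ p hpU
    have key : ∀ i j k l, (gluedForm ρ τ p v i j).1 k l =
        ∑ m ∈ s, ρ m p • (τ m p v i j).1 k l := fun i j k l =>
      map_gluedForm (F := Fin n → Fin n → symMat n) h3.self_of_nhds τ v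
        (fun t => (t i j).1 k l) (fun _ _ => rfl) (fun _ _ => rfl)
    refine Subtype.ext (funext fun k => funext fun l => ?_)
    rw [key, key]
    exact Finset.sum_congr rfl fun m hm => by rw [(h m).symm p hp (h1 m hm)]
  · intro p hp hpU v w i j k
    obtain ⟨s, h1, h2, h3⟩ := hρ p hpU
    have key : ∀ v i j k l, (gluedForm ρ τ p v i j).1 k l =
        ∑ m ∈ s, ρ m p • (τ m p v i j).1 k l := fun v i j k l =>
      map_gluedForm (F := Fin n → Fin n → symMat n) h3.self_of_nhds τ v
        (fun t => (t i j).1 k l) (fun _ _ => rfl) (fun _ _ => rfl)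
    simp only [key, Finset.sum_mul, ← Finset.sum_sub_distrib]
    rw [Finset.sum_comm]
    refine Finset.sum_eq_zero fun m hm => ?_
    have e := congrArg (ρ m p * ·) ((h m).wedge_om p hp (h1 m hm) v w i j k)
    simp only [Finset.mul_sum, mul_zero] at e
    rw [← e]
    exact Finset.sum_congr rfl fun l _ => by simp only [smul_eq_mul]; ring
  · intro p hp hpU v hv w hw
    obtain ⟨s, h1, h2, h3⟩ := hρ p hpU
    have kφ := fun u a => infAct_gluedForm h3.self_of_nhds φ u a
    have kτ := fun u a => tauAct_gluedForm h3.self_of_nhds τ u a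
    rw [kφ, kφ, kτ, kτ]
    exact sum_smul_structure s _ h2 _ _ _ _ _ _ fun m hm =>
      (h m).structure_eq p hp (h1 m hm) v hv w hw

end Globalization

theorem proposition1 (n : ℕ) (hn : 2 ≤ n)
    {Y : Type*} [TopologicalSpace Y] [T2Space Y] [SecondCountableTopology Y]
    [ChartedSpace (EuclideanSpace ℝ (Fin (2 * n + 1))) Y] [IsManifold (𝓡 (2 * n + 1)) ∞ Y]
    {Z : Type*} [TopologicalSpace Z] [T2Space Z] [SecondCountableTopology Z]
    [ChartedSpace (EuclideanSpace ℝ (Fin (dimZ n))) Z] [IsManifold (𝓡 (dimZ n)) ∞ Z]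
    (G : LegendrianPathGeometry n Y Z) :
    ∃ (φ : ∀ p : CoframeSpace n Z, TangentSpace (modelCo n) p →L[ℝ] H1Space n)
      (τ : ∀ p : CoframeSpace n Z,
        TangentSpace (modelCo n) p →L[ℝ] (Fin n → Fin n → symMat n)),
      IsPseudoConnection G φ ∧
      IsSmoothFormOnSubset (modelCo n) τ (F1 G) ∧
      ∀ p ∈ F1 G, ∀ v ∈ tangentVectors (modelCo n) (F1 G) p,
        (∀ i j, τ p v i j = τ p v j i) ∧
        ∀ w ∈ tangentVectors (modelCo n) (F1 G) p,
          (∀ i j k, ∑ l, wedge (fun x => (τ p x i j).1 k l)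
            (fun x => coOm l (taut n p x)) v w = 0) ∧
          StructureEquations p (φ p) (τ p) v w := by
  obtain ⟨κ, K, K', c, hd⟩ := exists_isConnectionData n
  -- The index set consists of all adapted fields with a marked point. By definition each point of
  -- `F1` is a value of such a field, so `F1` lies over the union of the domains, and adapted
  -- coframes need not exist over the rest of `Z`.
  let ι := {a : Z × Set Z × (∀ z : Z, TangentSpace (𝓡 (dimZ n)) z →L[ℝ] CoV n) //
    a.1 ∈ a.2.1 ∧ IsAdaptedCoframeField G a.2.1 a.2.2}
  let U : ι → Set Z := fun a => a.1.2.1 ∩ (extChartAt (𝓡 (dimZ n)) a.1.1).source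
  have hU : ∀ a, IsOpen (U a) := fun a => a.2.2.isOpen.inter (isOpen_extChartAt_source _)
  obtain ⟨φ, τ, h⟩ := exists_isConnectionOver_iUnion hU
    fun a : ι => a.2.2.isConnectionOver a.1.1 hd
  have hF : ∀ p ∈ F1 G, p.proj ∈ ⋃ a, U a := by
    rintro p ⟨U', s, hp, hs, -⟩
    exact mem_iUnion.2 ⟨⟨(p.proj, U', s), hp, hs⟩, hp, mem_extChartAt_source _⟩
  refine ⟨φ, τ, ⟨fun p hp => ?_, fun z u a X hu => h.fibre z (hF _ (hu 0)) u a X hu⟩,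
    fun p hp => ?_, fun p hp v hv => ⟨h.symm p hp (hF p hp) v, fun w hw => ⟨fun i j k => ?_,
      StructureEquations.of_eq (h.structure_eq p hp (hF p hp) v hv w hw)⟩⟩⟩
  -- The form is already smooth on an open set of the ambient coframe space and is its own
  -- extension.
  · obtain ⟨O, hO, hpO, h1, -⟩ := h.smooth p hp (hF p hp)
    exact ⟨O, hO, hpO, φ, h1, fun _ _ _ _ => rfl⟩
  · obtain ⟨O, hO, hpO, -, h1⟩ := h.smooth p hp (hF p hp)
    exact ⟨O, hO, hpO, τ, h1, fun _ _ _ _ => rfl⟩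
  · rw [← h.wedge_om p hp (hF p hp) v w i j k]
    exact Finset.sum_congr rfl fun l _ => by simp only [wedge]
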